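/- Let $d\in\mathbb N$, $0<\varepsilon\le 1$ and $\langle z\rangle=\sqrt{1+|z|^2}$. **Symbols.** For $\mathbf d=(d_1,\dots,d_J)$ and $\mathbf m\in\mathbb R^J$, $S[\mathbf m;\mathbf d]$ is the space of smooth functions $u(z_1,\dots,z_J)$ on $\mathbb R^{d_1}\times\dots\times\mathbb R^{d_J}$ such that $\prod_j\langle z_j\rangle^{-m_j}\,\partial^\alpha u$ is bounded for every multi-index $\alpha$; it is a Fréchet space for the corresponding sup-seminorms. Put $S[+\infty;4d]=\bigcup_m S[m;4d]$, $S[(+\infty,m^p);(3d,d)]=\bigcup_m S[(m,m^p);(3d,d)]$ and $S[(+\infty,-\infty);(2d,2d)]=\bigcup_m\bigcap_{m'}S[(m,m');(2d,2d)]$, where the $4d$ variables are $(x,y,q,p)$, $x,y,q,p\in\mathbb R^d$, split in this order. **Data.** Let $\kappa=(X,\Xi):\mathbb R^d\times\mathbb R^d\to\mathbb R^d\times\mathbb R^d$ be a canonical transformation (a smooth diffeomorphism whose Jacobian matrix $F^\kappa(q,p)$ is symplectic at every point) of class $\mathcal B$, i.e. $F^\kappa\in S[0;2d]$. Let $S^\kappa$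 be an action associated with $\kappa$: a real-valued differentiable function with $dS^\kappa=-p\cdot dq+\Xi\cdot dX$. Let $\Theta^x,\Theta^y$ be complex symmetric $d\times d$ matrices with positive definite real parts, and set, with $X=X(q,p)$ and $\Xi=\Xi(q,p)$, $$\Phi(x,y,q,p)=S^\kappa(q,p)+\Xi\cdot(x-X)-p\cdot(y-q)+\tfrac i2(x-X)\cdot\Theta^x(x-X)+\tfrac i2(y-q)\cdot\Theta^y(y-q).$$ **Operator.** For $u\in S[(+\infty,m^p);(3d,d)]$, $\varphi\in\mathcal S(\mathbb R^d;\mathbb C)$ and an integer $k\ge 1$ with $k>m^p+d$, let $$[\mathcal I^\varepsilon(\kappa;u;\Theta^x,\Theta^y)\varphi](x)=\frac1{(2\pi\varepsilon)^{3d/2}}\int_{\mathbb R^{3d}}e^{\frac i\varepsilon\Phi(x,y,q,p)}\,(L_y^\dagger)^k\big[u(x,y,q,p)\varphi(y)\big]\,dq\,dp\,dy,$$ where $L_y=(1+|\nabla_y\Phi|^2)^{-1}\big(1-i\varepsilon\,\overline{\nabla_y\Phi}\cdot\nabla_y\big)$ and $L_y^\dagger v=\frac{v}{1+|\nabla_y\Phi|^2}+i\varepsilon\,\mathrm{div}_y\Big(\frac{\overline{\nabla_y\Phi}\,v}{1+|\nabla_y\Phi|^2}\Big)$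 is its transpose. The integral converges absolutely and does not depend on the choice of $(m^p,k)$; since $S[+\infty;4d]=\bigcup_{m^p}S[(+\infty,m^p);(3d,d)]$, this defines $\mathcal I^\varepsilon(\kappa;u;\Theta^x,\Theta^y)$ for all $u\in S[+\infty;4d]$. **Theorem.** 1. If $u\in S[+\infty;4d]$, then $\mathcal I^\varepsilon(\kappa;u;\Theta^x,\Theta^y)$ maps $\mathcal S(\mathbb R^d;\mathbb C)$ continuously into itself, and it extends by duality (as the dual map of a continuous operator on $\mathcal S(\mathbb R^d;\mathbb C)$) to a continuous linear operator from $\mathcal S'(\mathbb R^d;\mathbb C)$ into itself. 2. For all $m^x,m^y,m^q,m^p\in\mathbb R$, the map $u\mapsto\mathcal I^\varepsilon(\kappa;u;\Theta^x,\Theta^y)$ from $S[(m^x,m^y,m^q,m^p);(d,d,d,d)]$ to the space of continuous linear operators on $\mathcal S(\mathbb R^d;\mathbb C)$, with the topology of uniform convergence on bounded sets, is linear and continuous. 3. If $u\in S[(+\infty,-\infty);(2d,2d)]$, then $\mathcal I^\varepsilon(\kappa;u;\Theta^x,\Theta^y)$ is smoothing: its extension to $\mathcal S'(\mathbb R^d;\mathbb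 C)$ takes values in $\mathcal S(\mathbb R^d;\mathbb C)$, and it is continuous from $\mathcal S'(\mathbb R^d;\mathbb C)$ with the strong dual topology to $\mathcal S(\mathbb R^d;\mathbb C)$. -/

import Mathlib

open scoped ContDiff SchwartzMap

noncomputable section

namespace CplxFourier

section Symbols

variable {V F ι : Type*} [NormedAddCommGroup V] [NormedSpace ℝ V]
  [NormedAddCommGroup F] [NormedSpace ℝ F] [Fintype ι]

/-- The weight `∏ⱼ ⟨zⱼ⟩ ^ (-mⱼ)`, where `⟨t⟩ = √(1 + |t|²)` and `n j z = |zⱼ|²` is the squared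
Euclidean length of the `j`-th block of the variable `z`. -/
def symbolWeight (n : ι → V → ℝ) (m : ι → ℝ) (z : V) : ℝ :=
  ∏ j, Real.sqrt (1 + n j z) ^ (-m j)

/-- Symbols of order `m` (finite orders): smooth functions whose derivatives of every order `k` are
bounded by a constant times `∏ⱼ ⟨zⱼ⟩ ^ mⱼ`. -/
def IsSymbol (n : ι → V → ℝ) (m : ι → ℝ) (u : V → F) : Prop :=
  ContDiff ℝ ∞ u ∧
    ∀ k : ℕ, BddAbove (Set.range fun z => symbolWeight n m z * ‖iteratedFDeriv ℝ k u z‖)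

set_option linter.unusedSectionVars false in
theorem symbolWeight_nonneg (n : ι → V → ℝ) (m : ι → ℝ) (z : V) : 0 ≤ symbolWeight n m z :=
  Finset.prod_nonneg fun _ _ => Real.rpow_nonneg (Real.sqrt_nonneg _) _

theorem weighted_add_le (n : ι → V → ℝ) (m : ι → ℝ) {u v : V → F} (hu : ContDiff ℝ ∞ u)
    (hv : ContDiff ℝ ∞ v) (k : ℕ) (z : V) :
    symbolWeight n m z * ‖iteratedFDeriv ℝ k (u + v) z‖ ≤
      symbolWeight n m z * ‖iteratedFDeriv ℝ k u z‖ +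
        symbolWeight n m z * ‖iteratedFDeriv ℝ k v z‖ := by
  have hk : ((k : ℕ∞) : WithTop ℕ∞) ≤ ∞ := by exact_mod_cast le_top
  rw [iteratedFDeriv_add_apply (hu.of_le hk).contDiffAt (hv.of_le hk).contDiffAt, ← mul_add]
  exact mul_le_mul_of_nonneg_left (norm_add_le _ _) (symbolWeight_nonneg n m z)

theorem weighted_smul (n : ι → V → ℝ) (m : ι → ℝ) (c : ℂ) {u : V → ℂ} (hu : ContDiff ℝ ∞ u)
    (k : ℕ) (z : V) :
    symbolWeight n m z * ‖iteratedFDeriv ℝ k (c • u) z‖ =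
      ‖c‖ * (symbolWeight n m z * ‖iteratedFDeriv ℝ k u z‖) := by
  have hk : ((k : ℕ∞) : WithTop ℕ∞) ≤ ∞ := by exact_mod_cast le_top
  rw [iteratedFDeriv_const_smul_apply (hu.of_le hk).contDiffAt, norm_smul]
  ring

/-- The complex-valued symbols of order `m` as a subspace of all functions. -/
def symbolSubmodule (n : ι → V → ℝ) (m : ι → ℝ) : Submodule ℂ (V → ℂ) where
  carrier := {u | IsSymbol n m u}
  zero_mem' := by
    refine ⟨contDiff_const, fun k => ⟨0, ?_⟩⟩
    rintro _ ⟨z, rfl⟩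
    have h : iteratedFDeriv ℝ k (0 : V → ℂ) z = 0 := by
      rw [show (0 : V → ℂ) = fun _ => 0 from rfl, iteratedFDeriv_fun_zero]; rfl
    simp [h]
  add_mem' := by
    rintro u v ⟨hu, hu'⟩ ⟨hv, hv'⟩
    refine ⟨hu.add hv, fun k => ?_⟩
    obtain ⟨A, hA⟩ := hu' k
    obtain ⟨B, hB⟩ := hv' k
    refine ⟨A + B, ?_⟩
    rintro _ ⟨z, rfl⟩
    exact (weighted_add_le n m hu hv k z).trans (add_le_add (hA ⟨z, rfl⟩) (hB ⟨z, rfl⟩))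
  smul_mem' := by
    rintro c u ⟨hu, hu'⟩
    refine ⟨contDiff_const.smul hu, fun k => ?_⟩
    obtain ⟨A, hA⟩ := hu' k
    refine ⟨‖c‖ * A, ?_⟩
    rintro _ ⟨z, rfl⟩
    exact (weighted_smul n m c hu k z).trans_le
      (mul_le_mul_of_nonneg_left (hA ⟨z, rfl⟩) (norm_nonneg c))

/-- The space of complex-valued symbols of (finite) order `m`, with the topology of the seminorms
`symbolSeminorm` below. (A `def`, so that it does not inherit the topology of pointwise
convergence.) -/
def SymbolSpace (n : ι → V → ℝ) (m : ι → ℝ) : Type _ := symbolSubmodule n m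

instance (n : ι → V → ℝ) (m : ι → ℝ) : AddCommGroup (SymbolSpace n m) :=
  inferInstanceAs (AddCommGroup (symbolSubmodule n m))

instance (n : ι → V → ℝ) (m : ι → ℝ) : Module ℂ (SymbolSpace n m) :=
  inferInstanceAs (Module ℂ (symbolSubmodule n m))

/-- The function underlying a symbol. -/
def SymbolSpace.val {n : ι → V → ℝ} {m : ι → ℝ} (u : SymbolSpace n m) : V → ℂ := Subtype.val u

theorem SymbolSpace.isSymbol {n : ι → V → ℝ} {m : ι → ℝ} (u : SymbolSpace n m) :
    IsSymbol n m u.val := Subtype.property u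

/-- The seminorm `M_k[u] = sup_z ∏ⱼ ⟨zⱼ⟩ ^ (-mⱼ) |D^k u(z)|`. -/
def symbolSeminorm (n : ι → V → ℝ) (m : ι → ℝ) (k : ℕ) : Seminorm ℂ (SymbolSpace n m) :=
  Seminorm.of (fun u => ⨆ z, symbolWeight n m z * ‖iteratedFDeriv ℝ k u.val z‖)
    (fun u v => ciSup_le fun z =>
      (weighted_add_le n m u.isSymbol.1 v.isSymbol.1 k z).trans
        (add_le_add (le_ciSup (u.isSymbol.2 k) z) (le_ciSup (v.isSymbol.2 k) z)))
    (fun c u => by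
      rw [Real.mul_iSup_of_nonneg (norm_nonneg c)]
      exact iSup_congr fun z => weighted_smul n m c u.isSymbol.1 k z)

instance (n : ι → V → ℝ) (m : ι → ℝ) : TopologicalSpace (SymbolSpace n m) :=
  SeminormFamily.moduleFilterBasis (𝕜 := ℂ) (symbolSeminorm n m) |>.topology

end Symbols

/-- `ℝ^d` with its Euclidean structure. -/
abbrev E (d : ℕ) : Type := EuclideanSpace ℝ (Fin d)

/-- The variables `(x, y, q, p)`. -/
abbrev E4 (d : ℕ) : Type := E d × E d × E d × E d

variable {d : ℕ}

/-- One block: `((q, p))`. -/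
def blocksQP (d : ℕ) : Fin 1 → E d × E d → ℝ := ![fun z => ‖z.1‖ ^ 2 + ‖z.2‖ ^ 2]

/-- One block: `((x, y, q, p))`. -/
def blocks4d (d : ℕ) : Fin 1 → E4 d → ℝ :=
  ![fun z => ‖z.1‖ ^ 2 + ‖z.2.1‖ ^ 2 + ‖z.2.2.1‖ ^ 2 + ‖z.2.2.2‖ ^ 2]

/-- Two blocks: `((x, y, q), p)`. -/
def blocks3d1d (d : ℕ) : Fin 2 → E4 d → ℝ :=
  ![fun z => ‖z.1‖ ^ 2 + ‖z.2.1‖ ^ 2 + ‖z.2.2.1‖ ^ 2, fun z => ‖z.2.2.2‖ ^ 2]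

/-- Two blocks: `((x, y), (q, p))`. -/
def blocks2d2d (d : ℕ) : Fin 2 → E4 d → ℝ :=
  ![fun z => ‖z.1‖ ^ 2 + ‖z.2.1‖ ^ 2, fun z => ‖z.2.2.1‖ ^ 2 + ‖z.2.2.2‖ ^ 2]

/-- Four blocks: `(x, y, q, p)`. -/
def blocksDDDD (d : ℕ) : Fin 4 → E4 d → ℝ :=
  ![fun z => ‖z.1‖ ^ 2, fun z => ‖z.2.1‖ ^ 2, fun z => ‖z.2.2.1‖ ^ 2, fun z => ‖z.2.2.2‖ ^ 2]

/-- The class `S[+∞; 4d] = ⋃_m S[m; 4d]`. -/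
def IsSymbolTop (u : E4 d → ℂ) : Prop := ∃ m : ℝ, IsSymbol (blocks4d d) ![m] u

/-- The class `S[(+∞, mp); (3d, d)] = ⋃_m S[(m, mp); (3d, d)]`. -/
def IsSymbolTopFin (mp : ℝ) (u : E4 d → ℂ) : Prop :=
  ∃ m : ℝ, IsSymbol (blocks3d1d d) ![m, mp] u

/-- The class `S[(+∞, -∞); (2d, 2d)] = ⋃_m ⋂_m' S[(m, m'); (2d, 2d)]`. -/
def IsSymbolTopBot (u : E4 d → ℂ) : Prop :=
  ∃ m : ℝ, ∀ m' : ℝ, IsSymbol (blocks2d2d d) ![m, m'] u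

/-- A canonical transformation: a smooth diffeomorphism `κ = (X, Ξ)` of `ℝ^d × ℝ^d` whose
differential preserves the symplectic form `(v, w) ↦ v · J w = v₁ · w₂ - v₂ · w₁`. -/
structure IsCanonical (κ : E d × E d ≃ E d × E d) : Prop where
  contDiff : ContDiff ℝ ∞ κ
  contDiff_symm : ContDiff ℝ ∞ κ.symm
  symplectic : ∀ z v w : E d × E d,
    inner ℝ (fderiv ℝ κ z v).1 (fderiv ℝ κ z w).2 - inner ℝ (fderiv ℝ κ z v).2 (fderiv ℝ κ z w).1 =
      inner ℝ v.1 w.2 - inner ℝ v.2 w.1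

/-- A canonical transformation of class `𝓑`: its differential is a symbol in `S[0; 2d]`. -/
structure IsCanonicalClassB (κ : E d × E d ≃ E d × E d) : Prop extends IsCanonical κ where
  symbol : IsSymbol (blocksQP d) ![0] (fun z => fderiv ℝ κ z)

/-- `S` is an action associated to `κ = (X, Ξ)`: `∇_q S = -p + (∂X/∂q)ᵀ Ξ` and
`∇_p S = (∂X/∂p)ᵀ Ξ`, that is, `dS = -p · dq + Ξ · dX`. -/
def IsAction (κ : E d × E d ≃ E d × E d) (S : E d × E d → ℝ) : Prop :=
  Differentiable ℝ S ∧ ∀ z v : E d × E d,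
    fderiv ℝ S z v = -inner ℝ z.2 v.1 + inner ℝ (κ z).2 (fderiv ℝ κ z v).1

/-- A complex symmetric matrix with positive definite real part. -/
def IsAdmissible (Θ : Matrix (Fin d) (Fin d) ℂ) : Prop :=
  Θ.IsSymm ∧ (Θ.map Complex.re).PosDef

/-- The complex bilinear expression `w · Θ w` at a real vector `w`. -/
def quad (Θ : Matrix (Fin d) (Fin d) ℂ) (w : E d) : ℂ := ∑ i, ∑ j, (w i : ℂ) * Θ i j * (w j : ℂ)

/-- The phase function
`Φ(x,y,q,p) = S(q,p) + Ξ·(x-X) - p·(y-q) + (i/2) (x-X)·Θx(x-X) + (i/2) (y-q)·Θy(y-q)`,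
where `(X, Ξ) = κ(q,p)`. -/
def phase (κ : E d × E d ≃ E d × E d) (S : E d × E d → ℝ) (Θx Θy : Matrix (Fin d) (Fin d) ℂ)
    (x y q p : E d) : ℂ :=
  (S (q, p) : ℂ) + ((inner ℝ (κ (q, p)).2 (x - (κ (q, p)).1) : ℝ) : ℂ) - ((inner ℝ p (y - q) : ℝ) : ℂ)
    + Complex.I / 2 * quad Θx (x - (κ (q, p)).1) + Complex.I / 2 * quad Θy (y - q)

/-- The partial derivative `∂f/∂y_j`. -/
def pderiv (j : Fin d) (f : E d → ℂ) (y : E d) : ℂ := fderiv ℝ f y (EuclideanSpace.single j 1)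

/-- For a function `f` of `y` (in the application, the phase with `x, q, p` frozen), the symmetric
`L† v = a v + i ε div (a (conj ∇f) v)`, `a = 1 / (1 + |∇f|²)`, of the first order operator
`L = a (1 - i ε (conj ∇f) · ∇)`. -/
def Ldagger (ε : ℝ) (f : E d → ℂ) (v : E d → ℂ) (y : E d) : ℂ :=
  v y / (1 + ∑ j, (‖pderiv j f y‖ : ℂ) ^ 2) +
    Complex.I * ε * ∑ j, pderiv j
      (fun y' => (starRingEnd ℂ) (pderiv j f y') * v y' / (1 + ∑ l, (‖pderiv l f y'‖ : ℂ) ^ 2)) y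

/-- The integrand `e^{iΦ/ε} (L_y†)^k [u(x,y,q,p) φ(y)]` as a function of `(q, p, y)`. -/
def oscIntegrand (κ : E d × E d ≃ E d × E d) (S : E d × E d → ℝ)
    (Θx Θy : Matrix (Fin d) (Fin d) ℂ) (ε : ℝ) (k : ℕ) (u : E4 d → ℂ) (φ : 𝓢(E d, ℂ)) (x : E d)
    (t : E d × E d × E d) : ℂ :=
  Complex.exp (Complex.I / ε * phase κ S Θx Θy x t.2.2 t.1 t.2.1) *
    (Ldagger ε (fun y => phase κ S Θx Θy x y t.1 t.2.1))^[k]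
      (fun y => u (x, y, t.1, t.2.1) * φ y) t.2.2

/-- `T` is the operator `𝓘^ε(κ; u; Θx, Θy)` on Schwartz functions: for every finite order `mp` in
`p` of the symbol `u` (there is one) and every positive integer `k > mp + d`, the defining integral
is absolutely convergent and equal to `(T φ)(x)`. -/
def IsFourierOp (κ : E d × E d ≃ E d × E d) (S : E d × E d → ℝ) (Θx Θy : Matrix (Fin d) (Fin d) ℂ)
    (ε : ℝ) (u : E4 d → ℂ) (T : 𝓢(E d, ℂ) →L[ℂ] 𝓢(E d, ℂ)) : Prop :=
  (∃ mp : ℝ, IsSymbolTopFin mp u) ∧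
    ∀ (mp : ℝ) (k : ℕ), IsSymbolTopFin mp u → 0 < k → mp + d < k →
      ∀ (φ : 𝓢(E d, ℂ)) (x : E d),
        MeasureTheory.Integrable (oscIntegrand κ S Θx Θy ε k u φ x) ∧
          T φ x = (((2 * Real.pi * ε) ^ (3 * (d : ℝ) / 2))⁻¹ : ℝ) *
            ∫ t, oscIntegrand κ S Θx Θy ε k u φ x t

/-- `T'` extends `T` to tempered distributions by duality: `T'` agrees with `T` on Schwartz
functions, and it is the dual map of a continuous operator of the Schwartz space. -/
structure IsDualExtension (T : 𝓢(E d, ℂ) →L[ℂ] 𝓢(E d, ℂ)) (T' : 𝓢'(E d, ℂ) →L[ℂ] 𝓢'(E d, ℂ)) :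
    Prop where
  agrees : ∀ φ : 𝓢(E d, ℂ), T' (φ : 𝓢'(E d, ℂ)) = (T φ : 𝓢'(E d, ℂ))
  dual : ∃ A : 𝓢(E d, ℂ) →L[ℂ] 𝓢(E d, ℂ), ∀ (f : 𝓢'(E d, ℂ)) (ψ : 𝓢(E d, ℂ)), T' f ψ = f (A ψ)

/-- The operator `T'` on tempered distributions is smoothing: it is given by a map into Schwartz
functions, continuous for the strong topology (uniform convergence on bounded sets) of `𝓢'`. -/
def IsSmoothing (T' : 𝓢'(E d, ℂ) →L[ℂ] 𝓢'(E d, ℂ)) : Prop :=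
  ∃ R : (𝓢(E d, ℂ) →L[ℂ] ℂ) →L[ℂ] 𝓢(E d, ℂ), ∀ f : 𝓢(E d, ℂ) →L[ℂ] ℂ,
    T' (ContinuousLinearMap.toPointwiseConvergenceCLM ℂ (RingHom.id ℂ) 𝓢(E d, ℂ) ℂ f) =
      (R f : 𝓢'(E d, ℂ))

end CplxFourier

end

/-! The exponential factors: `e^{iΦ/ε}` is the unimodular `e^{iS/ε}`, times a Gaussian wave packet
in `x` with phase space centre `κ(q,p)`, times a Gaussian wave packet in `y` with phase space centre
`(q,-p)` (`exp_phase_eq`). The operator is therefore a superposition over `z = (q,p)` of products of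
packets modulated by `u`. `WaveData` keeps only what the estimates need: two phase space maps `a`,
`b` whose size is comparable to that of `z`. For `κ` this holds because a bounded symplectic
Jacobian has a bounded inverse, so `κ` and its inverse are both Lipschitz
(`IsCanonicalClassB.exists_growth`).

Fix `z` and integrate in `y` against a Schwartz function `φ`. The Gaussian together with the decay
of `φ` gives decay in `q`; integration by parts along `p` against the oscillating factor gives decay
in `p`. The inner integral thus decays faster than any power of `z` (`WaveData.derivBound_inner`),
which pays for every polynomial loss: the growth of `u`, the derivatives of the `x`-packet, and the
displacement of its centre. Integrating over `z` gives a Schwartz function, with bounds that are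
products of a norm of `u` and a norm of `φ`; this yields continuity on the Schwartz space and,
uniformly on bounded sets of `φ`, continuity in `u`.

The iterated integral agrees with the defining one because `L` fixes the exponential, so its
transpose can be removed by integrating by parts in `y` (`integral_mul_gradDagger`). Absolute
convergence comes from `(1 + |∇_yΦ|²)^{-1/2} ≤ C (1 + |y - q|) / (1 + |p|)`, each power of `L†`
gaining one power of `p` (`oscIntegrand_bound`).

Exchanging the roles of `x` and `y` gives an operator of the same kind, which is the transpose
(`WaveData.integral_op_swap`); its dual map is the extension to tempered distributions. If `u`
decays rapidly in `z`, the `z`-integral of the kernel is itself a Schwartz function `K(x,y)`, and `f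
↦ f(K(x,·))` maps the strong dual continuously into the Schwartz space (`kernelMap`). -/

noncomputable section

namespace CplxFourier

/-! ### Calculus of derivative bounds, uniform over a family of functions. -/

section DerivBound

variable {ι ι' V V' F G : Type*} [NormedAddCommGroup V] [NormedSpace ℝ V]
  [NormedAddCommGroup V'] [NormedSpace ℝ V']
  [NormedAddCommGroup F] [NormedSpace ℝ F] [NormedAddCommGroup G] [NormedSpace ℝ G]

/-- A family `f i` of smooth functions whose derivatives up to order `N` are bounded, uniformly in
the parameter `i`, by a constant multiple of the weight `W i`. -/
def DerivBound (N : ℕ) (f : ι → V → F) (W : ι → V → ℝ) : Prop :=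
  (∀ i, ContDiff ℝ ∞ (f i)) ∧
    ∃ C, 0 ≤ C ∧ ∀ i v, ∀ n ≤ N, ‖iteratedFDeriv ℝ n (f i) v‖ ≤ C * W i v

theorem natCast_le_infty (n : ℕ) : ((n : ℕ∞) : WithTop ℕ∞) ≤ ∞ := by exact_mod_cast le_top

namespace DerivBound

variable {N : ℕ} {f g : ι → V → F} {W W₁ W₂ : ι → V → ℝ}

theorem of_le {M : ℕ} (h : DerivBound N f W) (hM : M ≤ N) : DerivBound M f W :=
  ⟨h.1, h.2.imp fun _ hC => ⟨hC.1, fun i v n hn => hC.2 i v n (hn.trans hM)⟩⟩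

theorem mono (h : DerivBound N f W) (K : ℝ) (hK : 0 ≤ K) (hW : ∀ i v, W i v ≤ K * W₁ i v) :
    DerivBound N f W₁ := by
  obtain ⟨hf, C, hC, hb⟩ := h
  refine ⟨hf, C * K, by positivity, fun i v n hn => (hb i v n hn).trans ?_⟩
  rw [mul_assoc]
  exact mul_le_mul_of_nonneg_left (hW i v) hC

theorem reindex (h : DerivBound N f W) (e : ι' → ι) :
    DerivBound N (fun i => f (e i)) (fun i => W (e i)) :=
  ⟨fun _ => h.1 _, h.2.imp fun _ hC => ⟨hC.1, fun _ v n hn => hC.2 _ v n hn⟩⟩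

theorem add (hf : DerivBound N f W) (hg : DerivBound N g W) :
    DerivBound N (fun i v => f i v + g i v) W := by
  obtain ⟨hf, C, hC, hb⟩ := hf
  obtain ⟨hg, C', hC', hb'⟩ := hg
  refine ⟨fun i => (hf i).add (hg i), C + C', by positivity, fun i v n hn => ?_⟩
  change ‖iteratedFDeriv ℝ n (f i + g i) v‖ ≤ _
  rw [iteratedFDeriv_add_apply ((hf i).of_le (natCast_le_infty n)).contDiffAt
      ((hg i).of_le (natCast_le_infty n)).contDiffAt, add_mul]
  exact (norm_add_le _ _).trans (add_le_add (hb i v n hn) (hb' i v n hn))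

theorem sum {J : Type*} (s : Finset J) {f : J → ι → V → F}
    (hf : ∀ j ∈ s, DerivBound N (f j) W) : DerivBound N (fun i v => ∑ j ∈ s, f j i v) W := by
  classical
  induction s using Finset.induction_on with
  | empty =>
    refine ⟨fun i => by simpa using contDiff_const, 0, le_rfl, fun i v n _ => ?_⟩
    simp only [Finset.sum_empty, zero_mul]
    rw [iteratedFDeriv_fun_zero]; simp
  | insert a s ha ih =>
    simp only [Finset.sum_insert ha]
    exact (hf a (by simp)).add (ih fun j hj => hf j (by simp [hj]))

theorem clm (h : DerivBound N f W) (L : F →L[ℝ] G) : DerivBound N (fun i v => L (f i v)) W := by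
  obtain ⟨hf, C, hC, hb⟩ := h
  refine ⟨fun i => L.contDiff.comp (hf i), ‖L‖ * C, by positivity, fun i v n hn => ?_⟩
  change ‖iteratedFDeriv ℝ n (L ∘ f i) v‖ ≤ _
  rw [L.iteratedFDeriv_comp_left ((hf i).of_le (natCast_le_infty n)).contDiffAt le_rfl, mul_assoc]
  exact (ContinuousLinearMap.norm_compContinuousMultilinearMap_le _ _).trans
    (mul_le_mul_of_nonneg_left (hb i v n hn) (norm_nonneg _))

theorem bilinear {H : Type*} [NormedAddCommGroup H] [NormedSpace ℝ H] (B : F →L[ℝ] G →L[ℝ] H)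
    {g : ι → V → G} (hf : DerivBound N f W₁) (hg : DerivBound N g W₂) :
    DerivBound N (fun i v => B (f i v) (g i v)) (fun i v => W₁ i v * W₂ i v) := by
  obtain ⟨hf, C, hC, hb⟩ := hf
  obtain ⟨hg, C', hC', hb'⟩ := hg
  refine ⟨fun i => B.isBoundedBilinearMap.contDiff.comp ((hf i).prodMk (hg i)),
    ‖B‖ * (2 ^ N * (C * C')), by positivity, fun i v n hn => ?_⟩
  refine (B.norm_iteratedFDeriv_le_of_bilinear (hf i) (hg i) v (natCast_le_infty n)).trans ?_
  have h0 : 0 ≤ C * W₁ i v := (norm_nonneg _).trans (hb i v 0 (Nat.zero_le _))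
  have h1 : 0 ≤ C' * W₂ i v := (norm_nonneg _).trans (hb' i v 0 (Nat.zero_le _))
  have key : ∑ j ∈ Finset.range (n + 1), (n.choose j : ℝ) * ‖iteratedFDeriv ℝ j (f i) v‖ *
      ‖iteratedFDeriv ℝ (n - j) (g i) v‖ ≤ 2 ^ N * ((C * W₁ i v) * (C' * W₂ i v)) := by
    calc _ ≤ ∑ j ∈ Finset.range (n + 1), (n.choose j : ℝ) * ((C * W₁ i v) * (C' * W₂ i v)) := by
          refine Finset.sum_le_sum fun j hj => ?_
          rw [mul_assoc]
          have hj' := Finset.mem_range.1 hj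
          gcongr
          · exact hb i v j (by omega)
          · exact hb' i v _ (by omega)
      _ = 2 ^ n * ((C * W₁ i v) * (C' * W₂ i v)) := by
          rw [← Finset.sum_mul]; congr 1; exact_mod_cast Nat.sum_range_choose n
      _ ≤ _ := by
          have : (2 : ℝ) ^ n ≤ 2 ^ N := pow_le_pow_right₀ (by norm_num) hn
          gcongr
  calc _ ≤ ‖B‖ * (2 ^ N * ((C * W₁ i v) * (C' * W₂ i v))) := by gcongr
    _ = _ := by ring

theorem mul {f g : ι → V → ℂ} (hf : DerivBound N f W₁) (hg : DerivBound N g W₂) :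
    DerivBound N (fun i v => f i v * g i v) (fun i v => W₁ i v * W₂ i v) :=
  bilinear (ContinuousLinearMap.mul ℝ ℂ) hf hg

theorem smul [NormedSpace ℂ F] [IsScalarTower ℝ ℂ F] {f : ι → V → ℂ} {g : ι → V → F}
    (hf : DerivBound N f W₁) (hg : DerivBound N g W₂) :
    DerivBound N (fun i v => f i v • g i v) (fun i v => W₁ i v * W₂ i v) :=
  bilinear (ContinuousLinearMap.lsmul ℝ ℂ : ℂ →L[ℝ] F →L[ℝ] F) hf hg

theorem comp_affine (h : DerivBound N f W) (L : V' →L[ℝ] V) (a : ι → V) :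
    DerivBound N (fun i v => f i (L v + a i)) (fun i v => W i (L v + a i)) := by
  obtain ⟨hf, C, hC, hb⟩ := h
  have hsm : ∀ i, ContDiff ℝ ∞ fun v => f i (v + a i) := fun i =>
    (hf i).comp (contDiff_id.add contDiff_const)
  refine ⟨fun i => (hsm i).comp L.contDiff, C * (1 + ‖L‖) ^ N, by positivity,
    fun i v n hn => ?_⟩
  change ‖iteratedFDeriv ℝ n ((fun v => f i (v + a i)) ∘ L) v‖ ≤ _
  rw [L.iteratedFDeriv_comp_right (hsm i) v (natCast_le_infty n), iteratedFDeriv_comp_add_right]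
  refine (ContinuousMultilinearMap.norm_compContinuousLinearMap_le _ _).trans ?_
  have h0 : 0 ≤ C * W i (L v + a i) := (norm_nonneg _).trans (hb i _ 0 (Nat.zero_le _))
  have h2 : ‖L‖ ^ n ≤ (1 + ‖L‖) ^ N :=
    (pow_le_pow_left₀ (norm_nonneg _) (by linarith) n).trans
      (pow_le_pow_right₀ (by linarith [norm_nonneg L]) hn)
  calc _ ≤ (C * W i (L v + a i)) * (1 + ‖L‖) ^ N := by
        rw [Finset.prod_const, Finset.card_univ, Fintype.card_fin]
        gcongr
        exact hb i _ n hn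
    _ = _ := by ring

/-- The device behind the inductions on the order: since `‖D^{n+1} f‖ = ‖D^n (Df)‖`, estimates for
exponentials and inverses follow from the product rule alone, without a formula for higher
derivatives of a composition. -/
theorem fderiv_iff : DerivBound (N + 1) f W ↔ DerivBound 0 f W ∧
    DerivBound N (fun i v => fderiv ℝ (f i) v) W := by
  constructor
  · rintro ⟨hf, C, hC, hb⟩
    refine ⟨⟨hf, C, hC, fun i v n hn => hb i v n (hn.trans (Nat.zero_le _))⟩,
      fun i => (hf i).fderiv_right (by simp), C, hC, fun i v n hn => ?_⟩
    rw [norm_iteratedFDeriv_fderiv]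
    exact hb i v (n + 1) (by omega)
  · rintro ⟨⟨hf, C, hC, hb⟩, -, C', hC', hb'⟩
    refine ⟨hf, C + C', by positivity, fun i v n hn => ?_⟩
    have h0 : 0 ≤ C * W i v := (norm_nonneg _).trans (hb i v 0 le_rfl)
    have h1 : 0 ≤ C' * W i v := (norm_nonneg _).trans (hb' i v 0 (Nat.zero_le _))
    rw [add_mul]
    rcases n with _ | n
    · exact (hb i v 0 le_rfl).trans (by linarith)
    · rw [← norm_iteratedFDeriv_fderiv]
      exact (hb' i v n (by omega)).trans (by linarith)

theorem zero_iff : DerivBound 0 f W ↔ (∀ i, ContDiff ℝ ∞ (f i)) ∧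
    ∃ C, 0 ≤ C ∧ ∀ i v, ‖f i v‖ ≤ C * W i v := by
  simp [DerivBound]

/-- The directional derivatives along a bounded family of directions. -/
theorem fderiv_apply (h : DerivBound (N + 1) f W) (v : ι → V) (hv : ∀ i, ‖v i‖ ≤ 1) :
    DerivBound N (fun i w => fderiv ℝ (f i) w (v i)) W := by
  obtain ⟨hf, C, hC, hb⟩ := (fderiv_iff.1 h).2
  refine ⟨fun i => (hf i).clm_apply contDiff_const, C, hC, fun i w n hn => ?_⟩
  refine (norm_iteratedFDeriv_clm_apply_const ((hf i).of_le (natCast_le_infty n)).contDiffAt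
    le_rfl).trans ?_
  calc _ ≤ 1 * ‖iteratedFDeriv ℝ n (fun v => fderiv ℝ (f i) v) w‖ := by
        gcongr; exact hv i
    _ ≤ _ := by rw [one_mul]; exact hb i w n hn

theorem const (c : ι → F) (w : ι → ℝ) (hc : ∀ i, ‖c i‖ ≤ w i) :
    DerivBound N (fun i (_ : V) => c i) (fun i _ => w i) := by
  refine ⟨fun i => contDiff_const, 1, zero_le_one, fun i v n _ => ?_⟩
  rcases n with _ | n
  · simpa using hc i
  · rw [iteratedFDeriv_const_of_ne (by simp)]
    simpa using (norm_nonneg _).trans (hc i)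

/-- As `D(e^h) = e^h Dh`, each derivative costs at most one factor `ρ`; the assumption `ρ ≥ 1` lets
the highest power cover all lower orders. -/
theorem cexp {h : ι → V → ℂ} {ρ : ι → V → ℝ} (hsm : ∀ i, ContDiff ℝ ∞ (h i))
    (hρ : ∀ i v, 1 ≤ ρ i v) (hh : DerivBound N (fun i v => fderiv ℝ (h i) v) ρ) :
    DerivBound N (fun i v => Complex.exp (h i v))
      (fun i v => ‖Complex.exp (h i v)‖ * ρ i v ^ N) := by
  have hE : ∀ i, ContDiff ℝ ∞ fun v => Complex.exp (h i v) := fun i => (hsm i).cexp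
  induction N with
  | zero => exact zero_iff.2 ⟨hE, 1, zero_le_one, fun i v => by simp⟩
  | succ N ih =>
    refine fderiv_iff.2 ⟨zero_iff.2 ⟨hE, 1, zero_le_one, fun i v => ?_⟩, ?_⟩
    · rw [one_mul]
      exact le_mul_of_one_le_right (norm_nonneg _) (one_le_pow₀ (hρ i v))
    · have h1 := (ih (hh.of_le (Nat.le_succ N))).smul (hh.of_le (Nat.le_succ N))
      have h2 : (fun i v => fderiv ℝ (fun v => Complex.exp (h i v)) v) =
          fun i v => Complex.exp (h i v) • fderiv ℝ (h i) v := by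
        funext i v
        exact (((hsm i).differentiable (by simp)) v).hasFDerivAt.cexp.fderiv
      rw [h2]
      refine h1.mono 1 zero_le_one fun i v => ?_
      rw [one_mul, mul_assoc, ← pow_succ]

/-- In `D(1/Q) = -Q⁻² DQ` the weight is `W⁻² W = W⁻¹`, so the same bound reproduces itself at every
order. -/
theorem inv {Q : ι → V → ℂ} {c : ℝ} (hc : 0 < c) (hW : ∀ i v, 0 < W i v)
    (hQ : DerivBound N Q W) (hlow : ∀ i v, c * W i v ≤ ‖Q i v‖) :
    DerivBound N (fun i v => (Q i v)⁻¹) (fun i v => (W i v)⁻¹) := by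
  have hne : ∀ i v, Q i v ≠ 0 := fun i v =>
    norm_pos_iff.1 ((mul_pos hc (hW i v)).trans_le (hlow i v))
  have hE : ∀ i, ContDiff ℝ ∞ fun v => (Q i v)⁻¹ := fun i => (hQ.1 i).inv (hne i)
  have h0 : ∀ i v, ‖(Q i v)⁻¹‖ ≤ c⁻¹ * (W i v)⁻¹ := fun i v => by
    rw [norm_inv, ← mul_inv]
    exact inv_anti₀ (mul_pos hc (hW i v)) (hlow i v)
  induction N with
  | zero => exact zero_iff.2 ⟨hE, c⁻¹, by positivity, h0⟩
  | succ N ih =>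
    refine fderiv_iff.2 ⟨zero_iff.2 ⟨hE, c⁻¹, by positivity, h0⟩, ?_⟩
    have ih' := ih (hQ.of_le (Nat.le_succ N))
    have h1 := ((ih'.mul ih').smul (fderiv_iff.1 hQ).2).clm
      (-ContinuousLinearMap.id ℝ (V →L[ℝ] ℂ))
    have h2 : (fun i v => fderiv ℝ (fun v => (Q i v)⁻¹) v) =
          fun i v => (-ContinuousLinearMap.id ℝ (V →L[ℝ] ℂ))
            (((Q i v)⁻¹ * (Q i v)⁻¹) • fderiv ℝ (Q i) v) := by
      funext i v
      rw [show (fun v => (Q i v)⁻¹) = fun v => Inv.inv (Q i v) from rfl]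
      have := ((hasDerivAt_inv (hne i v)).hasFDerivAt.restrictScalars ℝ).comp v
        (((hQ.1 i).differentiable (by simp)) v).hasFDerivAt
      rw [show (fun v => Inv.inv (Q i v)) = Inv.inv ∘ Q i from rfl, this.fderiv]
      ext w
      simp [pow_two]
      ring
    rw [h2]
    refine h1.mono 1 zero_le_one fun i v => ?_
    rw [one_mul, mul_assoc, inv_mul_cancel₀ (hW i v).ne', mul_one]

end DerivBound

end DerivBound


/-! ### Differentiation under the integral sign to all orders. -/

section ParametricIntegral

open MeasureTheory Filter Topology

variable {Z V F : Type*} [MeasurableSpace Z] {μ : Measure Z} [NormedAddCommGroup V]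
  [NormedSpace ℝ V] [FiniteDimensional ℝ V] [NormedAddCommGroup F] [NormedSpace ℝ F]

/-- Each directional derivative is a limit of difference quotients with step `1/n`, hence measurable
in the parameter; in finite dimension the full derivative is a finite combination of its values on a
basis. -/
theorem aestronglyMeasurable_fderiv_param {f : Z → V → F} (hd : ∀ z, Differentiable ℝ (f z))
    (hm : ∀ x, AEStronglyMeasurable (fun z => f z x) μ) (x : V) :
    AEStronglyMeasurable (fun z => fderiv ℝ (f z) x) μ := by
  have hv : ∀ v, AEStronglyMeasurable (fun z => fderiv ℝ (f z) x v) μ := by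
    intro v
    refine aestronglyMeasurable_of_tendsto_ae (u := atTop (α := ℕ))
      (f := fun n z => ((n : ℝ)) • (f z (x + ((n : ℝ))⁻¹ • v) - f z x)) (fun n => ?_) ?_
    · exact ((hm _).sub (hm _)).const_smul _
    · refine Eventually.of_forall fun z => ?_
      refine (hd z x).hasFDerivAt.lim v (c := fun n : ℕ => (n : ℝ)) ?_
      simpa using tendsto_natCast_atTop_atTop (R := ℝ)
  let b := Module.finBasis ℝ V
  have hsum : (fun z => fderiv ℝ (f z) x) = fun z => ∑ i,
      ContinuousLinearMap.smulRightL ℝ V F (LinearMap.toContinuousLinearMap (b.coord i))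
        (fderiv ℝ (f z) x (b i)) := by
    funext z
    ext v
    have := congrArg (fderiv ℝ (f z) x) (b.sum_repr v)
    rw [map_sum] at this
    rw [← this]
    simp
  rw [hsum]
  refine Finset.aestronglyMeasurable_fun_sum _ fun i _ => ?_
  exact (ContinuousLinearMap.continuous _).comp_aestronglyMeasurable (hv (b i))

theorem aestronglyMeasurable_iteratedFDeriv_param {f : Z → V → F}
    (hd : ∀ z, ContDiff ℝ ∞ (f z)) (hm : ∀ x, AEStronglyMeasurable (fun z => f z x) μ) (n : ℕ) :
    ∀ x, AEStronglyMeasurable (fun z => iteratedFDeriv ℝ n (f z) x) μ := by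
  induction n with
  | zero =>
    intro x
    simp only [iteratedFDeriv_zero_eq_comp]
    exact (LinearIsometryEquiv.continuous _).comp_aestronglyMeasurable (hm x)
  | succ n ih =>
    intro x
    simp only [iteratedFDeriv_succ_eq_comp_left]
    refine (LinearIsometryEquiv.continuous _).comp_aestronglyMeasurable
      (aestronglyMeasurable_fderiv_param (fun z => ?_) ih x)
    exact (hd z).differentiable_iteratedFDeriv (by exact_mod_cast ENat.natCast_lt_top n)

variable [CompleteSpace F]

/-- Differentiation under the integral sign, to all orders. -/
theorem contDiff_integral_param {f : Z → V → F} (hd : ∀ z, ContDiff ℝ ∞ (f z))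
    (hm : ∀ x, AEStronglyMeasurable (fun z => f z x) μ)
    (hb : ∀ n : ℕ, ∃ b : Z → ℝ, Integrable b μ ∧ ∀ z x, ‖iteratedFDeriv ℝ n (f z) x‖ ≤ b z) :
    ContDiff ℝ ∞ (fun x => ∫ z, f z x ∂μ) ∧
      ∀ n x, iteratedFDeriv ℝ n (fun x => ∫ z, f z x ∂μ) x =
        ∫ z, iteratedFDeriv ℝ n (f z) x ∂μ := by
  have hmn := aestronglyMeasurable_iteratedFDeriv_param hd hm
  have hInt : ∀ n x, Integrable (fun z => iteratedFDeriv ℝ n (f z) x) μ := fun n x => by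
    obtain ⟨b, hbi, hbb⟩ := hb n
    exact hbi.mono' (hmn n x) (Eventually.of_forall fun z => hbb z x)
  have hder : ∀ n x, HasFDerivAt (fun x => ∫ z, iteratedFDeriv ℝ n (f z) x ∂μ)
      ((∫ z, iteratedFDeriv ℝ (n + 1) (f z) x ∂μ).curryLeft) x := by
    intro n x
    obtain ⟨b, hbi, hbb⟩ := hb (n + 1)
    have hcl : (∫ z, iteratedFDeriv ℝ (n + 1) (f z) x ∂μ).curryLeft =
        ∫ z, fderiv ℝ (iteratedFDeriv ℝ n (f z)) x ∂μ := by
      let L : (V [×(n + 1)]→L[ℝ] F) →L[ℝ] (V →L[ℝ] V [×n]→L[ℝ] F) :=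
        (continuousMultilinearCurryLeftEquiv ℝ (fun _ : Fin (n + 1) => V)
          F).toContinuousLinearEquiv.toContinuousLinearMap
      have h1 := ContinuousLinearMap.integral_comp_comm (𝕜 := ℝ) (Fₗ := V →L[ℝ] V [×n]→L[ℝ] F) L
        (hInt (n + 1) x)
      refine Eq.trans h1.symm ?_
      refine integral_congr_ae (Eventually.of_forall fun z => ?_)
      simp [L, iteratedFDeriv_succ_eq_comp_left]
    rw [hcl]
    refine hasFDerivAt_integral_of_dominated_of_fderiv_le
      (F' := fun x z => fderiv ℝ (iteratedFDeriv ℝ n (f z)) x) (bound := b)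
      univ_mem (Eventually.of_forall fun x => hmn n x) (hInt n x)
      (aestronglyMeasurable_fderiv_param (fun z => (hd z).differentiable_iteratedFDeriv
        (by exact_mod_cast ENat.natCast_lt_top n)) (hmn n) x)
      (Eventually.of_forall fun z y _ => ?_) hbi (Eventually.of_forall fun z y _ => ?_)
    · rw [norm_fderiv_iteratedFDeriv]
      exact hbb z y
    · exact ((hd z).differentiable_iteratedFDeriv
        (by exact_mod_cast ENat.natCast_lt_top n) y).hasFDerivAt
  -- The integrated derivatives form a Taylor series for the integral; uniqueness of such a series
  -- identifies them with its iterated derivatives.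
  have hT : HasFTaylorSeriesUpTo ∞ (fun x => ∫ z, f z x ∂μ)
      (fun x n => ∫ z, iteratedFDeriv ℝ n (f z) x ∂μ) := by
    refine ⟨fun x => ?_, fun m _ x => hder m x, fun m _ => ?_⟩
    · have h1 := (continuousMultilinearCurryFin0 ℝ V
        F).toContinuousLinearEquiv.toContinuousLinearMap.integral_comp_comm (hInt 0 x)
      refine Eq.trans h1.symm ?_
      refine integral_congr_ae (Eventually.of_forall fun z => ?_)
      simp
    · exact continuous_iff_continuousAt.2 fun x => (hder m x).continuousAt
  refine ⟨hT.contDiff, fun n x => ?_⟩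
  exact (hT.eq_iteratedFDeriv (natCast_le_infty n) x).symm

end ParametricIntegral

/-! ### Polynomial weights and Peetre's inequality. -/

section Bracket

variable {V : Type*} [NormedAddCommGroup V]

theorem one_add_norm_le_mul (x a : V) : 1 + ‖x‖ ≤ (1 + ‖x - a‖) * (1 + ‖a‖) := by
  have h : ‖x‖ ≤ ‖x - a‖ + ‖a‖ := by simpa using norm_add_le (x - a) a
  nlinarith [mul_nonneg (norm_nonneg (x - a)) (norm_nonneg a)]

/-- The decay factor `(1 + |v|)^{-k}`. -/
def dec (k : ℕ) (v : V) : ℝ := ((1 + ‖v‖) ^ k)⁻¹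

theorem dec_pos (k : ℕ) (v : V) : 0 < dec k v := by unfold dec; positivity

theorem dec_le_one (k : ℕ) (v : V) : dec k v ≤ 1 :=
  inv_le_one_of_one_le₀ (one_le_pow₀ (by linarith [norm_nonneg v]))

theorem dec_add (k l : ℕ) (v : V) : dec (k + l) v = dec k v * dec l v := by
  simp [dec, pow_add, mul_comm]

theorem pow_mul_dec (k : ℕ) (v : V) : (1 + ‖v‖) ^ k * dec k v = 1 :=
  mul_inv_cancel₀ (by positivity)

/-- Peetre's inequality: decay away from `a` is traded for decay away from the origin at a
polynomial cost in `a`. The primed version exchanges the roles of `x` and `a`. -/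
theorem dec_sub_le (k : ℕ) (x a : V) : dec k (x - a) ≤ (1 + ‖a‖) ^ k * dec k x := by
  have h : (1 + ‖x‖) ^ k ≤ ((1 + ‖x - a‖) * (1 + ‖a‖)) ^ k :=
    pow_le_pow_left₀ (by positivity) (one_add_norm_le_mul x a) k
  unfold dec
  rw [← div_eq_mul_inv, inv_eq_one_div, div_le_div_iff₀ (by positivity) (by positivity), one_mul,
    mul_comm, ← mul_pow]
  exact h

theorem dec_sub_le' (k : ℕ) (x a : V) : dec k (x - a) ≤ (1 + ‖x‖) ^ k * dec k a := by
  have := dec_sub_le k a x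
  rwa [show dec k (a - x) = dec k (x - a) by simp [dec, norm_sub_rev]] at this

theorem continuous_dec (k : ℕ) : Continuous (dec k : V → ℝ) := by
  unfold dec
  exact Continuous.inv₀ (by fun_prop) fun v => by positivity

theorem integrable_dec [NormedSpace ℝ V] [FiniteDimensional ℝ V] [MeasurableSpace V] [BorelSpace V]
    (μ : MeasureTheory.Measure V) [μ.IsAddHaarMeasure] {k : ℕ} (hk : Module.finrank ℝ V < k) :
    MeasureTheory.Integrable (dec k) μ := by
  have := integrable_one_add_norm (E := V) (μ := μ) (r := k) (by exact_mod_cast hk)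
  refine this.congr (Filter.Eventually.of_forall fun v => ?_)
  simp only [dec]
  rw [Real.rpow_neg (by positivity), Real.rpow_natCast]

end Bracket


/-! ### Symbols of polynomial growth, Schwartz functions, integrals of families. -/

section Growth

open MeasureTheory Filter

variable {ι V F : Type*} [NormedAddCommGroup V] [NormedSpace ℝ V]
  [NormedAddCommGroup F] [NormedSpace ℝ F]

/-- Smooth functions all of whose derivatives are `O((1 + |w|)^m)`. -/
def PolyGrowth (m : ℕ) (u : V → F) : Prop :=
  ContDiff ℝ ∞ u ∧ ∀ n : ℕ, ∃ C, ∀ w, ‖iteratedFDeriv ℝ n u w‖ ≤ C * (1 + ‖w‖) ^ m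

/-- The sum of the best constants in the bounds `PolyGrowth` up to order `N`. -/
def growthNorm (N m : ℕ) (u : V → F) : ℝ :=
  ∑ n ∈ Finset.range (N + 1), ⨆ w, dec m w * ‖iteratedFDeriv ℝ n u w‖

theorem growthNorm_nonneg (N m : ℕ) (u : V → F) : 0 ≤ growthNorm N m u :=
  Finset.sum_nonneg fun _ _ => Real.iSup_nonneg fun w =>
    mul_nonneg (dec_pos m w).le (norm_nonneg _)

theorem PolyGrowth.le_growthNorm {m N n : ℕ} {u : V → F} (hu : PolyGrowth m u) (hn : n ≤ N)
    (w : V) : ‖iteratedFDeriv ℝ n u w‖ ≤ growthNorm N m u * (1 + ‖w‖) ^ m := by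
  obtain ⟨C, hC⟩ := hu.2 n
  have hbdd : BddAbove (Set.range fun w => dec m w * ‖iteratedFDeriv ℝ n u w‖) := by
    refine ⟨C, ?_⟩
    rintro _ ⟨w, rfl⟩
    calc dec m w * ‖iteratedFDeriv ℝ n u w‖ ≤ dec m w * (C * (1 + ‖w‖) ^ m) :=
          mul_le_mul_of_nonneg_left (hC w) (dec_pos m w).le
      _ = C * ((1 + ‖w‖) ^ m * dec m w) := by ring
      _ = C := by rw [pow_mul_dec, mul_one]
  have h1 : dec m w * ‖iteratedFDeriv ℝ n u w‖ ≤ growthNorm N m u := by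
    refine (le_ciSup hbdd w).trans ?_
    exact Finset.single_le_sum (f := fun n => ⨆ w, dec m w * ‖iteratedFDeriv ℝ n u w‖)
      (fun _ _ => Real.iSup_nonneg fun w => mul_nonneg (dec_pos m w).le (norm_nonneg _))
      (Finset.mem_range.2 (by omega))
  calc ‖iteratedFDeriv ℝ n u w‖ = ((1 + ‖w‖) ^ m * dec m w) * ‖iteratedFDeriv ℝ n u w‖ := by
        rw [pow_mul_dec, one_mul]
    _ = (dec m w * ‖iteratedFDeriv ℝ n u w‖) * (1 + ‖w‖) ^ m := by ring
    _ ≤ _ := mul_le_mul_of_nonneg_right h1 (by positivity)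

/-- The family is indexed by the functions themselves, so the constant in `DerivBound` is
independent of `u` and all dependence on `u` sits in `growthNorm`. This uniformity is what later
gives continuity in the symbol; `derivBound_schwartz` does the same for `φ`. -/
theorem derivBound_growth (N m : ℕ) :
    DerivBound N (fun u : {u : V → F // PolyGrowth m u} => u.1)
      (fun u w => growthNorm N m u.1 * (1 + ‖w‖) ^ m) :=
  ⟨fun u => u.2.1, 1, zero_le_one, fun u w n hn => by
    rw [one_mul]; exact u.2.le_growthNorm hn w⟩

/-- A Schwartz norm dominating `(1 + |v|)^k |D^n φ(v)|` for `n ≤ N`. -/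
def schwartzNorm (k N : ℕ) (φ : 𝓢(V, ℂ)) : ℝ :=
  (Finset.Iic (k, N)).sup (schwartzSeminormFamily ℂ V ℂ) φ

theorem derivBound_schwartz (N k : ℕ) :
    DerivBound N (fun φ : 𝓢(V, ℂ) => (φ : V → ℂ)) (fun φ v => schwartzNorm k N φ * dec k v) := by
  refine ⟨fun φ => φ.smooth ⊤, 2 ^ k, by positivity, fun φ v n hn => ?_⟩
  have h := SchwartzMap.one_add_le_sup_seminorm_apply (𝕜 := ℂ) (m := (k, N)) le_rfl hn φ v
  have h' : (1 + ‖v‖) ^ k * ‖iteratedFDeriv ℝ n (φ : V → ℂ) v‖ ≤ 2 ^ k * schwartzNorm k N φ := h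
  calc ‖iteratedFDeriv ℝ n (φ : V → ℂ) v‖
      = ((1 + ‖v‖) ^ k * ‖iteratedFDeriv ℝ n (φ : V → ℂ) v‖) * dec k v := by
        rw [mul_right_comm, pow_mul_dec, one_mul]
    _ ≤ (2 ^ k * schwartzNorm k N φ) * dec k v :=
        mul_le_mul_of_nonneg_right h' (dec_pos k v).le
    _ = _ := by ring

theorem DerivBound.id (N : ℕ) : DerivBound N (fun (_ : ι) (v : V) => v) (fun _ v => 1 + ‖v‖) := by
  rcases N with _ | N
  · exact zero_iff.2 ⟨fun _ => contDiff_id, 1, zero_le_one, fun _ v => by linarith⟩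
  · refine fderiv_iff.2 ⟨zero_iff.2 ⟨fun _ => contDiff_id, 1, zero_le_one, fun _ v => by linarith⟩,
      ?_⟩
    simp only [fderiv_fun_id]
    refine (DerivBound.const (fun _ : ι => ContinuousLinearMap.id ℝ V) (fun _ => 1)
      (fun _ => ContinuousLinearMap.norm_id_le)).mono 1 zero_le_one fun _ v => ?_
    linarith [norm_nonneg v]

/-- Integration over a parameter preserves derivative bounds. -/
theorem DerivBound.integral {Y : Type*} [MeasurableSpace Y] {μ : Measure Y} [CompleteSpace F]
    [FiniteDimensional ℝ V] {N : ℕ} {f : ι → Y → V → F} {w : ι → V → ℝ} {w' : ℕ → ι → ℝ}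
    {g : Y → ℝ} (hw : ∀ i v, 0 ≤ w i v)
    (hN : DerivBound N (fun p : ι × Y => f p.1 p.2) (fun p v => w p.1 v * g p.2))
    (hall : ∀ n, DerivBound n (fun p : ι × Y => f p.1 p.2) (fun p _ => w' n p.1 * g p.2))
    (hm : ∀ i v, AEStronglyMeasurable (fun y => f i y v) μ) (hg : Integrable g μ) :
    DerivBound N (fun i v => ∫ y, f i y v ∂μ) w := by
  -- Smoothness requires dominating functions at every order, supplied by `hall` with weights
  -- independent of `v`; the weighted estimate up to order `N` comes from `hN`.
  have key : ∀ i, _ := fun i => contDiff_integral_param (fun y => hN.1 (i, y)) (hm i) fun n => by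
    obtain ⟨-, C, -, hb⟩ := hall n
    exact ⟨fun y => C * (w' n i * g y), (hg.const_mul _).const_mul _,
      fun y v => hb (i, y) v n le_rfl⟩
  obtain ⟨-, C, hC, hb⟩ := hN
  refine ⟨fun i => (key i).1, C * |∫ y, g y ∂μ|, by positivity, fun i v n hn => ?_⟩
  rw [(key i).2 n v]
  have hle : ∀ y, ‖iteratedFDeriv ℝ n (f i y) v‖ ≤ C * w i v * g y := fun y => by
    rw [mul_assoc]; exact hb (i, y) v n hn
  have h1 : ‖∫ y, iteratedFDeriv ℝ n (f i y) v ∂μ‖ ≤ C * w i v * ∫ y, g y ∂μ := by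
    rw [← integral_const_mul]
    exact norm_integral_le_of_norm_le (hg.const_mul _) (Eventually.of_forall hle)
  refine h1.trans ?_
  have h2 : 0 ≤ C * w i v := mul_nonneg hC (hw i v)
  calc C * w i v * ∫ y, g y ∂μ ≤ C * w i v * |∫ y, g y ∂μ| := by gcongr; exact le_abs_self _
    _ = _ := by ring

end Growth


/-! ### Gaussian wave packets. -/

section Packet

variable {d : ℕ}

theorem quad_re (Θ : Matrix (Fin d) (Fin d) ℂ) (w : E d) :
    (quad Θ w).re = w.ofLp ⬝ᵥ ((Θ.map Complex.re).mulVec w.ofLp) := by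
  simp only [quad, dotProduct, Matrix.mulVec, Complex.re_sum, Matrix.map_apply, Finset.mul_sum]
  refine Finset.sum_congr rfl fun i _ => Finset.sum_congr rfl fun j _ => ?_
  simp [mul_assoc]

theorem quad_smul (Θ : Matrix (Fin d) (Fin d) ℂ) (t : ℝ) (w : E d) :
    quad Θ (t • w) = (t : ℂ) ^ 2 * quad Θ w := by
  simp only [quad, Finset.mul_sum]
  refine Finset.sum_congr rfl fun i _ => Finset.sum_congr rfl fun j _ => ?_
  simp
  ring

theorem contDiff_quad (Θ : Matrix (Fin d) (Fin d) ℂ) : ContDiff ℝ ∞ (quad Θ) := by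
  unfold quad
  refine ContDiff.sum fun i _ => ContDiff.sum fun j _ => ?_
  have h : ∀ i : Fin d, ContDiff ℝ ∞ fun w : E d => ((w i : ℝ) : ℂ) := fun i =>
    Complex.ofRealCLM.contDiff.comp (EuclideanSpace.proj (𝕜 := ℝ) i).contDiff
  exact ((h i).mul contDiff_const).mul (h j)

/-- The minimum of `Re (w · Θ w)` over the compact unit sphere is positive; homogeneity of degree
two extends the bound to all `w`. -/
theorem exists_quad_re_lower {Θ : Matrix (Fin d) (Fin d) ℂ} (hΘ : (Θ.map Complex.re).PosDef) :
    ∃ c : ℝ, 0 < c ∧ ∀ w : E d, c * ‖w‖ ^ 2 ≤ (quad Θ w).re := by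
  have hpos : ∀ w : E d, w ≠ 0 → 0 < (quad Θ w).re := by
    intro w hw
    rw [quad_re]
    have := hΘ.re_dotProduct_pos (x := w.ofLp) (by simpa using hw)
    simpa using this
  have hcont : Continuous fun w : E d => (quad Θ w).re :=
    Complex.continuous_re.comp (contDiff_quad Θ).continuous
  -- The sphere is empty exactly when `d = 0`; then `w = 0` and any constant works.
  rcases (Metric.sphere (0 : E d) 1).eq_empty_or_nonempty with h | h
  · refine ⟨1, one_pos, fun w => ?_⟩
    have hw : w = 0 := by
      by_contra hw
      have : ‖w‖⁻¹ • w ∈ Metric.sphere (0 : E d) 1 := by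
        simp [norm_smul, norm_ne_zero_iff.2 hw]
      rw [h] at this
      exact this
    subst hw
    simp [quad]
  · obtain ⟨w₀, hw₀, hmin⟩ := (isCompact_sphere (0 : E d) 1).exists_isMinOn h hcont.continuousOn
    have hw₀' : w₀ ≠ 0 := by
      rintro rfl
      simp at hw₀
    refine ⟨_, hpos w₀ hw₀', fun w => ?_⟩
    by_cases hw : w = 0
    · subst hw; simp [quad]
    have hn : ‖w‖ ≠ 0 := norm_ne_zero_iff.2 hw
    have hm : ‖w‖⁻¹ • w ∈ Metric.sphere (0 : E d) 1 := by simp [norm_smul, hn]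
    have h1 : (quad Θ w₀).re ≤ (quad Θ (‖w‖⁻¹ • w)).re := hmin hm
    have h2 : quad Θ w = ((‖w‖ : ℝ) : ℂ) ^ 2 * quad Θ (‖w‖⁻¹ • w) := by
      rw [← quad_smul, smul_smul, mul_inv_cancel₀ hn, one_smul]
    rw [h2, ← Complex.ofReal_pow, Complex.re_ofReal_mul, mul_comm]
    exact mul_le_mul_of_nonneg_left h1 (by positivity)

/-- Combines `1 + t ≤ 2 (1 + t²)` with `s^M / M! ≤ e^s` at `s = c (1 + t²)`; the extra `e^c` in the
constant comes from the `1` in `1 + t²`. -/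
theorem exists_pow_mul_exp_neg_sq_le {c : ℝ} (hc : 0 < c) (M : ℕ) :
    ∃ C, 0 ≤ C ∧ ∀ t : ℝ, 0 ≤ t → (1 + t) ^ M * Real.exp (-(c * t ^ 2)) ≤ C := by
  refine ⟨2 ^ M * (M.factorial * (c⁻¹) ^ M * Real.exp c), by positivity, fun t ht => ?_⟩
  have h1 : (1 + t) ^ M ≤ (2 * (1 + t ^ 2)) ^ M := by
    refine pow_le_pow_left₀ (by positivity) ?_ M
    nlinarith [sq_nonneg (t - 1), sq_nonneg t]
  have h2 := Real.pow_div_factorial_le_exp (c * (1 + t ^ 2)) (by positivity) M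
  have h3 : (1 + t ^ 2) ^ M ≤ M.factorial * (c⁻¹) ^ M * (Real.exp c * Real.exp (c * t ^ 2)) := by
    rw [div_le_iff₀ (by positivity), mul_pow, mul_add, Real.exp_add, mul_one] at h2
    calc (1 + t ^ 2) ^ M = (c⁻¹) ^ M * (c ^ M * (1 + t ^ 2) ^ M) := by
          rw [← mul_assoc, ← mul_pow, inv_mul_cancel₀ hc.ne', one_pow, one_mul]
      _ ≤ (c⁻¹) ^ M * (Real.exp c * Real.exp (c * t ^ 2) * M.factorial) := by gcongr
      _ = _ := by ring
  calc (1 + t) ^ M * Real.exp (-(c * t ^ 2))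
      ≤ (2 ^ M * (M.factorial * (c⁻¹) ^ M * (Real.exp c * Real.exp (c * t ^ 2)))) *
          Real.exp (-(c * t ^ 2)) := by
        rw [mul_pow] at h1
        gcongr
        exact h1.trans (by gcongr)
    _ = 2 ^ M * (M.factorial * (c⁻¹) ^ M * Real.exp c) *
          (Real.exp (c * t ^ 2) * Real.exp (-(c * t ^ 2))) := by ring
    _ = _ := by rw [← Real.exp_add, add_neg_cancel, Real.exp_zero, mul_one]

/-- The exponent of a complex Gaussian wave packet centred at the origin. -/
def packetExponent (Θ : Matrix (Fin d) (Fin d) ℂ) (ε : ℝ) (b w : E d) : ℂ :=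
  Complex.I / ε * (((inner ℝ b w : ℝ) : ℂ) + Complex.I / 2 * quad Θ w)

/-- The complex Gaussian wave packet with centre `a` and momentum `b`. -/
def packet (Θ : Matrix (Fin d) (Fin d) ℂ) (ε : ℝ) (a b x : E d) : ℂ :=
  Complex.exp (packetExponent Θ ε b (x - a))

/-- Separates the oscillation from the Gaussian profile. The remaining packet has momentum zero, so
its derivatives do not grow with `b`, and the oscillation is available for integration by parts. -/
theorem packet_eq (Θ : Matrix (Fin d) (Fin d) ℂ) (ε : ℝ) (a b x : E d) :
    packet Θ ε a b x =
      Complex.exp (Complex.I / ε * ((inner ℝ b (x - a) : ℝ) : ℂ)) * packet Θ ε a 0 x := by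
  simp only [packet, packetExponent, ← Complex.exp_add]
  congr 1
  simp
  ring

theorem derivBound_packetExponent (Θ : Matrix (Fin d) (Fin d) ℂ) (ε : ℝ) (N : ℕ) :
    DerivBound N (fun b w => packetExponent Θ ε b w)
      (fun b w => (1 + ‖b‖) * (1 + ‖w‖) ^ 2) := by
  have hid := DerivBound.id (ι := E d) (V := E d) N
  have h1 : DerivBound N (fun (b : E d) (w : E d) => ((inner ℝ b w : ℝ) : ℂ))
      (fun b w => (1 + ‖b‖) * (1 + ‖w‖) ^ 2) := by
    refine (((DerivBound.const (N := N) (V := E d) (fun b : E d => b) (fun b => 1 + ‖b‖)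
      (fun b => by linarith)).bilinear (innerSL ℝ) hid).clm Complex.ofRealCLM).mono 1 zero_le_one
      fun b w => ?_
    rw [one_mul]
    gcongr
    exact le_self_pow₀ (by linarith [norm_nonneg w]) two_ne_zero
  have hco : ∀ i : Fin d, DerivBound N (fun (_ : E d) (w : E d) => ((w i : ℝ) : ℂ))
      (fun _ w => 1 + ‖w‖) := fun i =>
    hid.clm (Complex.ofRealCLM.comp (EuclideanSpace.proj (𝕜 := ℝ) i))
  have h2 : DerivBound N (fun (_ : E d) (w : E d) => quad Θ w)
      (fun b w => (1 + ‖b‖) * (1 + ‖w‖) ^ 2) := by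
    unfold quad
    refine DerivBound.sum _ fun i _ => DerivBound.sum _ fun j _ => ?_
    refine (((hco i).mul (DerivBound.const (fun _ => Θ i j) (fun _ => ‖Θ i j‖)
      (fun _ => le_rfl))).mul (hco j)).mono ‖Θ i j‖ (norm_nonneg _) fun b w => ?_
    calc _ = ‖Θ i j‖ * (1 * (1 + ‖w‖) ^ 2) := by ring
      _ ≤ _ := by gcongr; linarith [norm_nonneg b]
  exact (h1.add (h2.clm (ContinuousLinearMap.mul ℝ ℂ (Complex.I / 2)))).clm
    (ContinuousLinearMap.mul ℝ ℂ (Complex.I / ε))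

/-- The momentum is real, so its term has modulus one and only the real part of `Θ` determines the
size. -/
theorem norm_exp_packetExponent (Θ : Matrix (Fin d) (Fin d) ℂ) (ε : ℝ) (b w : E d) :
    ‖Complex.exp (packetExponent Θ ε b w)‖ = Real.exp (-((2 * ε)⁻¹ * (quad Θ w).re)) := by
  rw [Complex.norm_exp]
  congr 1
  have : packetExponent Θ ε b w = ((ε⁻¹ * inner ℝ b w : ℝ) : ℂ) * Complex.I -
      (((2 * ε)⁻¹ : ℝ) : ℂ) * quad Θ w := by
    simp only [packetExponent]
    push_cast
    have hI : Complex.I * Complex.I = -1 := Complex.I_mul_I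
    rw [mul_inv, div_eq_mul_inv]
    linear_combination (ε : ℂ)⁻¹ * (1 / 2 * quad Θ w) * hI
  rw [this, Complex.sub_re, Complex.re_ofReal_mul, Complex.re_ofReal_mul]
  simp

/-- By `DerivBound.cexp` each derivative costs `(1 + |b|)(1 + |w|)²`. The Gaussian absorbs the `2N`
powers of `w` and `k` more, which remain as decay; the powers of the momentum cannot be absorbed.
Translation to the centre changes no derivative bound. -/
theorem derivBound_packet {Θ : Matrix (Fin d) (Fin d) ℂ} (hΘ : (Θ.map Complex.re).PosDef) {ε : ℝ}
    (hε : 0 < ε) (N k : ℕ) :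
    DerivBound N (fun (i : E d × E d) x => packet Θ ε i.1 i.2 x)
      (fun i x => (1 + ‖i.2‖) ^ N * dec k (x - i.1)) := by
  obtain ⟨c, hc, hq⟩ := exists_quad_re_lower hΘ
  obtain ⟨C, hC, hb⟩ := exists_pow_mul_exp_neg_sq_le (c := (2 * ε)⁻¹ * c) (by positivity)
    (2 * N + k)
  have h0 := derivBound_packetExponent Θ ε (N + 1)
  have h1 := DerivBound.cexp (N := N) h0.1 (fun b w => by
    have hb : 1 ≤ 1 + ‖b‖ := by linarith [norm_nonneg b]
    have hw : 1 ≤ (1 + ‖w‖) ^ 2 := one_le_pow₀ (by linarith [norm_nonneg w])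
    nlinarith) (DerivBound.fderiv_iff.1 h0).2
  have h2 : DerivBound N (fun (b : E d) w => Complex.exp (packetExponent Θ ε b w))
      (fun b w => (1 + ‖b‖) ^ N * dec k w) := by
    refine h1.mono C hC fun b w => ?_
    rw [norm_exp_packetExponent, mul_pow, ← pow_mul]
    have h3 : Real.exp (-((2 * ε)⁻¹ * (quad Θ w).re)) ≤
        Real.exp (-((2 * ε)⁻¹ * c * ‖w‖ ^ 2)) := by
      refine Real.exp_le_exp.2 (neg_le_neg ?_)
      rw [mul_assoc]
      exact mul_le_mul_of_nonneg_left (hq w) (by positivity)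
    calc _ ≤ Real.exp (-((2 * ε)⁻¹ * c * ‖w‖ ^ 2)) * ((1 + ‖b‖) ^ N * (1 + ‖w‖) ^ (2 * N)) := by
          gcongr
      _ = ((1 + ‖w‖) ^ k * dec k w) * (Real.exp (-((2 * ε)⁻¹ * c * ‖w‖ ^ 2)) *
            ((1 + ‖b‖) ^ N * (1 + ‖w‖) ^ (2 * N))) := by rw [pow_mul_dec, one_mul]
      _ = ((1 + ‖w‖) ^ (2 * N + k) * Real.exp (-((2 * ε)⁻¹ * c * ‖w‖ ^ 2))) *
            ((1 + ‖b‖) ^ N * dec k w) := by ring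
      _ ≤ _ := mul_le_mul_of_nonneg_right (hb _ (norm_nonneg w))
          (mul_nonneg (by positivity) (dec_pos k w).le)
  have h4 := (h2.reindex (fun i : E d × E d => i.2)).comp_affine (ContinuousLinearMap.id ℝ (E d))
    (fun i => -i.1)
  simpa [packet, sub_eq_add_neg] using h4

end Packet


/-! ### Superpositions of wave packets; integration by parts in the second variable. -/

section WaveData

open MeasureTheory Filter

/-- The data of an oscillatory kernel: a superposition over `z` of products of wave packets
following two phase space maps `a` and `b` of linear growth. -/
structure WaveData (d : ℕ) where
  /-- the semiclassical parameter -/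
  ε : ℝ
  ε_pos : 0 < ε
  /-- the width of the packets in the first variable -/
  Θ₁ : Matrix (Fin d) (Fin d) ℂ
  /-- the width of the packets in the second variable -/
  Θ₂ : Matrix (Fin d) (Fin d) ℂ
  posDef₁ : (Θ₁.map Complex.re).PosDef
  posDef₂ : (Θ₂.map Complex.re).PosDef
  /-- the bounded amplitude -/
  c : E d × E d → ℂ
  /-- the phase space point of the packets in the first variable -/
  a : E d × E d → E d × E d
  /-- the phase space point of the packets in the second variable -/
  b : E d × E d → E d × E d
  c_cont : Continuous c
  a_cont : Continuous a
  b_cont : Continuous b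
  c_le : ∀ z, ‖c z‖ ≤ 1
  /-- the growth constant -/
  K : ℝ
  K_nonneg : 0 ≤ K
  a_le : ∀ z, 1 + ‖a z‖ ≤ K * (1 + ‖z‖)
  b_le : ∀ z, 1 + ‖b z‖ ≤ K * (1 + ‖z‖)
  le_a : ∀ z, 1 + ‖z‖ ≤ K * (1 + ‖a z‖)
  le_b : ∀ z, 1 + ‖z‖ ≤ K * (1 + ‖b z‖)

namespace WaveData

variable {d : ℕ} (D : WaveData d)

/-- The data of the transposed kernel. -/
def swap : WaveData d where
  ε := D.ε
  ε_pos := D.ε_pos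
  Θ₁ := D.Θ₂
  Θ₂ := D.Θ₁
  posDef₁ := D.posDef₂
  posDef₂ := D.posDef₁
  c := D.c
  a := D.b
  b := D.a
  c_cont := D.c_cont
  a_cont := D.b_cont
  b_cont := D.a_cont
  c_le := D.c_le
  K := D.K
  K_nonneg := D.K_nonneg
  a_le := D.b_le
  b_le := D.a_le
  le_a := D.le_b
  le_b := D.le_a

/-- The oscillatory kernel with amplitude `u`. -/
def kern (u : E4 d → ℂ) (x y : E d) (z : E d × E d) : ℂ :=
  D.c z * packet D.Θ₁ D.ε (D.a z).1 (D.a z).2 x * packet D.Θ₂ D.ε (D.b z).1 (D.b z).2 y *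
    u (x, y, z)

/-- The integral of the kernel over its second variable against a Schwartz function. -/
def inner (u : E4 d → ℂ) (φ : 𝓢(E d, ℂ)) (z : E d × E d) (x : E d) : ℂ :=
  ∫ y, D.kern u x y z * φ y

/-- Parameters of the families considered below: an amplitude, a Schwartz function, and a point
of phase space. -/
abbrev Idx (d m : ℕ) : Type := ({u : E4 d → ℂ // PolyGrowth m u} × 𝓢(E d, ℂ)) × (E d × E d)

/-- The oscillating factor in the second variable. -/
def osc (z : E d × E d) (y : E d) : ℂ :=
  Complex.exp (Complex.I / D.ε * ((Inner.inner ℝ (D.b z).2 (y - (D.b z).1) : ℝ) : ℂ))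

/-- The non-oscillating part of the integrand of `inner`, without the packet in the first
variable. -/
def amp {m : ℕ} (i : Idx d m) (v : E d × E d) : ℂ :=
  D.c i.2 * packet D.Θ₂ D.ε (D.b i.2).1 0 v.2 * i.1.1.1 (v.1, v.2, i.2) * i.1.2 v.2

theorem kern_mul_eq {m : ℕ} (i : Idx d m) (x y : E d) :
    D.kern i.1.1.1 x y i.2 * i.1.2 y =
      packet D.Θ₁ D.ε (D.a i.2).1 (D.a i.2).2 x * (D.osc i.2 y * D.amp i (x, y)) := by
  simp only [kern, amp, osc]
  rw [packet_eq D.Θ₂]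
  ring

theorem norm_osc (z : E d × E d) (y : E d) : ‖D.osc z y‖ = 1 := by
  rw [osc, show Complex.I / D.ε * ((Inner.inner ℝ (D.b z).2 (y - (D.b z).1) : ℝ) : ℂ) =
    ((D.ε⁻¹ * Inner.inner ℝ (D.b z).2 (y - (D.b z).1) : ℝ) : ℂ) * Complex.I by
      push_cast; rw [div_eq_mul_inv]; ring]
  exact Complex.norm_exp_ofReal_mul_I _

theorem one_add_norm_triple_le (x y : E d) (z : E d × E d) :
    1 + ‖((x, y, z) : E4 d)‖ ≤ (1 + ‖x‖) * (1 + ‖y‖) * (1 + ‖z‖) := by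
  have hx := norm_nonneg x
  have hy := norm_nonneg y
  have hz := norm_nonneg z
  have h1 : ‖((x, y, z) : E4 d)‖ ≤ ‖x‖ + (‖y‖ + ‖z‖) := by
    simp only [Prod.norm_def (x, y, z), Prod.norm_def (y, z)]
    exact max_le (by linarith) (max_le (by linarith) (by linarith))
  nlinarith [mul_nonneg hx hy, mul_nonneg hx hz, mul_nonneg hy hz,
    mul_nonneg (mul_nonneg hx hy) hz]

theorem one_add_fst_le (v : E d × E d) : 1 + ‖v.1‖ ≤ 1 + ‖v‖ := by
  linarith [norm_fst_le v]

theorem one_add_snd_le (v : E d × E d) : 1 + ‖v.2‖ ≤ 1 + ‖v‖ := by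
  linarith [norm_snd_le v]

/-- The weight controlling the derivatives of `amp` up to order `N`. -/
def ampWeight {m : ℕ} (N k r : ℕ) (i : Idx d m) : ℝ :=
  growthNorm N m i.1.1.1 * schwartzNorm (k + r + m) N i.1.2 * (1 + ‖i.2‖) ^ m *
    dec r (D.b i.2).1

theorem schwartzNorm_nonneg (k N : ℕ) (φ : 𝓢(E d, ℂ)) : 0 ≤ schwartzNorm k N φ := apply_nonneg _ _

theorem ampWeight_nonneg {m : ℕ} (N k r : ℕ) (i : Idx d m) : 0 ≤ D.ampWeight N k r i :=
  mul_nonneg (mul_nonneg (mul_nonneg (growthNorm_nonneg _ _ _) (schwartzNorm_nonneg _ _ _))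
    (by positivity)) (dec_pos _ _).le

/-- The Schwartz function is used with decay of order `k + r + m`: `m` powers pay for the growth of
`u` in `y`, `r` powers pay for turning decay in `y - b₁` into decay in `b₁` by Peetre's inequality,
and `k` powers remain. No power of `b₂` is lost, since the packet in `amp` has momentum zero. -/
theorem derivBound_amp (m N k r : ℕ) :
    DerivBound N (fun i : Idx d m => D.amp i)
      (fun i v => D.ampWeight N k r i * ((1 + ‖v.1‖) ^ m * dec k v.2)) := by
  have h2 := ((derivBound_packet D.posDef₂ D.ε_pos N r).reindex
    (fun i : Idx d m => ((D.b i.2).1, (0 : E d)))).comp_affine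
      (ContinuousLinearMap.snd ℝ (E d) (E d)) (fun _ => 0)
  have h3 := ((derivBound_growth (V := E4 d) (F := ℂ) N m).reindex
    (fun i : Idx d m => i.1.1)).comp_affine
      ((ContinuousLinearMap.fst ℝ (E d) (E d)).prod ((ContinuousLinearMap.snd ℝ (E d) (E d)).prod
        (0 : E d × E d →L[ℝ] E d × E d))) (fun i => (0, 0, i.2))
  have h4 := ((derivBound_schwartz (V := E d) N (k + r + m)).reindex
    (fun i : Idx d m => i.1.2)).comp_affine (ContinuousLinearMap.snd ℝ (E d) (E d)) (fun _ => 0)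
  have h0 := DerivBound.const (N := N) (V := E d × E d) (fun i : Idx d m => D.c i.2)
    (fun _ => (1 : ℝ)) (fun i => D.c_le i.2)
  have h := ((h0.mul h2).mul h3).mul h4
  simp only [ContinuousLinearMap.coe_fst', ContinuousLinearMap.coe_snd', add_zero, one_mul,
    ContinuousLinearMap.prod_apply, Prod.mk_add_mk, zero_apply,
    zero_add, norm_zero, one_pow] at h
  refine h.mono 1 zero_le_one fun i v => ?_
  have hg := growthNorm_nonneg N m i.1.1.1
  have hs := schwartzNorm_nonneg (k + r + m) N i.1.2
  have hd2 := (dec_pos r (D.b i.2).1).le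
  have hd3 := (dec_pos (k + r + m) v.2).le
  have e2 : (1 + ‖v.2‖) ^ m * ((1 + ‖v.2‖) ^ r * dec (k + r + m) v.2) = dec k v.2 := by
    rw [dec_add, dec_add]
    calc _ = dec k v.2 * ((1 + ‖v.2‖) ^ r * dec r v.2) * ((1 + ‖v.2‖) ^ m * dec m v.2) := by ring
      _ = _ := by rw [pow_mul_dec, pow_mul_dec, mul_one, mul_one]
  calc _ ≤ ((1 + ‖v.2‖) ^ r * dec r (D.b i.2).1) *
          (growthNorm N m i.1.1.1 * ((1 + ‖v.1‖) * (1 + ‖v.2‖) * (1 + ‖i.2‖)) ^ m) *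
          (schwartzNorm (k + r + m) N i.1.2 * dec (k + r + m) v.2) := by
        gcongr
        · exact dec_sub_le' _ _ _
        · exact one_add_norm_triple_le _ _ _
    _ = growthNorm N m i.1.1.1 * schwartzNorm (k + r + m) N i.1.2 *
          (1 + ‖i.2‖) ^ m * dec r (D.b i.2).1 * ((1 + ‖v.1‖) ^ m *
            ((1 + ‖v.2‖) ^ m * ((1 + ‖v.2‖) ^ r * dec (k + r + m) v.2))) := by
        simp only [mul_pow]; ring
    _ = _ := by rw [e2, ampWeight, one_mul]

/-- A unit vector in the direction of the momentum of the second packet. -/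
def dir (z : E d × E d) : E d := ‖(D.b z).2‖⁻¹ • (D.b z).2

theorem norm_dir_le (z : E d × E d) : ‖D.dir z‖ ≤ 1 := by
  rw [dir, norm_smul, norm_inv, norm_norm]
  exact inv_mul_le_one

theorem inner_dir (z : E d × E d) : Inner.inner ℝ (D.b z).2 (D.dir z) = ‖(D.b z).2‖ := by
  rw [dir, real_inner_smul_right, real_inner_self_eq_norm_sq]
  by_cases h : ‖(D.b z).2‖ = 0
  · simp [h]
  · field_simp

/-- The first order operator producing a factor `1 + |b₂|` upon integration by parts. -/
def gain (z : E d × E d) (h : E d × E d → ℂ) (v : E d × E d) : ℂ :=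
  h v + Complex.I * D.ε * fderiv ℝ h v (0, D.dir z)

theorem derivBound_gain {ι : Type*} {N : ℕ} {h : ι → E d × E d → ℂ} {W : ι → E d × E d → ℝ}
    (z : ι → E d × E d) (hh : DerivBound (N + 1) h W) :
    DerivBound N (fun i => D.gain (z i) (h i)) W := by
  have h1 := (hh.fderiv_apply (fun i => ((0 : E d), D.dir (z i))) fun i => by
    simpa [Prod.norm_def] using D.norm_dir_le (z i)).clm
      (ContinuousLinearMap.mul ℝ ℂ (Complex.I * D.ε))
  exact (hh.of_le (Nat.le_succ N)).add h1

theorem derivBound_gain_iterate {ι : Type*} {N : ℕ} (r : ℕ) {h : ι → E d × E d → ℂ}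
    {W : ι → E d × E d → ℝ} (z : ι → E d × E d) (hh : DerivBound (N + r) h W) :
    DerivBound N (fun i => (D.gain (z i))^[r] (h i)) W := by
  induction r generalizing h with
  | zero => exact hh
  | succ r ih =>
    simp only [Function.iterate_succ, Function.comp_apply]
    exact ih (D.derivBound_gain z (by rwa [add_assoc]))

theorem hasFDerivAt_osc (z : E d × E d) (y : E d) :
    HasFDerivAt (D.osc z) (D.osc z y • (Complex.I / D.ε) •
      (Complex.ofRealCLM.comp (innerSL ℝ (D.b z).2))) y := by
  have h1 : HasFDerivAt (fun y => Complex.I / D.ε *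
      ((Inner.inner ℝ (D.b z).2 (y - (D.b z).1) : ℝ) : ℂ))
      ((Complex.I / D.ε) • (Complex.ofRealCLM.comp (innerSL ℝ (D.b z).2))) y := by
    have h2 : HasFDerivAt (fun y : E d => Complex.ofRealCLM.comp (innerSL ℝ (D.b z).2)
        (y - (D.b z).1)) (Complex.ofRealCLM.comp (innerSL ℝ (D.b z).2)) y := by
      have := (Complex.ofRealCLM.comp (innerSL ℝ (D.b z).2)).hasFDerivAt.comp y
        ((hasFDerivAt_id y).sub_const (D.b z).1)
      rw [ContinuousLinearMap.comp_id] at this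
      exact this
    exact h2.const_mul _
  exact h1.cexp

theorem continuous_osc (z : E d × E d) : Continuous (D.osc z) :=
  continuous_iff_continuousAt.2 fun y => (D.hasFDerivAt_osc z y).continuousAt

/-- Along the unit vector in the direction of `b₂` the oscillation has derivative `(i/ε)|b₂|` times
itself, so moving the derivative in `iε ∂` onto it produces `|b₂|`. The operator has constant
coefficients, so derivatives in `x` are not disturbed. For `b₂ = 0` the direction is `0` and the
identity is trivial. -/
theorem integral_osc_gain (z : E d × E d) {h : E d × E d → ℂ} (hh : ContDiff ℝ ∞ h) {C : ℝ} {k : ℕ}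
    (hk : d < k) {x : E d} (hb : ∀ n ≤ 1, ∀ y, ‖iteratedFDeriv ℝ n h (x, y)‖ ≤ C * dec k y) :
    ∫ y, D.osc z y * D.gain z h (x, y) = (1 + ‖(D.b z).2‖ : ℝ) * ∫ y, D.osc z y * h (x, y) := by
  have hInt : Integrable (fun y : E d => C * dec k y) := by
    exact (integrable_dec volume (by simpa using hk)).const_mul C
  have hpath : ∀ y, HasFDerivAt (fun y : E d => h (x, y))
      ((fderiv ℝ h (x, y)).comp (ContinuousLinearMap.inr ℝ (E d) (E d))) y := fun y =>
    ((hh.differentiable (by simp)) (x, y)).hasFDerivAt.comp y (hasFDerivAt_prodMk_right x y)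
  have hfd : ∀ y, fderiv ℝ (fun y : E d => h (x, y)) y (D.dir z) =
      fderiv ℝ h (x, y) (0, D.dir z) := fun y => by
    rw [(hpath y).fderiv]; simp
  have hcont : Continuous fun y : E d => h (x, y) := hh.continuous.comp (by fun_prop)
  have hcont' : Continuous fun y : E d => fderiv ℝ h (x, y) (0, D.dir z) :=
    (((hh.continuous_fderiv (by simp)).comp (by fun_prop : Continuous fun y : E d => (x, y))).clm_apply
      continuous_const)
  have i1 : Integrable fun y => D.osc z y * h (x, y) := by
    refine hInt.mono' ((D.continuous_osc z).mul hcont).aestronglyMeasurable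
      (Eventually.of_forall fun y => ?_)
    rw [norm_mul, norm_osc, one_mul]
    simpa using hb 0 zero_le_one y
  have i2 : Integrable fun y => D.osc z y * fderiv ℝ h (x, y) (0, D.dir z) := by
    refine hInt.mono' ((D.continuous_osc z).mul hcont').aestronglyMeasurable
      (Eventually.of_forall fun y => ?_)
    rw [norm_mul, norm_osc, one_mul]
    have h1 := hb 1 le_rfl y
    rw [norm_iteratedFDeriv_one] at h1
    calc _ ≤ ‖fderiv ℝ h (x, y)‖ * ‖((0 : E d), D.dir z)‖ := ContinuousLinearMap.le_opNorm _ _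
      _ ≤ ‖fderiv ℝ h (x, y)‖ * 1 := by
        gcongr; simpa [Prod.norm_def] using D.norm_dir_le z
      _ ≤ _ := by rw [mul_one]; exact h1
  have hosc : ∀ y, fderiv ℝ (D.osc z) y (D.dir z) =
      (Complex.I / D.ε * ‖(D.b z).2‖) * D.osc z y := fun y => by
    rw [(D.hasFDerivAt_osc z y).fderiv]
    simp [D.inner_dir z]
    ring
  have ibp := integral_mul_fderiv_eq_neg_fderiv_mul_of_integrable (𝕜 := ℂ) (μ := volume)
    (f := D.osc z) (g := fun y => h (x, y)) (v := D.dir z)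
    (by
      simp only [hosc, mul_assoc]
      exact (i1.const_mul _).const_mul _)
    (by simpa only [hfd] using i2) i1
    (fun y _ => (D.hasFDerivAt_osc z y).differentiableAt) (fun y _ => (hpath y).differentiableAt)
  simp only [hfd, hosc] at ibp
  have hε : (D.ε : ℂ) ≠ 0 := by exact_mod_cast D.ε_pos.ne'
  calc ∫ y, D.osc z y * D.gain z h (x, y)
      = ∫ y, (D.osc z y * h (x, y) + Complex.I * D.ε *
          (D.osc z y * fderiv ℝ h (x, y) (0, D.dir z))) := by
        refine integral_congr_ae (Eventually.of_forall fun y => ?_)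
        simp only [gain]; ring
    _ = _ := by
        rw [integral_add i1 (i2.const_mul _), integral_const_mul, ibp]
        simp only [mul_assoc]
        rw [integral_const_mul, integral_const_mul]
        push_cast
        field_simp
        linear_combination (-(‖(D.b z).2‖ : ℂ) * ∫ y, D.osc z y * h (x, y)) * Complex.I_sq

end WaveData

end WaveData


/-! ### Rapid decay in phase space and Schwartz bounds for the operator. -/

section WaveOp

open MeasureTheory Filter

namespace WaveData

variable {d : ℕ} (D : WaveData d)

/-- Bounds at every order are assumed because each application of `gain` consumes one derivative. -/
theorem integral_osc_gain_iterate (z : E d × E d) {k : ℕ} (hk : d < k) {w : E d → ℝ} (r : ℕ)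
    {h : E d × E d → ℂ}
    (hh : ∀ N, DerivBound N (fun _ : Unit => h) (fun _ v => w v.1 * dec k v.2)) (x : E d) :
    ∫ y, D.osc z y * (D.gain z)^[r] h (x, y) =
      ((1 + ‖(D.b z).2‖) ^ r : ℝ) * ∫ y, D.osc z y * h (x, y) := by
  induction r generalizing h with
  | zero => simp
  | succ r ih =>
    simp only [Function.iterate_succ, Function.comp_apply]
    rw [ih fun N => D.derivBound_gain (fun _ => z) (hh (N + 1))]
    obtain ⟨hsm, C, -, hb⟩ := hh 1
    rw [D.integral_osc_gain z (hsm ()) hk (C := C * w x) (x := x) fun n hn y => by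
      rw [mul_assoc]; exact hb () (x, y) n hn]
    push_cast
    ring

/-- Decay in the position and in the momentum of the second packet is decay in `b(z)`, hence in `z`,
by the lower growth bound on `b`. -/
theorem dec_fst_mul_dec_snd_le (r : ℕ) (z : E d × E d) :
    dec r (D.b z).1 * dec r (D.b z).2 ≤ D.K ^ r * dec r z := by
  have hK := D.K_nonneg
  have h1 : 1 + ‖z‖ ≤ D.K * ((1 + ‖(D.b z).1‖) * (1 + ‖(D.b z).2‖)) := by
    refine (D.le_b z).trans (mul_le_mul_of_nonneg_left ?_ hK)
    have h1 := norm_nonneg (D.b z).1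
    have h2 := norm_nonneg (D.b z).2
    rw [Prod.norm_def]
    rcases max_cases ‖(D.b z).1‖ ‖(D.b z).2‖ with h | h <;> rw [h.1] <;> nlinarith
  have h2 := pow_le_pow_left₀ (by positivity) h1 r
  rw [mul_pow, mul_pow] at h2
  unfold dec
  rw [← mul_inv, ← div_eq_mul_inv, inv_eq_one_div, div_le_div_iff₀ (by positivity) (by positivity),
    one_mul]
  exact h2

theorem dec_anti {V : Type*} [NormedAddCommGroup V] {k l : ℕ} (h : k ≤ l) (v : V) :
    dec l v ≤ dec k v := by
  obtain ⟨j, rfl⟩ := Nat.exists_eq_add_of_le h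
  rw [dec_add]
  exact mul_le_of_le_one_right (dec_pos k v).le (dec_le_one j v)

theorem dec_sub_a_le (z : E d × E d) (j : ℕ) (x : E d) :
    dec j (x - (D.a z).1) ≤ D.K ^ j * (1 + ‖z‖) ^ j * dec j x := by
  refine (dec_sub_le _ _ _).trans ?_
  rw [← mul_pow]
  refine mul_le_mul_of_nonneg_right ?_ (dec_pos j x).le
  exact pow_le_pow_left₀ (by positivity) ((one_add_fst_le _).trans (D.a_le z)) j

/-- The packets in the first variable, with polynomial loss in `z`. -/
theorem derivBound_packet_a {ι : Type*} (z : ι → E d × E d) (N j : ℕ) :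
    DerivBound N (fun i x => packet D.Θ₁ D.ε (D.a (z i)).1 (D.a (z i)).2 x)
      (fun i x => (1 + ‖z i‖) ^ (N + j) * dec j x) := by
  have hK := D.K_nonneg
  refine ((derivBound_packet D.posDef₁ D.ε_pos N j).reindex (fun i => D.a (z i))).mono
    (D.K ^ N * D.K ^ j) (by positivity) fun i x => ?_
  calc _ ≤ (D.K * (1 + ‖z i‖)) ^ N * (D.K ^ j * (1 + ‖z i‖) ^ j * dec j x) := by
        refine mul_le_mul ?_ (D.dec_sub_a_le _ _ _) (dec_pos _ _).le (by positivity)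
        exact pow_le_pow_left₀ (by positivity) ((one_add_snd_le _).trans (D.a_le _)) N
    _ = _ := by rw [mul_pow, pow_add]; ring

/-- The `x`-packet is used with decay of order `k + m`, of which `m` cancels the growth of the
amplitude in `x`. It loses `N + k + m` powers of `z` and the symbol loses `m` more; against this
stands decay of arbitrary order `r` in `z`, from the Gaussian in `b₁` and from `r` integrations by
parts in `b₂`. -/
theorem derivBound_integrand (m N k r : ℕ) :
    DerivBound N (fun (p : Idx d m × E d) x =>
        (dec r (D.b p.1.2).2 : ℂ) * (packet D.Θ₁ D.ε (D.a p.1.2).1 (D.a p.1.2).2 x *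
          (D.osc p.1.2 p.2 * (D.gain p.1.2)^[r] (D.amp p.1) (x, p.2))))
      (fun p x => growthNorm (N + r) m p.1.1.1.1 * schwartzNorm (k + r + m) (N + r) p.1.1.2 *
        ((1 + ‖p.1.2‖) ^ (N + k + m + m) * dec r p.1.2) * dec k x * dec k p.2) := by
  have hK := D.K_nonneg
  have h1 := D.derivBound_packet_a (fun p : Idx d m × E d => p.1.2) N (k + m)
  have h2 := (((D.derivBound_gain_iterate r (fun i : Idx d m => i.2)
    (D.derivBound_amp m (N + r) k r)).reindex (fun p : Idx d m × E d => p.1))).comp_affine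
      (ContinuousLinearMap.inl ℝ (E d) (E d)) (fun p => (0, p.2))
  have h3 := DerivBound.const (N := N) (V := E d) (fun p : Idx d m × E d => D.osc p.1.2 p.2)
    (fun _ => (1 : ℝ)) (fun p => (D.norm_osc _ _).le)
  have h4 := DerivBound.const (N := N) (V := E d)
    (fun p : Idx d m × E d => (dec r (D.b p.1.2).2 : ℂ)) (fun p => dec r (D.b p.1.2).2)
    (fun p => by
      rw [Complex.norm_real, Real.norm_of_nonneg (dec_pos _ _).le])
  have h := h4.mul (h1.mul (h3.mul h2))
  simp only [ContinuousLinearMap.inl_apply, Prod.mk_add_mk, add_zero, zero_add, one_mul] at h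
  refine h.mono (D.K ^ r) (by positivity) fun p x => ?_
  have hg := growthNorm_nonneg (N + r) m p.1.1.1.1
  have hs := schwartzNorm_nonneg (k + r + m) (N + r) p.1.1.2
  have e1 : (1 + ‖x‖) ^ m * dec (k + m) x = dec k x := by
    rw [dec_add, mul_left_comm, pow_mul_dec, mul_one]
  calc _ = growthNorm (N + r) m p.1.1.1.1 * schwartzNorm (k + r + m) (N + r) p.1.1.2 *
        (1 + ‖p.1.2‖) ^ (N + k + m + m) * (dec r (D.b p.1.2).1 * dec r (D.b p.1.2).2) *
        ((1 + ‖x‖) ^ m * dec (k + m) x) * dec k p.2 := by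
        simp only [ampWeight]; ring
    _ ≤ growthNorm (N + r) m p.1.1.1.1 * schwartzNorm (k + r + m) (N + r) p.1.1.2 *
        (1 + ‖p.1.2‖) ^ (N + k + m + m) * (D.K ^ r * dec r p.1.2) *
        dec k x * dec k p.2 := by
        rw [e1]
        have := dec_pos k x
        have := dec_pos k p.2
        refine mul_le_mul_of_nonneg_right (mul_le_mul_of_nonneg_right
          (mul_le_mul_of_nonneg_left (D.dec_fst_mul_dec_snd_le r _) (by positivity))
          (by positivity)) (by positivity)
    _ = _ := by ring

/-- The factor `(1 + |b₂|)^r` created by the integrations by parts is cancelled by `dec r`, so the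
same integral has an absolutely convergent representation for every `r`. -/
theorem inner_eq {m : ℕ} {k : ℕ} (hk : d < k) (r : ℕ) (i : Idx d m) (x : E d) :
    D.inner i.1.1.1 i.1.2 i.2 x = ∫ y, (dec r (D.b i.2).2 : ℂ) *
      (packet D.Θ₁ D.ε (D.a i.2).1 (D.a i.2).2 x *
        (D.osc i.2 y * (D.gain i.2)^[r] (D.amp i) (x, y))) := by
  have h := D.integral_osc_gain_iterate i.2 hk (w := fun x => (1 + ‖x‖) ^ m) r (h := D.amp i)
    (fun N => ((D.derivBound_amp m N k r).reindex (fun _ : Unit => i)).mono (D.ampWeight N k r i)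
      (D.ampWeight_nonneg N k r i) fun _ _ => le_rfl) x
  rw [integral_const_mul, integral_const_mul, h]
  simp only [inner, D.kern_mul_eq i]
  rw [integral_const_mul]
  have h1 : ((dec r (D.b i.2).2 : ℝ) : ℂ) * (((1 + ‖(D.b i.2).2‖) ^ r : ℝ) : ℂ) = 1 := by
    rw [← Complex.ofReal_mul, mul_comm, pow_mul_dec, Complex.ofReal_one]
  linear_combination (-(packet D.Θ₁ D.ε (D.a i.2).1 (D.a i.2).2 x *
    ∫ y, D.osc i.2 y * D.amp i (x, y))) * h1

theorem continuous_gain_iterate {m : ℕ} (i : Idx d m) (r : ℕ) :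
    Continuous ((D.gain i.2)^[r] (D.amp i)) :=
  ((D.derivBound_gain_iterate (N := 0) r (fun i : Idx d m => i.2)
    (D.derivBound_amp m (0 + r) 0 0)).1 i).continuous

/-- Decay of the inner integral, in `x` and in `z`. -/
theorem derivBound_inner (m N k s : ℕ) : ∃ N' l, DerivBound N
    (fun i : Idx d m => D.inner i.1.1.1 i.1.2 i.2)
    (fun i x => growthNorm N' m i.1.1.1 * schwartzNorm l N' i.1.2 * dec s i.2 * dec k x) := by
  -- Order `k'` exceeds `d`, for integrability in `y`, and is at least the decay `k` wanted in `x`;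
  -- `r` is the total loss in `z` plus the decay `s` to be kept.
  set k' := k + d + 1 with hk'
  set r := (N + k' + m + m) + s with hr
  refine ⟨N + r, k' + r + m, ?_⟩
  have hk : d < k' := by omega
  have hfun : (fun i : Idx d m => D.inner i.1.1.1 i.1.2 i.2) = fun i x =>
      ∫ y, (dec r (D.b i.2).2 : ℂ) * (packet D.Θ₁ D.ε (D.a i.2).1 (D.a i.2).2 x *
        (D.osc i.2 y * (D.gain i.2)^[r] (D.amp i) (x, y))) := by
    funext i x
    exact D.inner_eq hk r i x
  rw [hfun]
  have hpos : ∀ (N' : ℕ) (i : Idx d m) (x : E d),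
      0 ≤ growthNorm (N' + r) m i.1.1.1 * schwartzNorm (k' + r + m) (N' + r) i.1.2 *
        ((1 + ‖i.2‖) ^ (N' + k' + m + m) * dec r i.2) := fun N' i x =>
    mul_nonneg (mul_nonneg (growthNorm_nonneg _ _ _) (schwartzNorm_nonneg _ _ _))
      (mul_nonneg (by positivity) (dec_pos _ _).le)
  have h := DerivBound.integral (μ := volume)
    (f := fun (i : Idx d m) (y : E d) x => (dec r (D.b i.2).2 : ℂ) *
      (packet D.Θ₁ D.ε (D.a i.2).1 (D.a i.2).2 x *
        (D.osc i.2 y * (D.gain i.2)^[r] (D.amp i) (x, y)))) (g := fun y => dec k' y)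
    (w := fun i x => growthNorm (N + r) m i.1.1.1 * schwartzNorm (k' + r + m) (N + r) i.1.2 *
        ((1 + ‖i.2‖) ^ (N + k' + m + m) * dec r i.2) * dec k' x)
    (w' := fun N i => growthNorm (N + r) m i.1.1.1 * schwartzNorm (k' + r + m) (N + r) i.1.2 *
        ((1 + ‖i.2‖) ^ (N + k' + m + m) * dec r i.2))
    (fun i x => mul_nonneg (hpos N i x) (dec_pos k' x).le)
    (D.derivBound_integrand m N k' r)
    (fun n => (D.derivBound_integrand m n k' r).mono 1 zero_le_one fun p x => by
      rw [one_mul]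
      refine mul_le_mul_of_nonneg_right ?_ (dec_pos _ _).le
      exact mul_le_of_le_one_right (hpos n p.1 x) (dec_le_one _ _))
    (fun i x => by
      refine Continuous.aestronglyMeasurable ?_
      have h1 := D.continuous_osc i.2
      have h2 := (D.continuous_gain_iterate i r).comp (by fun_prop : Continuous fun y : E d => (x, y))
      exact continuous_const.mul (continuous_const.mul (h1.mul h2)))
    (integrable_dec volume (by simpa using hk))
  refine h.mono 1 zero_le_one fun i x => ?_
  have e : (1 + ‖i.2‖) ^ (N + k' + m + m) * dec r i.2 = dec s i.2 := by
    rw [hr, dec_add, ← mul_assoc, pow_mul_dec, one_mul]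
  rw [e, one_mul]
  refine mul_le_mul_of_nonneg_left (dec_anti (by omega) x) ?_
  exact mul_nonneg (mul_nonneg (growthNorm_nonneg _ _ _) (schwartzNorm_nonneg _ _ _))
    (dec_pos _ _).le

theorem continuous_packet {Y : Type*} [TopologicalSpace Y] (Θ : Matrix (Fin d) (Fin d) ℂ) (ε : ℝ)
    {a b x : Y → E d} (ha : Continuous a) (hb : Continuous b) (hx : Continuous x) :
    Continuous fun y => packet Θ ε (a y) (b y) (x y) := by
  unfold packet packetExponent
  have h1 := (contDiff_quad Θ).continuous.comp (hx.sub ha)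
  have h2 : Continuous fun y => (Inner.inner ℝ (b y) (x y - a y) : ℝ) := hb.inner (hx.sub ha)
  exact Complex.continuous_exp.comp (continuous_const.mul
    ((Complex.continuous_ofReal.comp h2).add (continuous_const.mul h1)))

theorem continuous_kern {u : E4 d → ℂ} (hu : Continuous u) :
    Continuous fun p : E d × E d × (E d × E d) => D.kern u p.1 p.2.1 p.2.2 := by
  unfold kern
  have hz : Continuous fun p : E d × E d × (E d × E d) => p.2.2 := by fun_prop
  have ha := D.a_cont.comp hz
  have hb := D.b_cont.comp hz
  refine Continuous.mul (Continuous.mul (Continuous.mul (D.c_cont.comp hz) ?_) ?_) hu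
  · exact continuous_packet _ _ ha.fst ha.snd (by fun_prop)
  · exact continuous_packet _ _ hb.fst hb.snd (by fun_prop)

theorem stronglyMeasurable_inner {u : E4 d → ℂ} (hu : Continuous u) (φ : 𝓢(E d, ℂ)) :
    StronglyMeasurable fun p : E d × (E d × E d) => D.inner u φ p.2 p.1 := by
  unfold inner
  have h : Continuous fun q : (E d × (E d × E d)) × E d =>
      D.kern u q.1.1 q.2 q.1.2 * φ q.2 :=
    ((D.continuous_kern hu).comp (by fun_prop :
      Continuous fun q : (E d × (E d × E d)) × E d => (q.1.1, q.2, q.1.2))).mul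
      (φ.continuous.comp continuous_snd)
  exact h.stronglyMeasurable.integral_prod_right

theorem integrable_dec_prod : Integrable (fun z : E d × E d => dec (2 * d + 1) z) := by
  have : (volume : Measure (E d × E d)).IsAddHaarMeasure :=
    inferInstanceAs ((volume : Measure (E d)).prod (volume : Measure (E d))).IsAddHaarMeasure
  exact integrable_dec volume (by simp; omega)

/-- The iterated integral defining the operator with kernel `kern`. -/
def op (u : E4 d → ℂ) (φ : 𝓢(E d, ℂ)) (x : E d) : ℂ := ∫ z, D.inner u φ z x

/-- Keeping decay of order `2d + 1` in `z` makes the inner integral integrable over the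
`2d`-dimensional phase space, while its decay in `x` is untouched. -/
theorem derivBound_op (m N k : ℕ) : ∃ N' l, DerivBound N
    (fun i : {u : E4 d → ℂ // PolyGrowth m u} × 𝓢(E d, ℂ) => D.op i.1.1 i.2)
    (fun i x => growthNorm N' m i.1.1 * schwartzNorm l N' i.2 * dec k x) := by
  set s := 2 * d + 1 with hs
  obtain ⟨N', l, hN⟩ := D.derivBound_inner m N k s
  choose N'' l' hall using fun n => D.derivBound_inner m n k s
  refine ⟨N', l, ?_⟩
  have hpos : ∀ N' l (i : {u : E4 d → ℂ // PolyGrowth m u} × 𝓢(E d, ℂ)),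
      0 ≤ growthNorm N' m i.1.1 * schwartzNorm l N' i.2 := fun N' l i =>
    mul_nonneg (growthNorm_nonneg _ _ _) (schwartzNorm_nonneg _ _ _)
  refine DerivBound.integral (μ := volume)
    (f := fun (i : {u : E4 d → ℂ // PolyGrowth m u} × 𝓢(E d, ℂ)) (z : E d × E d) =>
      D.inner i.1.1 i.2 z) (g := fun z => dec s z)
    (w' := fun n i => growthNorm (N'' n) m i.1.1 * schwartzNorm (l' n) (N'' n) i.2)
    (fun i x => mul_nonneg (hpos _ _ i) (dec_pos k x).le)
    (hN.mono 1 zero_le_one fun p x => le_of_eq (by ring))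
    (fun n => (hall n).mono 1 zero_le_one fun p x => ?_)
    (fun i x => ?_) integrable_dec_prod
  · rw [one_mul]
    exact mul_le_of_le_one_right (mul_nonneg (hpos _ _ p.1) (dec_pos _ _).le) (dec_le_one _ _)
  · have hm := (D.stronglyMeasurable_inner i.1.2.1.continuous i.2).comp_measurable
      (measurable_prodMk_left (x := x))
    exact hm.aestronglyMeasurable

end WaveData

end WaveOp


/-! ### Linearity, action on Schwartz functions, and transposition. -/

section WaveOp

open MeasureTheory Filter

namespace WaveData

variable {d : ℕ} (D : WaveData d)

theorem exists_kern_mul_le {m : ℕ} {u : E4 d → ℂ} (hu : PolyGrowth m u) (φ : 𝓢(E d, ℂ))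
    (z : E d × E d) (k : ℕ) :
    ∃ C, ∀ x y, ‖D.kern u x y z * φ y‖ ≤ C * (dec k x * dec k y) := by
  let i : Idx d m := ((⟨u, hu⟩, φ), z)
  obtain ⟨-, C, hC, hb⟩ := D.derivBound_amp m 0 k 0
  obtain ⟨-, C', hC', hb'⟩ := D.derivBound_packet_a (fun z : E d × E d => z) 0 (k + m)
  refine ⟨C' * (1 + ‖z‖) ^ (0 + (k + m)) * (C * D.ampWeight 0 k 0 i), fun x y => ?_⟩
  have h1 := hb i (x, y) 0 le_rfl
  have h2 := hb' z x 0 le_rfl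
  simp only [norm_iteratedFDeriv_zero] at h1 h2
  have e1 : (1 + ‖x‖) ^ m * dec (k + m) x = dec k x := by
    rw [dec_add, mul_left_comm, pow_mul_dec, mul_one]
  rw [show D.kern u x y z * φ y = _ from D.kern_mul_eq i x y, norm_mul, norm_mul, norm_osc, one_mul]
  calc _ ≤ _ := mul_le_mul h2 h1 (norm_nonneg _) ((norm_nonneg _).trans h2)
    _ = C' * (1 + ‖z‖) ^ (0 + (k + m)) * (C * D.ampWeight 0 k 0 i) *
          (((1 + ‖x‖) ^ m * dec (k + m) x) * dec k y) := by ring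
    _ = _ := by rw [e1]

theorem integrable_kern_mul {m : ℕ} {u : E4 d → ℂ} (hu : PolyGrowth m u) (φ : 𝓢(E d, ℂ))
    (z : E d × E d) (x : E d) : Integrable fun y => D.kern u x y z * φ y := by
  obtain ⟨C, hC⟩ := D.exists_kern_mul_le hu φ z (d + 1)
  refine ((integrable_dec (V := E d) volume (k := d + 1) (by simp)).const_mul
    (C * dec (d + 1) x)).mono' ?_ (Eventually.of_forall fun y => (hC x y).trans_eq (by ring))
  exact (((D.continuous_kern hu.1.continuous).comp
    (by fun_prop : Continuous fun y : E d => (x, y, z))).mul φ.continuous).aestronglyMeasurable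

theorem exists_inner_le {m : ℕ} {u : E4 d → ℂ} (hu : PolyGrowth m u) (φ : 𝓢(E d, ℂ)) (s k : ℕ) :
    ∃ C, ∀ z x, ‖D.inner u φ z x‖ ≤ C * dec s z * dec k x := by
  obtain ⟨N', l, -, C, hC, hb⟩ := D.derivBound_inner m 0 k s
  refine ⟨C * (growthNorm N' m u * schwartzNorm l N' φ), fun z x => ?_⟩
  have := hb ((⟨u, hu⟩, φ), z) x 0 le_rfl
  simp only [norm_iteratedFDeriv_zero] at this
  exact this.trans (le_of_eq (by ring))

theorem integrable_inner {m : ℕ} {u : E4 d → ℂ} (hu : PolyGrowth m u) (φ : 𝓢(E d, ℂ)) (x : E d) :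
    Integrable fun z => D.inner u φ z x := by
  obtain ⟨C, hC⟩ := D.exists_inner_le hu φ (2 * d + 1) 0
  refine ((integrable_dec_prod (d := d)).const_mul C).mono' ?_ (Eventually.of_forall fun z => ?_)
  · exact ((D.stronglyMeasurable_inner hu.1.continuous φ).comp_measurable
      (measurable_prodMk_left (x := x))).aestronglyMeasurable
  · simpa [dec] using hC z x

theorem op_add_right {m : ℕ} {u : E4 d → ℂ} (hu : PolyGrowth m u) (φ ψ : 𝓢(E d, ℂ)) (x : E d) :
    D.op u (φ + ψ) x = D.op u φ x + D.op u ψ x := by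
  unfold op
  rw [← integral_add (D.integrable_inner hu φ x) (D.integrable_inner hu ψ x)]
  congr 1
  funext z
  unfold inner
  rw [← integral_add (D.integrable_kern_mul hu φ z x) (D.integrable_kern_mul hu ψ z x)]
  congr 1
  funext y
  simp [mul_add]

theorem op_smul_right (u : E4 d → ℂ) (c : ℂ) (φ : 𝓢(E d, ℂ)) (x : E d) :
    D.op u (c • φ) x = c * D.op u φ x := by
  unfold op inner
  rw [← integral_const_mul]
  congr 1
  funext z
  rw [← integral_const_mul]
  congr 1
  funext y
  simp only [smul_apply, smul_eq_mul]
  ring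

theorem op_add_left {m n : ℕ} {u v : E4 d → ℂ} (hu : PolyGrowth m u) (hv : PolyGrowth n v)
    (φ : 𝓢(E d, ℂ)) (x : E d) : D.op (u + v) φ x = D.op u φ x + D.op v φ x := by
  unfold op
  rw [← integral_add (D.integrable_inner hu φ x) (D.integrable_inner hv φ x)]
  congr 1
  funext z
  unfold inner
  rw [← integral_add (D.integrable_kern_mul hu φ z x) (D.integrable_kern_mul hv φ z x)]
  congr 1
  funext y
  simp only [kern, Pi.add_apply]
  ring

theorem op_smul_left (u : E4 d → ℂ) (c : ℂ) (φ : 𝓢(E d, ℂ)) (x : E d) :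
    D.op (c • u) φ x = c * D.op u φ x := by
  unfold op inner
  rw [← integral_const_mul]
  congr 1
  funext z
  rw [← integral_const_mul]
  congr 1
  funext y
  simp only [kern, Pi.smul_apply, smul_eq_mul]
  ring

theorem exists_op_bound (m k n : ℕ) : ∃ N l : ℕ, ∃ C, 0 ≤ C ∧ ∀ (u : E4 d → ℂ),
    PolyGrowth m u → ∀ (φ : 𝓢(E d, ℂ)) (x : E d),
      ‖x‖ ^ k * ‖iteratedFDeriv ℝ n (D.op u φ) x‖ ≤
        C * growthNorm N m u * schwartzNorm l N φ := by
  obtain ⟨N', l, -, C, hC, hb⟩ := D.derivBound_op m n k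
  refine ⟨N', l, C, hC, fun u hu φ x => ?_⟩
  have h := hb (⟨u, hu⟩, φ) x n le_rfl
  have h1 : ‖x‖ ^ k ≤ (1 + ‖x‖) ^ k := pow_le_pow_left₀ (norm_nonneg _) (by linarith) k
  calc ‖x‖ ^ k * ‖iteratedFDeriv ℝ n (D.op u φ) x‖
      ≤ (1 + ‖x‖) ^ k * (C * (growthNorm N' m u * schwartzNorm l N' φ * dec k x)) := by gcongr
    _ = C * growthNorm N' m u * schwartzNorm l N' φ * ((1 + ‖x‖) ^ k * dec k x) := by ring
    _ = _ := by rw [pow_mul_dec, mul_one]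

/-- The operator with kernel `kern` on Schwartz functions. -/
def opCLM (u : E4 d → ℂ) (hu : ∃ m, PolyGrowth m u) : 𝓢(E d, ℂ) →L[ℂ] 𝓢(E d, ℂ) :=
  SchwartzMap.mkCLM (D.op u) (fun φ ψ x => D.op_add_right hu.choose_spec φ ψ x)
    (fun c φ x => D.op_smul_right u c φ x)
    (fun φ => by
      obtain ⟨m, hu⟩ := hu
      obtain ⟨N', l, h⟩ := D.derivBound_op m 0 0
      exact h.1 (⟨u, hu⟩, φ))
    (fun ⟨k, n⟩ => by
      obtain ⟨m, hu⟩ := hu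
      obtain ⟨N, l, C, hC, h⟩ := D.exists_op_bound m k n
      exact ⟨Finset.Iic (l, N), C * growthNorm N m u,
        mul_nonneg hC (growthNorm_nonneg _ _ _), fun φ x => h u hu φ x⟩)

theorem opCLM_apply {u : E4 d → ℂ} (hu : ∃ m, PolyGrowth m u) (φ : 𝓢(E d, ℂ)) (x : E d) :
    D.opCLM u hu φ x = D.op u φ x := rfl

/-- Exchange of the first two variables. -/
def swapVar (u : E4 d → ℂ) : E4 d → ℂ := fun w => u (w.2.1, w.1, w.2.2)

theorem kern_swap (u : E4 d → ℂ) (x y : E d) (z : E d × E d) :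
    D.swap.kern (swapVar u) y x z = D.kern u x y z := by
  simp only [kern, swap, swapVar]
  ring

theorem polyGrowth_swapVar {m : ℕ} {u : E4 d → ℂ} (hu : PolyGrowth m u) :
    PolyGrowth m (swapVar u) := by
  let L : E4 d →L[ℝ] E4 d :=
    ((ContinuousLinearMap.fst ℝ _ _).comp (ContinuousLinearMap.snd ℝ _ _)).prod
      ((ContinuousLinearMap.fst ℝ _ _).prod
        ((ContinuousLinearMap.snd ℝ _ _).comp (ContinuousLinearMap.snd ℝ _ _)))
  have hL : ∀ w, ‖L w‖ = ‖w‖ := fun w => by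
    change ‖((w.2.1, w.1, w.2.2) : E4 d)‖ = ‖w‖
    simp only [Prod.norm_def]
    exact max_left_comm _ _ _
  have hbd : ∀ n, DerivBound n (fun _ : Unit => swapVar u) (fun _ w => (1 + ‖w‖) ^ m) := fun n => by
    have h1 := ((derivBound_growth (V := E4 d) (F := ℂ) n m).reindex
      (fun _ : Unit => (⟨u, hu⟩ : {u : E4 d → ℂ // PolyGrowth m u}))).comp_affine L (fun _ => 0)
    simp only [add_zero, hL] at h1
    exact h1.mono (growthNorm n m u) (growthNorm_nonneg _ _ _) fun _ _ => le_rfl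
  refine ⟨(hbd 0).1 (), fun n => ?_⟩
  obtain ⟨-, C, -, hb⟩ := hbd n
  exact ⟨C, fun w => hb () w n le_rfl⟩

theorem integrable_mul_inner {m : ℕ} {u : E4 d → ℂ} (hu : PolyGrowth m u) (φ ψ : 𝓢(E d, ℂ)) :
    Integrable (fun p : E d × (E d × E d) => ψ p.1 * D.inner u φ p.2 p.1)
      (volume.prod volume) := by
  obtain ⟨C, hC⟩ := D.exists_inner_le hu φ (2 * d + 1) 0
  refine ((ψ.integrable (μ := volume)).norm.mul_prod
    ((integrable_dec_prod (d := d)).const_mul C)).mono' ?_ (Eventually.of_forall fun p => ?_)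
  · exact ((ψ.continuous.comp continuous_fst).aestronglyMeasurable).mul
      (D.stronglyMeasurable_inner hu.1.continuous φ).aestronglyMeasurable
  · rw [norm_mul]
    gcongr
    simpa [dec] using hC p.2 p.1

/-- The operator of the exchanged data is the transpose. -/
theorem integral_op_swap {m : ℕ} {u : E4 d → ℂ} (hu : PolyGrowth m u) (φ ψ : 𝓢(E d, ℂ)) :
    ∫ x, ψ x * D.op u φ x = ∫ y, φ y * D.swap.op (swapVar u) ψ y := by
  -- Fubini is applied twice. In general the full integrand in `(x, y, z)` is not absolutely
  -- integrable, decay in `z` appearing only after the inner integration; so `z` is first moved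
  -- outside on each side.
  have hA : ∀ (D : WaveData d) {u : E4 d → ℂ} (hu : PolyGrowth m u) (φ ψ : 𝓢(E d, ℂ)),
      ∫ x, ψ x * D.op u φ x = ∫ z, ∫ x, ψ x * D.inner u φ z x := by
    intro D u hu φ ψ
    unfold op
    simp only [← integral_const_mul]
    exact integral_integral_swap (D.integrable_mul_inner hu φ ψ)
  rw [hA D hu, hA D.swap (polyGrowth_swapVar hu)]
  congr 1
  funext z
  unfold inner
  simp only [← integral_const_mul, kern_swap]
  -- For fixed `z` both Gaussians and both Schwartz functions are available, and `x` and `y` can be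
  -- exchanged.
  have hInt : Integrable (fun p : E d × E d => ψ p.1 * (D.kern u p.1 p.2 z * φ p.2))
      (volume.prod volume) := by
    obtain ⟨C, hC⟩ := D.exists_kern_mul_le hu φ z (d + 1)
    have hd : Integrable (fun y : E d => dec (d + 1) y) := integrable_dec volume (by simp)
    refine ((hd.const_mul (SchwartzMap.seminorm ℂ 0 0 ψ * C)).mul_prod hd).mono' ?_
      (Eventually.of_forall fun p => ?_)
    · have hk := (D.continuous_kern hu.1.continuous).comp
        (by fun_prop : Continuous fun p : E d × E d => (p.1, p.2, z))
      exact ((ψ.continuous.comp continuous_fst).mul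
        (hk.mul (φ.continuous.comp continuous_snd))).aestronglyMeasurable
    · rw [norm_mul]
      calc _ ≤ SchwartzMap.seminorm ℂ 0 0 ψ * (C * (dec (d + 1) p.1 * dec (d + 1) p.2)) :=
            mul_le_mul (SchwartzMap.norm_le_seminorm ℂ ψ _) (hC _ _) (norm_nonneg _)
              (apply_nonneg _ _)
        _ = _ := by ring
  rw [integral_integral_swap hInt]
  congr 1
  funext y
  congr 1
  funext x
  ring

end WaveData

end WaveOp


/-! ### The gradient of the phase and the gain produced by `L†`. -/

section Transpose

open MeasureTheory Filter

variable {d : ℕ}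

theorem DerivBound.of_forall {ι V F : Type*} [NormedAddCommGroup V] [NormedSpace ℝ V]
    [NormedAddCommGroup F] [NormedSpace ℝ F] {f : ι → V → F} {W : ι → V → ℝ}
    (hf : ∀ i, ContDiff ℝ ∞ (f i)) (hW : ∀ i v, 0 ≤ W i v)
    (hb : ∀ n, ∃ C, ∀ i v, ‖iteratedFDeriv ℝ n (f i) v‖ ≤ C * W i v) (N : ℕ) :
    DerivBound N f W := by
  choose C hC using hb
  refine ⟨hf, ∑ n ∈ Finset.range (N + 1), |C n|, by positivity, fun i v n hn => ?_⟩
  refine (hC n i v).trans (mul_le_mul_of_nonneg_right ((le_abs_self _).trans ?_) (hW i v))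
  exact Finset.single_le_sum (f := fun n => |C n|) (fun _ _ => abs_nonneg _)
    (Finset.mem_range.2 (by omega))

/-- The gradient in `y` of the phase, at `(q, p) = z`. -/
def grad (Θ : Matrix (Fin d) (Fin d) ℂ) (z : E d × E d) (j : Fin d) (y : E d) : ℂ :=
  -((z.2 j : ℝ) : ℂ) + Complex.I * ∑ l, Θ j l * (((y l - z.1 l : ℝ)) : ℂ)

theorem pderiv_quad {Θ : Matrix (Fin d) (Fin d) ℂ} (hΘ : Θ.IsSymm) (j : Fin d) (w : E d) :
    pderiv j (quad Θ) w = 2 * ∑ l, Θ j l * ((w l : ℝ) : ℂ) := by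
  have hco : ∀ i : Fin d, HasFDerivAt (fun w : E d => ((w i : ℝ) : ℂ))
      (Complex.ofRealCLM.comp (EuclideanSpace.proj (𝕜 := ℝ) i)) w := fun i =>
    (Complex.ofRealCLM.comp (EuclideanSpace.proj (𝕜 := ℝ) i)).hasFDerivAt
  have h : HasFDerivAt (quad Θ) (∑ i, ∑ l,
      (((w i : ℝ) : ℂ) * Θ i l) • (Complex.ofRealCLM.comp (EuclideanSpace.proj (𝕜 := ℝ) l)) +
      ∑ i, ∑ l, ((w l : ℝ) : ℂ) • Θ i l •
        (Complex.ofRealCLM.comp (EuclideanSpace.proj (𝕜 := ℝ) i))) w := by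
    rw [← Finset.sum_add_distrib]
    simp only [← Finset.sum_add_distrib]
    unfold quad
    exact HasFDerivAt.fun_sum fun i _ => HasFDerivAt.fun_sum fun l _ =>
      ((hco i).mul_const (Θ i l)).mul (hco l)
  rw [pderiv, h.fderiv]
  simp only [add_apply, sum_apply,
    smul_apply, ContinuousLinearMap.comp_apply, PiLp.proj_apply,
    Complex.ofRealCLM_apply, smul_eq_mul, PiLp.single_apply]
  simp only [apply_ite (fun t : ℝ => (t : ℂ)), Complex.ofReal_one, Complex.ofReal_zero, mul_ite,
    mul_one, mul_zero, Finset.sum_ite_eq', Finset.mem_univ, if_true]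
  have h2 : ∑ i, ∑ l, (if i = j then ((w l : ℝ) : ℂ) * Θ i l else 0) =
      ∑ l, Θ j l * ((w l : ℝ) : ℂ) := by
    rw [Finset.sum_comm]
    simp only [Finset.sum_ite_eq', Finset.mem_univ, if_true, mul_comm]
  rw [h2, two_mul]
  congr 1
  refine Finset.sum_congr rfl fun i _ => ?_
  rw [mul_comm, hΘ.apply]

theorem hasFDerivAt_phase (κ : E d × E d ≃ E d × E d) (S : E d × E d → ℝ)
    (Θx Θy : Matrix (Fin d) (Fin d) ℂ) (x y q p : E d) :
    HasFDerivAt (fun y => phase κ S Θx Θy x y q p)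
      (-(Complex.ofRealCLM.comp (innerSL ℝ p)) + (Complex.I / 2) • fderiv ℝ (quad Θy) (y - q)) y := by
  have h1 : HasFDerivAt (fun y : E d => ((inner ℝ p (y - q) : ℝ) : ℂ))
      (Complex.ofRealCLM.comp (innerSL ℝ p)) y := by
    have := (Complex.ofRealCLM.comp (innerSL ℝ p)).hasFDerivAt.comp y
      ((hasFDerivAt_id y).sub_const q)
    rw [ContinuousLinearMap.comp_id] at this
    exact this
  have h2 : HasFDerivAt (fun y : E d => quad Θy (y - q)) (fderiv ℝ (quad Θy) (y - q)) y := by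
    have := (((contDiff_quad Θy).differentiable (by simp)) (y - q)).hasFDerivAt.comp y
      ((hasFDerivAt_id y).sub_const q)
    rw [ContinuousLinearMap.comp_id] at this
    exact this
  have h3 := (((hasFDerivAt_const ((S (q, p) : ℂ) +
    ((inner ℝ (κ (q, p)).2 (x - (κ (q, p)).1) : ℝ) : ℂ)) y).sub h1).add
    (hasFDerivAt_const (Complex.I / 2 * quad Θx (x - (κ (q, p)).1)) y)).add
      (h2.const_mul (Complex.I / 2))
  rw [zero_sub, add_zero] at h3
  exact h3

/-- The gradient in `y` involves neither `x`, nor `κ`, nor `S`, so the whole calculus of `L†` can be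
carried out with the affine functions `grad`. Symmetry of `Θy` merges the two halves of the
derivative of the quadratic form. -/
theorem pderiv_phase (κ : E d × E d ≃ E d × E d) (S : E d × E d → ℝ)
    (Θx : Matrix (Fin d) (Fin d) ℂ) {Θy : Matrix (Fin d) (Fin d) ℂ} (hΘ : Θy.IsSymm)
    (x q p : E d) (j : Fin d) :
    pderiv j (fun y => phase κ S Θx Θy x y q p) = grad Θy (q, p) j := by
  funext y
  have h := pderiv_quad hΘ j (y - q)
  rw [pderiv] at h
  rw [pderiv, (hasFDerivAt_phase κ S Θx Θy x y q p).fderiv]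
  simp only [add_apply, neg_apply,
    smul_apply, h, smul_eq_mul, ContinuousLinearMap.comp_apply, grad,
    Complex.ofRealCLM_apply, innerSL_apply_apply, EuclideanSpace.inner_single_right]
  simp
  ring

/-- The operator `Ldagger` in terms of the gradient `g` of the phase. -/
def gradDagger (ε : ℝ) (g : Fin d → E d → ℂ) (v : E d → ℂ) (y : E d) : ℂ :=
  v y * (1 + ∑ l, g l y * (starRingEnd ℂ) (g l y))⁻¹ +
    Complex.I * ε * ∑ j, pderiv j (fun y' => (starRingEnd ℂ) (g j y') * v y' *
      (1 + ∑ l, g l y' * (starRingEnd ℂ) (g l y'))⁻¹) y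

theorem Ldagger_eq (ε : ℝ) (f : E d → ℂ) :
    Ldagger ε f = gradDagger ε (fun j => pderiv j f) := by
  funext v y
  simp only [Ldagger, gradDagger, Complex.mul_conj', div_eq_mul_inv]

variable (Θ : Matrix (Fin d) (Fin d) ℂ)

/-- The length `(1 + |∇Φ|²)^{1/2}`. -/
def gradLen (z : E d × E d) (y : E d) : ℝ := Real.sqrt (1 + ∑ l, ‖grad Θ z l y‖ ^ 2)

theorem one_le_gradLen (z : E d × E d) (y : E d) : 1 ≤ gradLen Θ z y :=
  Real.one_le_sqrt.2 (le_add_of_nonneg_right (by positivity))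

theorem gradLen_sq (z : E d × E d) (y : E d) :
    gradLen Θ z y ^ 2 = 1 + ∑ l, ‖grad Θ z l y‖ ^ 2 :=
  Real.sq_sqrt (by positivity)

theorem norm_grad_le (z : E d × E d) (j : Fin d) (y : E d) :
    ‖grad Θ z j y‖ ≤ gradLen Θ z y := by
  refine Real.le_sqrt_of_sq_le ?_
  have := Finset.single_le_sum (f := fun l => ‖grad Θ z l y‖ ^ 2)
    (fun l _ => sq_nonneg _) (Finset.mem_univ j)
  linarith

theorem contDiff_grad (j : Fin d) :
    ContDiff ℝ ∞ fun w : (E d × E d) × E d => grad Θ w.1 j w.2 := by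
  unfold grad
  have hc : ∀ l : Fin d, ContDiff ℝ ∞ fun w : E d => w l := fun l =>
    (EuclideanSpace.proj (𝕜 := ℝ) l).contDiff
  have hr : ∀ {f : (E d × E d) × E d → ℝ}, ContDiff ℝ ∞ f → ContDiff ℝ ∞ fun w => (f w : ℂ) :=
    fun h => Complex.ofRealCLM.contDiff.comp h
  refine (hr ((hc j).comp contDiff_fst.snd)).neg.add (contDiff_const.mul
    (ContDiff.sum fun l _ => contDiff_const.mul (hr ?_)))
  exact ((hc l).comp contDiff_snd).sub ((hc l).comp contDiff_fst.fst)

/-- The gradient is affine in `y` with linear part independent of `z`, and `gradLen ≥ 1` bounds that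
constant derivative. -/
theorem derivBound_grad (j : Fin d) (N : ℕ) :
    DerivBound N (fun z => grad Θ z j) (gradLen Θ) := by
  have hsm : ∀ z, ContDiff ℝ ∞ (grad Θ z j) := fun z =>
    (contDiff_grad Θ j).comp (contDiff_const.prodMk contDiff_id)
  have h0 : DerivBound 0 (fun z => grad Θ z j) (gradLen Θ) :=
    DerivBound.zero_iff.2 ⟨hsm, 1, zero_le_one, fun z y => by
      rw [one_mul]; exact norm_grad_le Θ z j y⟩
  rcases N with _ | N
  · exact h0
  refine DerivBound.fderiv_iff.2 ⟨h0, ?_⟩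
  let L : E d →L[ℝ] ℂ := ∑ l, (Complex.I * Θ j l) •
    (Complex.ofRealCLM.comp (EuclideanSpace.proj (𝕜 := ℝ) l))
  have hL : ∀ z y, fderiv ℝ (grad Θ z j) y = L := fun z y => by
    have : grad Θ z j = fun y => L y + grad Θ z j 0 := by
      funext y
      simp only [grad, L, sum_apply, smul_apply,
        ContinuousLinearMap.comp_apply, PiLp.proj_apply, Complex.ofRealCLM_apply,
        smul_eq_mul, Finset.mul_sum]
      rw [add_left_comm, ← Finset.sum_add_distrib]
      congr 1
      refine Finset.sum_congr rfl fun l _ => ?_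
      simp
      ring
    rw [this]
    exact (L.hasFDerivAt.add_const _).fderiv
  simp only [hL]
  refine (DerivBound.const (fun _ : E d × E d => L) (fun _ => ‖L‖) (fun _ => le_rfl)).mono ‖L‖
    (norm_nonneg _) fun z y => ?_
  exact le_mul_of_one_le_right (norm_nonneg _) (one_le_gradLen Θ z y)

theorem derivBound_grad_inv (N : ℕ) :
    DerivBound N (fun z y => (1 + ∑ l, grad Θ z l y * (starRingEnd ℂ) (grad Θ z l y))⁻¹)
      (fun z y => (gradLen Θ z y ^ 2)⁻¹) := by
  have hpos : ∀ z y, 0 < gradLen Θ z y := fun z y => one_pos.trans_le (one_le_gradLen Θ z y)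
  refine DerivBound.inv (W := fun z y => gradLen Θ z y ^ 2) one_pos
    (fun z y => pow_pos (hpos z y) 2) ?_ fun z y => ?_
  · have h1 : DerivBound N (fun (_ : E d × E d) (_ : E d) => (1 : ℂ))
        (fun z y => gradLen Θ z y ^ 2) :=
      (DerivBound.const (fun _ => (1 : ℂ)) (fun _ => 1) (fun _ => by simp)).mono 1 zero_le_one
        fun z y => by rw [one_mul]; exact one_le_pow₀ (one_le_gradLen Θ z y)
    refine h1.add (DerivBound.sum _ fun l _ => ?_)
    refine ((derivBound_grad Θ l N).mul ((derivBound_grad Θ l N).clm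
      (Complex.conjCLE : ℂ →L[ℝ] ℂ))).mono 1 zero_le_one fun z y => ?_
    rw [one_mul, sq]
  · simp only [Complex.mul_conj']
    have : (1 + ∑ l, ((‖grad Θ z l y‖ : ℝ) : ℂ) ^ 2) = ((gradLen Θ z y ^ 2 : ℝ) : ℂ) := by
      rw [gradLen_sq]; push_cast; rfl
    rw [this, Complex.norm_real, Real.norm_of_nonneg (by positivity), one_mul]

/-- The conjugate gradient contributes `gradLen` and the denominator `gradLen⁻²`, a net gain of one
power. -/
theorem derivBound_gradField {N : ℕ} {v : E d × E d → E d → ℂ} {W : E d × E d → E d → ℝ}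
    (hv : DerivBound N v W) (j : Fin d) :
    DerivBound N (fun z y => (starRingEnd ℂ) (grad Θ z j y) * v z y *
      (1 + ∑ l, grad Θ z l y * (starRingEnd ℂ) (grad Θ z l y))⁻¹)
      (fun z y => W z y * (gradLen Θ z y)⁻¹) := by
  refine ((((derivBound_grad Θ j N).clm (Complex.conjCLE : ℂ →L[ℝ] ℂ)).mul hv).mul
    (derivBound_grad_inv Θ N)).mono 1 zero_le_one fun z y => le_of_eq ?_
  have := (one_pos.trans_le (one_le_gradLen Θ z y)).ne'
  field_simp

theorem derivBound_mul_grad_inv {N : ℕ} {v : E d × E d → E d → ℂ} {W : E d × E d → E d → ℝ}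
    (hW : ∀ z y, 0 ≤ W z y) (hv : DerivBound N v W) :
    DerivBound N (fun z y => v z y *
      (1 + ∑ l, grad Θ z l y * (starRingEnd ℂ) (grad Θ z l y))⁻¹)
      (fun z y => W z y * (gradLen Θ z y)⁻¹) := by
  refine (hv.mul (derivBound_grad_inv Θ N)).mono 1 zero_le_one fun z y => ?_
  rw [one_mul]
  refine mul_le_mul_of_nonneg_left (inv_anti₀ (one_pos.trans_le (one_le_gradLen Θ z y)) ?_) (hW z y)
  exact le_self_pow₀ (one_le_gradLen Θ z y) two_ne_zero

/-- One application of `L†` costs one derivative and gains one power of `gradLen⁻¹`; the term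
without derivative gains two, of which one is kept. -/
theorem derivBound_gradDagger (ε : ℝ) {N : ℕ} {v : E d × E d → E d → ℂ}
    {W : E d × E d → E d → ℝ} (hW : ∀ z y, 0 ≤ W z y) (hv : DerivBound (N + 1) v W) :
    DerivBound N (fun z => gradDagger ε (grad Θ z) (v z)) (fun z y => W z y * (gradLen Θ z y)⁻¹) := by
  refine (derivBound_mul_grad_inv Θ hW (hv.of_le (Nat.le_succ N))).add
    ((DerivBound.sum Finset.univ fun j _ => ?_).clm (ContinuousLinearMap.mul ℝ ℂ (Complex.I * ε)))
  exact (derivBound_gradField Θ hv j).fderiv_apply (fun _ => EuclideanSpace.single j 1)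
    (fun _ => by simp)

theorem derivBound_gradDagger_iterate (ε : ℝ) (k : ℕ) {N : ℕ} {v : E d × E d → E d → ℂ}
    {W : E d × E d → E d → ℝ} (hW : ∀ z y, 0 ≤ W z y) (hv : DerivBound (N + k) v W) :
    DerivBound N (fun z => (gradDagger ε (grad Θ z))^[k] (v z))
      (fun z y => W z y * (gradLen Θ z y)⁻¹ ^ k) := by
  induction k generalizing v W with
  | zero => simpa using hv
  | succ k ih =>
    have hpos : ∀ z y, 0 < gradLen Θ z y := fun z y => one_pos.trans_le (one_le_gradLen Θ z y)
    simp only [Function.iterate_succ, Function.comp_apply]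
    refine (ih (fun z y => mul_nonneg (hW z y) (inv_nonneg.2 (hpos z y).le))
      (derivBound_gradDagger Θ ε hW (by rwa [add_assoc]))).mono 1 zero_le_one fun z y => ?_
    rw [one_mul, pow_succ, mul_assoc, mul_comm (_ ^ k)]

theorem contDiff_pderiv_param {G : (E d × E d) × E d → ℂ} (hG : ContDiff ℝ ∞ G) (j : Fin d) :
    ContDiff ℝ ∞ fun w : (E d × E d) × E d => pderiv j (fun y => G (w.1, y)) w.2 := by
  unfold pderiv
  have hmap : ContDiff ℝ ∞ fun s : ((E d × E d) × E d) × E d => (s.1.1, s.2) :=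
    contDiff_fst.fst.prodMk contDiff_snd
  have hfull : ContDiff ℝ ∞ (Function.uncurry fun (w : (E d × E d) × E d) (y : E d) =>
      G (w.1, y)) := hG.comp hmap
  exact (hfull.fderiv (m := ∞) contDiff_snd (by simp)).clm_apply contDiff_const

/-- Joint regularity in `(z, y)` is needed for the measurability of the oscillatory integrand over
all its variables. -/
theorem contDiff_gradDagger_iterate (ε : ℝ) (k : ℕ) {v : E d × E d → E d → ℂ}
    (hv : ContDiff ℝ ∞ fun w : (E d × E d) × E d => v w.1 w.2) :
    ContDiff ℝ ∞ fun w : (E d × E d) × E d => (gradDagger ε (grad Θ w.1))^[k] (v w.1) w.2 := by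
  induction k generalizing v with
  | zero => exact hv
  | succ k ih =>
    simp only [Function.iterate_succ, Function.comp_apply]
    refine ih (v := fun z => gradDagger ε (grad Θ z) (v z)) ?_
    have hg := contDiff_grad Θ
    have hc : ∀ j, ContDiff ℝ ∞ fun w : (E d × E d) × E d =>
        (starRingEnd ℂ) (grad Θ w.1 j w.2) := fun j =>
      (Complex.conjCLE : ℂ →L[ℝ] ℂ).contDiff.comp (hg j)
    have hq : ContDiff ℝ ∞ fun w : (E d × E d) × E d =>
        (1 + ∑ l, grad Θ w.1 l w.2 * (starRingEnd ℂ) (grad Θ w.1 l w.2))⁻¹ := by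
      refine ContDiff.inv (contDiff_const.add (ContDiff.sum fun l _ => (hg l).mul (hc l)))
        fun w => ?_
      simp only [Complex.mul_conj']
      have : (1 + ∑ l, ((‖grad Θ w.1 l w.2‖ : ℝ) : ℂ) ^ 2) =
          ((gradLen Θ w.1 w.2 ^ 2 : ℝ) : ℂ) := by
        rw [gradLen_sq]; push_cast; rfl
      rw [this]
      exact_mod_cast (pow_pos (one_pos.trans_le (one_le_gradLen Θ w.1 w.2)) 2).ne'
    unfold gradDagger
    refine (hv.mul hq).add (contDiff_const.mul (ContDiff.sum fun j _ => ?_))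
    exact contDiff_pderiv_param (G := fun w : (E d × E d) × E d =>
      (starRingEnd ℂ) (grad Θ w.1 j w.2) * v w.1 w.2 *
        (1 + ∑ l, grad Θ w.1 l w.2 * (starRingEnd ℂ) (grad Θ w.1 l w.2))⁻¹)
      (((hc j).mul hv).mul hq) j

end Transpose


/-! ### Removing `L†` under the integral, and the lower bound for the gradient. -/

section Transpose

open MeasureTheory Filter

variable {d : ℕ} (Θ : Matrix (Fin d) (Fin d) ℂ)

theorem grad_conj_sum_ne_zero (z : E d × E d) (y : E d) :
    (1 + ∑ l, grad Θ z l y * (starRingEnd ℂ) (grad Θ z l y)) ≠ 0 := by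
  simp only [Complex.mul_conj']
  have : (1 + ∑ l, ((‖grad Θ z l y‖ : ℝ) : ℂ) ^ 2) = ((gradLen Θ z y ^ 2 : ℝ) : ℂ) := by
    rw [gradLen_sq]; push_cast; rfl
  rw [this]
  exact_mod_cast (pow_pos (one_pos.trans_le (one_le_gradLen Θ z y)) 2).ne'

/-- `gradDagger` is the transpose of a first order operator fixing the exponential `e`. -/
theorem integral_mul_gradDagger {ε : ℝ} (hε : 0 < ε) (z : E d × E d) {e : E d → ℂ} {B : ℝ}
    (he : Differentiable ℝ e) (heB : ∀ y, ‖e y‖ ≤ B)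
    (hed : ∀ j y, pderiv j e y = Complex.I / ε * grad Θ z j y * e y) {k : ℕ} (hk : d < k)
    {v : E d → ℂ} (hv : DerivBound 1 (fun _ : E d × E d => v) (fun _ y => dec k y)) :
    ∫ y, e y * gradDagger ε (grad Θ z) v y = ∫ y, e y * v y := by
  set q : E d → ℂ := fun y => (1 + ∑ l, grad Θ z l y * (starRingEnd ℂ) (grad Θ z l y))⁻¹ with hq
  set G : Fin d → E d → ℂ := fun j y => (starRingEnd ℂ) (grad Θ z j y) * v y * q y with hG
  have hlen : ∀ y, 1 ≤ gradLen Θ z y := one_le_gradLen Θ z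
  have hB : 0 ≤ B := (norm_nonneg _).trans (heB 0)
  have hdec : Integrable (fun y : E d => dec k y) := integrable_dec volume (by simpa using hk)
  have hInt : ∀ {F : E d → ℂ} {C : ℝ}, Continuous F → (∀ y, ‖F y‖ ≤ C * dec k y) →
      Integrable F := fun hF hb =>
    (hdec.const_mul _).mono' hF.aestronglyMeasurable (Eventually.of_forall hb)
  have hmulB : ∀ {F : E d → ℂ} {C : ℝ}, (∀ y, ‖F y‖ ≤ C * dec k y) →
      ∀ y, ‖e y * F y‖ ≤ B * C * dec k y := fun hb y => by
    rw [norm_mul, mul_assoc]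
    exact mul_le_mul (heB y) (hb y) (norm_nonneg _) hB
  have hvq := derivBound_mul_grad_inv Θ (fun _ y => (dec_pos k y).le) (hv.of_le zero_le_one)
  have hGb := derivBound_gradField Θ hv
  have hcontG : ∀ j, ContDiff ℝ ∞ (G j) := fun j => (hGb j).1 z
  have hdG : ∀ y, dec k y * (gradLen Θ z y)⁻¹ ≤ dec k y := fun y =>
    mul_le_of_le_one_right (dec_pos k y).le (inv_le_one_of_one_le₀ (hlen y))
  have ivq : Integrable fun y => e y * (v y * q y) := by
    obtain ⟨hc, C, hC, hb⟩ := hvq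
    refine hInt (C := B * C) (he.continuous.mul (hc z).continuous) (hmulB fun y => ?_)
    have := hb z y 0 le_rfl
    rw [norm_iteratedFDeriv_zero] at this
    refine this.trans (mul_le_mul_of_nonneg_left ?_ hC)
    exact mul_le_of_le_one_right (dec_pos k y).le (inv_le_one_of_one_le₀ (hlen y))
  have iG : ∀ j, Integrable fun y => e y * G j y := fun j => by
    obtain ⟨hc, C, hC, hb⟩ := hGb j
    refine hInt (C := B * C) (he.continuous.mul (hcontG j).continuous) (hmulB fun y => ?_)
    have := hb z y 0 zero_le_one
    rw [norm_iteratedFDeriv_zero] at this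
    exact this.trans (mul_le_mul_of_nonneg_left (hdG y) hC)
  have idG : ∀ j, Integrable fun y => e y * pderiv j (G j) y := fun j => by
    obtain ⟨hc, C, hC, hb⟩ := hGb j
    refine hInt (C := B * C) (he.continuous.mul
      (((hcontG j).continuous_fderiv (by simp)).clm_apply continuous_const)) (hmulB fun y => ?_)
    have := hb z y 1 le_rfl
    rw [norm_iteratedFDeriv_one] at this
    refine (ContinuousLinearMap.le_opNorm _ _).trans ?_
    rw [PiLp.norm_single, norm_one, mul_one]
    exact this.trans (mul_le_mul_of_nonneg_left (hdG y) hC)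
  have igG : ∀ j, Integrable fun y => e y * (grad Θ z j y * G j y) := fun j => by
    obtain ⟨hc, C, hC, hb⟩ := hGb j
    refine hInt (C := B * C) (he.continuous.mul
      (((derivBound_grad Θ j 0).1 z).continuous.mul (hcontG j).continuous)) (hmulB fun y => ?_)
    have := hb z y 0 zero_le_one
    rw [norm_iteratedFDeriv_zero] at this
    rw [norm_mul]
    have hpos := one_pos.trans_le (hlen y)
    calc _ ≤ gradLen Θ z y * (C * (dec k y * (gradLen Θ z y)⁻¹)) :=
          mul_le_mul (norm_grad_le Θ z j y) this (norm_nonneg _) hpos.le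
      _ = C * dec k y * (gradLen Θ z y * (gradLen Θ z y)⁻¹) := by ring
      _ = _ := by rw [mul_inv_cancel₀ hpos.ne', mul_one]
  -- Moving `∂_j` onto `e` produces `(i/ε) g_j e`; the prefactor `iε` in `L†` then cancels all
  -- constants and leaves `g_j conj(g_j)`.
  have ibp : ∀ j, ∫ y, e y * pderiv j (G j) y =
      -(Complex.I / ε) * ∫ y, e y * (grad Θ z j y * G j y) := fun j => by
    have h1 : (fun y => fderiv ℝ e y (EuclideanSpace.single j 1) * G j y) =
        fun y => (Complex.I / ε) * (e y * (grad Θ z j y * G j y)) := by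
      funext y
      have := hed j y
      rw [pderiv] at this
      rw [this]; ring
    have h := integral_mul_fderiv_eq_neg_fderiv_mul_of_integrable (𝕜 := ℂ) (μ := volume)
      (f := e) (g := G j) (v := EuclideanSpace.single j 1)
      (by rw [h1]; exact (igG j).const_mul _) (idG j) (iG j) (fun y _ => he y)
      (fun y _ => ((hcontG j).differentiable (by simp)) y)
    rw [h1, integral_const_mul] at h
    rw [neg_mul]
    exact h
  have hεc : (ε : ℂ) ≠ 0 := by exact_mod_cast hε.ne'
  have hcancel : ∀ s : ℂ, Complex.I * ε * (-(Complex.I / ε) * s) = s := fun s => by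
    field_simp
    linear_combination (-s) * Complex.I_sq
  calc ∫ y, e y * gradDagger ε (grad Θ z) v y
      = ∫ y, (e y * (v y * q y) + Complex.I * ε * ∑ j, e y * pderiv j (G j) y) := by
        refine integral_congr_ae (Eventually.of_forall fun y => ?_)
        simp only [gradDagger, ← Finset.mul_sum]
        ring
    _ = (∫ y, e y * (v y * q y)) + Complex.I * ε * ∑ j, ∫ y, e y * pderiv j (G j) y := by
        rw [integral_add ivq ((integrable_finsetSum _ fun j _ => idG j).const_mul _),
          integral_const_mul, integral_finsetSum _ fun j _ => idG j]
    _ = (∫ y, e y * (v y * q y)) + ∑ j, ∫ y, e y * (grad Θ z j y * G j y) := by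
        simp only [ibp, ← Finset.mul_sum, hcancel]
    _ = ∫ y, (e y * (v y * q y) + ∑ j, e y * (grad Θ z j y * G j y)) := by
        rw [integral_add ivq (integrable_finsetSum _ fun j _ => igG j),
          integral_finsetSum _ fun j _ => igG j]
    -- The two contributions add up to `q (1 + ∑ g_l conj(g_l)) = 1`, which says that `L` fixes the
    -- exponential.
    _ = _ := by
        refine integral_congr_ae (Eventually.of_forall fun y => ?_)
        have h0 := grad_conj_sum_ne_zero Θ z y
        have h1 : ∑ j, e y * (grad Θ z j y * G j y) = e y * v y * q y *
            ∑ j, grad Θ z j y * (starRingEnd ℂ) (grad Θ z j y) := by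
          rw [Finset.mul_sum]
          refine Finset.sum_congr rfl fun j _ => ?_
          simp only [hG]; ring
        have h2 : q y * (1 + ∑ l, grad Θ z l y * (starRingEnd ℂ) (grad Θ z l y)) = 1 :=
          inv_mul_cancel₀ h0
        simp only [h1]
        linear_combination (e y * v y) * h2

theorem integral_mul_gradDagger_iterate {ε : ℝ} (hε : 0 < ε) (z : E d × E d) {e : E d → ℂ} {B : ℝ}
    (he : Differentiable ℝ e) (heB : ∀ y, ‖e y‖ ≤ B)
    (hed : ∀ j y, pderiv j e y = Complex.I / ε * grad Θ z j y * e y) {k : ℕ} (hk : d < k) (n : ℕ)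
    {v : E d → ℂ} (hv : ∀ N, DerivBound N (fun _ : E d × E d => v) (fun _ y => dec k y)) :
    ∫ y, e y * (gradDagger ε (grad Θ z))^[n] v y = ∫ y, e y * v y := by
  induction n generalizing v with
  | zero => rfl
  | succ n ih =>
    simp only [Function.iterate_succ, Function.comp_apply]
    rw [ih fun N => ?_, integral_mul_gradDagger Θ hε z he heB hed hk (hv 1)]
    refine ((derivBound_gradDagger Θ ε (fun _ y => (dec_pos k y).le) (hv (N + 1))).reindex
      (fun _ => z)).mono 1 zero_le_one fun _ y => ?_
    rw [one_mul]
    exact mul_le_of_le_one_right (dec_pos k y).le (inv_le_one_of_one_le₀ (one_le_gradLen Θ z y))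

theorem norm_le_sum_abs (p : E d) : ‖p‖ ≤ ∑ j, |p j| := by
  rw [EuclideanSpace.norm_eq]
  refine Real.sqrt_le_iff.2 ⟨by positivity, ?_⟩
  simp only [Real.norm_eq_abs]
  exact Finset.sum_sq_le_sq_sum_of_nonneg fun i _ => abs_nonneg _

/-- Solving `∇_yΦ = -p + iΘ(y - q)` for `p` gives `|p| ≤ d |gradLen| + A |y - q|`, where `A` is the
sum of the absolute values of the entries of `Θ`. The gradient can thus be small for large `p` only
far from `q`, where the Gaussian compensates. -/
theorem exists_inv_gradLen_le : ∃ C, 0 ≤ C ∧ ∀ (z : E d × E d) y,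
    (gradLen Θ z y)⁻¹ ≤ C * ((1 + ‖y - z.1‖) * dec 1 z.2) := by
  refine ⟨1 + d + ∑ j, ∑ l, ‖Θ j l‖, by positivity, fun z y => ?_⟩
  set A := ∑ j, ∑ l, ‖Θ j l‖ with hA
  have hA0 : 0 ≤ A := by positivity
  have hlen := one_le_gradLen Θ z y
  have hn := norm_nonneg (y - z.1)
  have h1 : ∀ j, |z.2 j| ≤ gradLen Θ z y + (∑ l, ‖Θ j l‖) * ‖y - z.1‖ := fun j => by
    have e1 : ((z.2 j : ℝ) : ℂ) = Complex.I * ∑ l, Θ j l * (((y l - z.1 l : ℝ)) : ℂ) -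
        grad Θ z j y := by simp only [grad]; ring
    rw [← Real.norm_eq_abs, ← Complex.norm_real, e1]
    refine (norm_sub_le _ _).trans ?_
    rw [norm_mul, Complex.norm_I, one_mul, add_comm]
    refine add_le_add (norm_grad_le Θ z j y) ((norm_sum_le _ _).trans ?_)
    rw [Finset.sum_mul]
    refine Finset.sum_le_sum fun l _ => ?_
    rw [norm_mul, Complex.norm_real]
    exact mul_le_mul_of_nonneg_left (PiLp.norm_apply_le (y - z.1) l) (norm_nonneg _)
  have h2 : ‖z.2‖ ≤ d * gradLen Θ z y + A * ‖y - z.1‖ := by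
    refine (norm_le_sum_abs z.2).trans ((Finset.sum_le_sum fun j _ => h1 j).trans (le_of_eq ?_))
    rw [Finset.sum_add_distrib, ← Finset.sum_mul]
    simp [hA]
  have h3 : 1 + ‖z.2‖ ≤ (1 + d + A) * (1 + ‖y - z.1‖) * gradLen Θ z y := by
    have hd : (0 : ℝ) ≤ d := Nat.cast_nonneg d
    have h4 : A * ‖y - z.1‖ ≤ A * ‖y - z.1‖ * gradLen Θ z y :=
      le_mul_of_one_le_right (by positivity) hlen
    have h5 : 0 ≤ (‖y - z.1‖ + d * ‖y - z.1‖ + A) * gradLen Θ z y := by positivity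
    nlinarith
  have hpos := one_pos.trans_le hlen
  unfold dec
  rw [pow_one, ← mul_assoc, ← div_eq_mul_inv, inv_eq_one_div,
    div_le_div_iff₀ hpos (by positivity), one_mul]
  exact h3

end Transpose


/-! ### The oscillatory integral as a superposition of wave packets. -/

section Canonical

open MeasureTheory Filter

variable {d : ℕ}

/-- The kernel data of the Fourier integral operator attached to `κ`. -/
def canonicalData (κ : E d × E d ≃ E d × E d) (S : E d × E d → ℝ)
    (Θx Θy : Matrix (Fin d) (Fin d) ℂ) (hx : (Θx.map Complex.re).PosDef)
    (hy : (Θy.map Complex.re).PosDef) {ε : ℝ} (hε : 0 < ε) (hκ : Continuous κ) (hS : Continuous S)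
    (K : ℝ) (hK : 1 ≤ K) (h1 : ∀ z, 1 + ‖κ z‖ ≤ K * (1 + ‖z‖))
    (h2 : ∀ z, 1 + ‖z‖ ≤ K * (1 + ‖κ z‖)) : WaveData d where
  ε := ε
  ε_pos := hε
  Θ₁ := Θx
  Θ₂ := Θy
  posDef₁ := hx
  posDef₂ := hy
  c := fun z => Complex.exp (((ε⁻¹ * S z : ℝ) : ℂ) * Complex.I)
  a := κ
  b := fun z => (z.1, -z.2)
  c_cont := by fun_prop
  a_cont := hκ
  b_cont := by fun_prop
  c_le := fun z => (Complex.norm_exp_ofReal_mul_I _).le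
  K := K
  K_nonneg := zero_le_one.trans hK
  a_le := h1
  b_le := fun z => by
    rw [show ‖((z.1, -z.2) : E d × E d)‖ = ‖z‖ by simp [Prod.norm_def]]
    exact le_mul_of_one_le_left (by positivity) hK
  le_a := h2
  le_b := fun z => by
    rw [show ‖((z.1, -z.2) : E d × E d)‖ = ‖z‖ by simp [Prod.norm_def]]
    exact le_mul_of_one_le_left (by positivity) hK

variable {κ : E d × E d ≃ E d × E d} {S : E d × E d → ℝ} {Θx Θy : Matrix (Fin d) (Fin d) ℂ} {ε : ℝ}

theorem exp_phase_eq (x y q p : E d) :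
    Complex.exp (Complex.I / ε * phase κ S Θx Θy x y q p) =
      Complex.exp (((ε⁻¹ * S (q, p) : ℝ) : ℂ) * Complex.I) *
        packet Θx ε (κ (q, p)).1 (κ (q, p)).2 x * packet Θy ε q (-p) y := by
  simp only [packet, packetExponent, ← Complex.exp_add]
  congr 1
  simp only [phase, inner_neg_left]
  push_cast
  ring

theorem kern_canonicalData (hx : (Θx.map Complex.re).PosDef)
    (hy : (Θy.map Complex.re).PosDef) (hε : 0 < ε) (hκ : Continuous κ) (hS : Continuous S)
    {K : ℝ} (hK : 1 ≤ K) (h1 : ∀ z, 1 + ‖κ z‖ ≤ K * (1 + ‖z‖))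
    (h2 : ∀ z, 1 + ‖z‖ ≤ K * (1 + ‖κ z‖))
    (u : E4 d → ℂ) (x y q p : E d) :
    (canonicalData κ S Θx Θy hx hy hε hκ hS K hK h1 h2).kern u x y (q, p) =
      Complex.exp (Complex.I / ε * phase κ S Θx Θy x y q p) * u (x, y, q, p) := by
  rw [exp_phase_eq]
  rfl

theorem differentiable_exp_phase (x q p : E d) :
    Differentiable ℝ fun y => Complex.exp (Complex.I / ε * phase κ S Θx Θy x y q p) := fun y =>
  ((hasFDerivAt_phase κ S Θx Θy x y q p).const_mul (Complex.I / ε)).cexp.differentiableAt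

theorem pderiv_exp_phase (hΘ : Θy.IsSymm) (x y q p : E d) (j : Fin d) :
    pderiv j (fun y => Complex.exp (Complex.I / ε * phase κ S Θx Θy x y q p)) y =
      Complex.I / ε * grad Θy (q, p) j y *
        Complex.exp (Complex.I / ε * phase κ S Θx Θy x y q p) := by
  have h := congrFun (pderiv_phase κ S Θx hΘ x q p j) y
  rw [pderiv, (hasFDerivAt_phase κ S Θx Θy x y q p).fderiv] at h
  rw [pderiv, ((hasFDerivAt_phase κ S Θx Θy x y q p).const_mul (Complex.I / ε)).cexp.fderiv,
    ← h]
  simp only [smul_apply, smul_eq_mul]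
  ring

theorem oscIntegrand_eq (hΘ : Θy.IsSymm) (k : ℕ) (u : E4 d → ℂ) (φ : 𝓢(E d, ℂ)) (x : E d)
    (t : E d × E d × E d) :
    oscIntegrand κ S Θx Θy ε k u φ x t =
      Complex.exp (Complex.I / ε * phase κ S Θx Θy x t.2.2 t.1 t.2.1) *
        (gradDagger ε (grad Θy (t.1, t.2.1)))^[k] (fun y => u (x, y, t.1, t.2.1) * φ y) t.2.2 := by
  rw [oscIntegrand, Ldagger_eq]
  simp only [pderiv_phase κ S Θx hΘ]

theorem exists_exp_phase_le (hx : (Θx.map Complex.re).PosDef)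
    (hy : (Θy.map Complex.re).PosDef) (hε : 0 < ε) (M : ℕ) : ∃ C, 0 ≤ C ∧ ∀ x y q p : E d,
    ‖Complex.exp (Complex.I / ε * phase κ S Θx Θy x y q p)‖ ≤ C * dec M (y - q) := by
  obtain ⟨-, C, hC, hb⟩ := derivBound_packet hx hε 0 0
  obtain ⟨-, C', hC', hb'⟩ := derivBound_packet hy hε 0 M
  refine ⟨C * C', by positivity, fun x y q p => ?_⟩
  have e1 := hb (κ (q, p)) x 0 le_rfl
  have e2 := hb' (q, -p) y 0 le_rfl
  simp only [norm_iteratedFDeriv_zero, pow_zero, one_mul, dec, inv_one, mul_one] at e1 e2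
  rw [exp_phase_eq, norm_mul, norm_mul, Complex.norm_exp_ofReal_mul_I, one_mul, mul_assoc]
  exact mul_le_mul e1 e2 (norm_nonneg _) hC

theorem derivBound_slice {u : E4 d → ℂ} {m : ℕ} {P : E d → ℝ}
    (hub : ∀ N, DerivBound N (fun _ : Unit => u) (fun _ w =>
      (1 + ‖w.1‖) ^ m * (1 + ‖w.2.1‖) ^ m * (1 + ‖w.2.2.1‖) ^ m * P w.2.2.2))
    (φ : 𝓢(E d, ℂ)) (x : E d) (l N : ℕ) :
    DerivBound N (fun (z : E d × E d) y => u (x, y, z) * φ y)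
      (fun z y => (1 + ‖z.1‖) ^ m * P z.2 * dec l y) := by
  have h1 := ((hub N).reindex (fun _ : E d × E d => ())).comp_affine
    ((0 : E d →L[ℝ] E d).prod ((ContinuousLinearMap.id ℝ (E d)).prod
        (0 : E d →L[ℝ] E d × E d))) (fun z => (x, 0, z))
  have h2 := (derivBound_schwartz (V := E d) N (l + m)).reindex (fun _ : E d × E d => φ)
  have h := h1.mul h2
  simp only [ContinuousLinearMap.prod_apply, Prod.mk_add_mk, zero_apply,
    zero_add, add_zero, ContinuousLinearMap.id_apply] at h
  refine h.mono ((1 + ‖x‖) ^ m * schwartzNorm (l + m) N φ)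
    (mul_nonneg (by positivity) (apply_nonneg _ _)) fun z y => le_of_eq ?_
  have e : (1 + ‖y‖) ^ m * dec (l + m) y = dec l y := by
    rw [dec_add, mul_left_comm, pow_mul_dec, mul_one]
  rw [← e]
  ring

/-- The Gaussian in `y - q` is used to order `k + r`. Its first `k` powers pay for the loss in the
`k` gains of `1/(1 + |p|)`; Peetre's inequality turns the other `r = m + (d + 1)` into decay in `q`,
with `m` spent on the growth of `u` and `d + 1` left for integrability. The Schwartz function pays
the resulting `(1 + |y|)^r`. -/
theorem oscIntegrand_bound (hx : (Θx.map Complex.re).PosDef)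
    (hy : (Θy.map Complex.re).PosDef) (hε : 0 < ε) (hΘ : Θy.IsSymm) (k : ℕ) {u : E4 d → ℂ}
    {m : ℕ} {P : E d → ℝ}
    (hP : ∀ p, 0 ≤ P p)
    (hub : ∀ N, DerivBound N (fun _ : Unit => u) (fun _ w =>
      (1 + ‖w.1‖) ^ m * (1 + ‖w.2.1‖) ^ m * (1 + ‖w.2.2.1‖) ^ m * P w.2.2.2))
    (φ : 𝓢(E d, ℂ)) (x : E d) : ∃ C, ∀ t : E d × E d × E d,
      ‖oscIntegrand κ S Θx Θy ε k u φ x t‖ ≤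
        C * (dec (d + 1) t.1 * ((P t.2.1 * dec k t.2.1) * dec (d + 1) t.2.2)) := by
  set r := m + (d + 1) with hr
  obtain ⟨Ce, hCe, he⟩ := exists_exp_phase_le (κ := κ) (S := S) hx hy hε (k + r)
  obtain ⟨Cg, hCg, hg⟩ := exists_inv_gradLen_le Θy
  obtain ⟨-, C, hC, hb⟩ := derivBound_gradDagger_iterate Θy ε k
    (fun z y => mul_nonneg (mul_nonneg (by positivity) (hP z.2)) (dec_pos _ y).le)
    (derivBound_slice hub φ x (d + 1 + r) (0 + k))
  refine ⟨Ce * C * Cg ^ k, fun t => ?_⟩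
  obtain ⟨q, p, y⟩ := t
  rw [oscIntegrand_eq hΘ, norm_mul]
  have e1 := hb (q, p) y 0 le_rfl
  rw [norm_iteratedFDeriv_zero] at e1
  have e2 : (gradLen Θy (q, p) y)⁻¹ ^ k ≤ (Cg * ((1 + ‖y - q‖) * dec 1 p)) ^ k :=
    pow_le_pow_left₀ (inv_nonneg.2 (zero_le_one.trans (one_le_gradLen Θy _ _))) (hg (q, p) y) k
  have hPp := hP p
  have d1 := (dec_pos (d + 1 + r) y).le
  have d2 := (dec_pos (k + r) (y - q)).le
  have d3 := (dec_pos (d + 1) y).le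
  have d4 := (dec_pos k p).le
  have e3 : (1 + ‖y - q‖) ^ k * dec (k + r) (y - q) = dec r (y - q) := by
    rw [dec_add, ← mul_assoc, pow_mul_dec, one_mul]
  have e4 : (1 + ‖y‖) ^ r * dec (d + 1 + r) y = dec (d + 1) y := by
    rw [dec_add, mul_left_comm, pow_mul_dec, mul_one]
  have e5 : (1 + ‖q‖) ^ m * dec r q = dec (d + 1) q := by
    rw [hr, dec_add, ← mul_assoc, pow_mul_dec, one_mul]
  have e6 : dec 1 p ^ k = dec k p := by simp [dec]
  calc _ ≤ (Ce * dec (k + r) (y - q)) * (C * ((1 + ‖q‖) ^ m * P p * dec (d + 1 + r) y *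
          (Cg * ((1 + ‖y - q‖) * dec 1 p)) ^ k)) := by
        refine mul_le_mul (he x y q p) (e1.trans ?_) (norm_nonneg _) (by positivity)
        exact mul_le_mul_of_nonneg_left (mul_le_mul_of_nonneg_left e2 (by positivity)) hC
    _ = Ce * C * Cg ^ k * ((1 + ‖q‖) ^ m * P p * dec 1 p ^ k * dec (d + 1 + r) y *
          ((1 + ‖y - q‖) ^ k * dec (k + r) (y - q))) := by simp only [mul_pow]; ring
    _ ≤ Ce * C * Cg ^ k * ((1 + ‖q‖) ^ m * P p * dec k p * dec (d + 1 + r) y *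
          ((1 + ‖y‖) ^ r * dec r q)) := by
        rw [e3, e6]
        gcongr
        exact dec_sub_le' _ _ _
    _ = Ce * C * Cg ^ k * (((1 + ‖q‖) ^ m * dec r q) * ((P p * dec k p) *
          ((1 + ‖y‖) ^ r * dec (d + 1 + r) y))) := by ring
    _ = _ := by rw [e4, e5]

theorem continuous_oscIntegrand (hκ : Continuous κ) (hS : Continuous S) (hΘ : Θy.IsSymm) (k : ℕ)
    {u : E4 d → ℂ} (hu : ContDiff ℝ ∞ u) (φ : 𝓢(E d, ℂ)) (x : E d) :
    Continuous (oscIntegrand κ S Θx Θy ε k u φ x) := by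
  have hfun : oscIntegrand κ S Θx Θy ε k u φ x = fun t =>
      Complex.exp (Complex.I / ε * phase κ S Θx Θy x t.2.2 t.1 t.2.1) *
        (gradDagger ε (grad Θy (t.1, t.2.1)))^[k] (fun y => u (x, y, t.1, t.2.1) * φ y) t.2.2 :=
    funext fun t => oscIntegrand_eq hΘ k u φ x t
  rw [hfun]
  refine Continuous.mul ?_ ?_
  · refine Complex.continuous_exp.comp (continuous_const.mul ?_)
    have hz : Continuous fun t : E d × E d × E d => (t.1, t.2.1) := by fun_prop
    have hX := hκ.comp hz
    have hq := fun Θ : Matrix (Fin d) (Fin d) ℂ => (contDiff_quad Θ).continuous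
    unfold phase
    refine (((Complex.continuous_ofReal.comp (hS.comp hz)).add
      (Complex.continuous_ofReal.comp (hX.snd.inner (continuous_const.sub hX.fst)))).sub
      (Complex.continuous_ofReal.comp ?_)).add (continuous_const.mul
        ((hq Θx).comp (continuous_const.sub hX.fst))) |>.add
        (continuous_const.mul ((hq Θy).comp ?_))
    · exact (continuous_snd.fst).inner (continuous_snd.snd.sub continuous_fst)
    · exact continuous_snd.snd.sub continuous_fst
  · have h := contDiff_gradDagger_iterate Θy ε k (v := fun z y => u (x, y, z) * φ y) (by
      have h1 : ContDiff ℝ ∞ fun w : (E d × E d) × E d => ((x, w.2, w.1) : E4 d) :=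
        contDiff_const.prodMk (contDiff_snd.prodMk contDiff_fst)
      exact (hu.comp h1).mul ((φ.smooth ⊤).comp contDiff_snd))
    have h' := h.continuous.comp
      (by fun_prop : Continuous fun t : E d × E d × E d => ((t.1, t.2.1), t.2.2))
    simp only [Function.comp_def] at h'
    exact h'

/-- Absolute convergence permits integrating in `y` first; for each `(q, p)` the power of `L†` is
then removed. The right-hand side contains no `k`, which gives the independence of the defining
integral from `k`. -/
theorem integral_oscIntegrand (hx : (Θx.map Complex.re).PosDef)
    (hy : (Θy.map Complex.re).PosDef) (hε : 0 < ε) (hκ : Continuous κ) (hS : Continuous S)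
    {K : ℝ} (hK : 1 ≤ K) (h1 : ∀ z, 1 + ‖κ z‖ ≤ K * (1 + ‖z‖))
    (h2 : ∀ z, 1 + ‖z‖ ≤ K * (1 + ‖κ z‖))
    (hΘ : Θy.IsSymm) (k : ℕ) {u : E4 d → ℂ} {m : ℕ}
    {P : E d → ℝ} (hP : ∀ p, 0 ≤ P p) (hPi : Integrable fun p => P p * dec k p)
    (hub : ∀ N, DerivBound N (fun _ : Unit => u) (fun _ w =>
      (1 + ‖w.1‖) ^ m * (1 + ‖w.2.1‖) ^ m * (1 + ‖w.2.2.1‖) ^ m * P w.2.2.2))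
    (φ : 𝓢(E d, ℂ)) (x : E d) :
    Integrable (oscIntegrand κ S Θx Θy ε k u φ x) ∧
      ∫ t, oscIntegrand κ S Θx Θy ε k u φ x t =
        (canonicalData κ S Θx Θy hx hy hε hκ hS K hK h1 h2).op u φ x := by
  have hu : ContDiff ℝ ∞ u := (hub 0).1 ()
  have hInt : Integrable (oscIntegrand κ S Θx Θy ε k u φ x) := by
    obtain ⟨C, hC⟩ := oscIntegrand_bound (κ := κ) (S := S) hx hy hε hΘ k hP hub φ x
    have hd : Integrable (fun y : E d => dec (d + 1) y) := integrable_dec volume (by simp)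
    exact ((hd.mul_prod (hPi.mul_prod hd)).const_mul C).mono'
      (continuous_oscIntegrand hκ hS hΘ k hu φ x).aestronglyMeasurable
      (Eventually.of_forall hC)
  refine ⟨hInt, ?_⟩
  -- The variables `(q, (p, y))` are regrouped as `((q, p), y)` to make `y` innermost.
  have hmp := volume_preserving_prodAssoc (α₁ := E d) (β₁ := E d) (γ₁ := E d)
  have hInt' : Integrable (fun s : (E d × E d) × E d =>
      oscIntegrand κ S Θx Θy ε k u φ x (s.1.1, s.1.2, s.2)) (volume.prod volume) :=
    (hmp.integrable_comp_emb MeasurableEquiv.prodAssoc.measurableEmbedding).2 hInt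
  rw [← hmp.integral_comp' (oscIntegrand κ S Θx Θy ε k u φ x)]
  refine (integral_prod _ hInt').trans ?_
  unfold WaveData.op
  congr 1
  funext z
  obtain ⟨q, p⟩ := z
  simp only [WaveData.inner, kern_canonicalData, oscIntegrand_eq hΘ]
  obtain ⟨B, -, hB⟩ := exists_exp_phase_le (κ := κ) (S := S) hx hy hε 0
  rw [integral_mul_gradDagger_iterate Θy hε (q, p) (k := d + 1) (B := B)
    (differentiable_exp_phase x q p) (fun y => by simpa [dec] using hB x y q p)
    (fun j y => pderiv_exp_phase hΘ x y q p j) (Nat.lt_succ_self d) k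
    (fun N => ((derivBound_slice hub φ x (d + 1) N).reindex (fun _ => (q, p))).mono
      ((1 + ‖q‖) ^ m * P p) (mul_nonneg (by positivity) (hP p)) fun _ y => le_rfl)]
  simp only [mul_assoc]

end Canonical


/-! ### Exchanging continuous functionals with integrals of Schwartz functions. -/

section SchwartzIntegral

open MeasureTheory Filter Topology

/-- A linear functional bounded by the norm of a linear map factors through this map. -/
theorem exists_factor_of_norm_le {A B : Type*} [AddCommGroup A] [Module ℂ A]
    [NormedAddCommGroup B] [NormedSpace ℂ B] (f : A →ₗ[ℂ] ℂ) (J : A →ₗ[ℂ] B) (C : ℝ)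
    (hJ : ∀ φ, ‖f φ‖ ≤ C * ‖J φ‖) : ∃ F : B →L[ℂ] ℂ, ∀ φ, f φ = F (J φ) := by
  have hker : LinearMap.ker J ≤ LinearMap.ker f := fun φ hφ => by
    have := hJ φ
    rw [LinearMap.mem_ker.1 hφ, norm_zero, mul_zero] at this
    exact norm_le_zero_iff.1 this
  let f₀ : LinearMap.range J →ₗ[ℂ] ℂ :=
    ((LinearMap.ker J).liftQ f hker).comp J.quotKerEquivRange.symm.toLinearMap
  have hf₀ : ∀ φ, f₀ ⟨J φ, LinearMap.mem_range_self J φ⟩ = f φ := fun φ => by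
    have : J.quotKerEquivRange.symm ⟨J φ, LinearMap.mem_range_self J φ⟩ =
        (LinearMap.ker J).mkQ φ := J.quotKerEquivRange_symm_apply_image φ _
    simp only [f₀, LinearMap.comp_apply, LinearEquiv.coe_coe, this]
    rfl
  -- Hahn–Banach extends the functional from the range of `J` to all of `B`.
  obtain ⟨F, hF, -⟩ := exists_extension_norm_eq (𝕜 := ℂ) (LinearMap.range J)
    (f₀.mkContinuous C (by
      rintro ⟨_, φ, rfl⟩
      rw [hf₀]
      exact hJ φ))
  exact ⟨F, fun φ => ((hF ⟨J φ, LinearMap.mem_range_self J φ⟩).trans (hf₀ φ)).symm⟩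

variable {V : Type*} [NormedAddCommGroup V] [NormedSpace ℝ V]

variable (V) in
/-- Complex-valued real-multilinear forms of degree `n`. -/
def MulForm (n : ℕ) : Type _ := V [×n]→L[ℝ] ℂ

instance (n : ℕ) : NormedAddCommGroup (MulForm V n) :=
  inferInstanceAs (NormedAddCommGroup (V [×n]→L[ℝ] ℂ))

instance (n : ℕ) : NormedSpace ℂ (MulForm V n) :=
  inferInstanceAs (NormedSpace ℂ (V [×n]→L[ℝ] ℂ))

instance (n : ℕ) : CompleteSpace (MulForm V n) :=
  inferInstanceAs (CompleteSpace (V [×n]→L[ℝ] ℂ))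

/-- The derivative of order `n`, as a function with values in `MulForm V n`. -/
def iterForm (n : ℕ) (φ : V → ℂ) (v : V) : MulForm V n := iteratedFDeriv ℝ n φ v

/-- The weighted derivative `|v|^k D^n φ(v)` as a bounded continuous function. -/
def weightedDeriv (k n : ℕ) : 𝓢(V, ℂ) →ₗ[ℂ] BoundedContinuousFunction V (MulForm V n) where
  toFun φ := BoundedContinuousFunction.ofNormedAddCommGroup
    (fun v => ((‖v‖ ^ k : ℝ) : ℂ) • iterForm n φ v)
    ((Complex.continuous_ofReal.comp (continuous_norm.pow k)).smul
      ((φ.smooth ⊤).continuous_iteratedFDeriv (by exact_mod_cast le_top)))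
    (SchwartzMap.seminorm ℂ k n φ) fun v => by
      rw [norm_smul, Complex.norm_real, norm_pow, norm_norm]
      exact φ.le_seminorm ℂ k n v
  map_add' φ ψ := by
    ext1 v
    have h : iterForm n (⇑(φ + ψ)) v = iterForm n φ v + iterForm n ψ v :=
      iteratedFDeriv_add_apply (φ.contDiffAt n) (ψ.contDiffAt n)
    change ((‖v‖ ^ k : ℝ) : ℂ) • iterForm n (⇑(φ + ψ)) v =
      ((‖v‖ ^ k : ℝ) : ℂ) • iterForm n φ v + ((‖v‖ ^ k : ℝ) : ℂ) • iterForm n ψ v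
    rw [h, smul_add]
  map_smul' c φ := by
    ext1 v
    have h : iterForm n (⇑(c • φ)) v = c • iterForm n φ v :=
      iteratedFDeriv_const_smul_apply (φ.contDiffAt n)
    change ((‖v‖ ^ k : ℝ) : ℂ) • iterForm n (⇑(c • φ)) v = c • (((‖v‖ ^ k : ℝ) : ℂ) • iterForm n φ v)
    rw [h, smul_comm]

theorem weightedDeriv_apply (k n : ℕ) (φ : 𝓢(V, ℂ)) (v : V) :
    weightedDeriv k n φ v = ((‖v‖ ^ k : ℝ) : ℂ) • iterForm n φ v := rfl

theorem norm_weightedDeriv (k n : ℕ) (φ : 𝓢(V, ℂ)) :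
    ‖weightedDeriv k n φ‖ = SchwartzMap.seminorm ℂ k n φ := by
  refine le_antisymm ?_ ?_
  · refine (BoundedContinuousFunction.norm_le (apply_nonneg _ _)).2 fun v => ?_
    rw [weightedDeriv_apply, norm_smul, Complex.norm_real, norm_pow, norm_norm]
    exact φ.le_seminorm ℂ k n v
  · refine φ.seminorm_le_bound ℂ k n (norm_nonneg _) fun v => ?_
    have := (weightedDeriv k n φ).norm_coe_le_norm v
    rwa [weightedDeriv_apply, norm_smul, Complex.norm_real, norm_pow, norm_norm] at this

/-- A continuous functional on a Schwartz space factors through finitely many weighted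
derivatives. -/
theorem exists_factor_weightedDeriv (f : 𝓢(V, ℂ) →L[ℂ] ℂ) :
    ∃ (s : Finset (ℕ × ℕ)) (F : (∀ i : s, BoundedContinuousFunction V (MulForm V i.1.2)) →L[ℂ] ℂ),
      ∀ φ, f φ = F fun i => weightedDeriv i.1.1 i.1.2 φ := by
  obtain ⟨s, C, -, hC⟩ := Seminorm.bound_of_continuous (schwartz_withSeminorms ℂ V ℂ)
    ((normSeminorm ℂ ℂ).comp f.toLinearMap) (continuous_norm.comp f.continuous)
  let J : 𝓢(V, ℂ) →ₗ[ℂ] (∀ i : s, BoundedContinuousFunction V (MulForm V i.1.2)) :=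
    LinearMap.pi fun i => weightedDeriv i.1.1 i.1.2
  refine ⟨s, exists_factor_of_norm_le f.toLinearMap J C fun φ => ?_⟩
  have h1 : ‖f φ‖ ≤ C * (s.sup (schwartzSeminormFamily ℂ V ℂ)) φ := hC φ
  refine h1.trans (mul_le_mul_of_nonneg_left ?_ C.2)
  refine Seminorm.finset_sup_apply_le (norm_nonneg _) fun i hi => ?_
  refine (norm_weightedDeriv i.1 i.2 φ).symm.le.trans ?_
  exact norm_le_pi_norm (J φ) ⟨i, hi⟩

theorem continuous_weightedDeriv (k n : ℕ) :
    Continuous (weightedDeriv k n : 𝓢(V, ℂ) → BoundedContinuousFunction V (MulForm V n)) := by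
  refine WithSeminorms.continuous_normedSpace_rng _ (schwartz_withSeminorms ℂ V ℂ)
    (weightedDeriv k n) ⟨{(k, n)}, 1, fun φ => ?_⟩
  simpa using (norm_weightedDeriv k n φ).le

/-- Continuous functionals commute with integrals of families of Schwartz functions. -/
theorem functional_integral [FiniteDimensional ℝ V] {X : Type*} [TopologicalSpace X]
    [SecondCountableTopology X] [MeasurableSpace X] [OpensMeasurableSpace X]
    {μ : Measure X} {g : X → 𝓢(V, ℂ)} (hg : Continuous g)
    (hb : ∀ k n, ∃ b : X → ℝ, Integrable b μ ∧ ∀ x, SchwartzMap.seminorm ℂ k n (g x) ≤ b x)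
    {h : 𝓢(V, ℂ)} (hh : ∀ v, h v = ∫ x, g x v ∂μ) (f : 𝓢(V, ℂ) →L[ℂ] ℂ) :
    f h = ∫ x, f (g x) ∂μ := by
  -- The functional is transferred to a finite product of Banach spaces of weighted derivatives,
  -- where Bochner integration applies.
  obtain ⟨s, F, hF⟩ := exists_factor_weightedDeriv f
  let J : X → (∀ i : s, BoundedContinuousFunction V (MulForm V i.1.2)) := fun x i =>
    weightedDeriv i.1.1 i.1.2 (g x)
  have hJi : ∀ i : s, Integrable (fun x => J x i) μ := fun i => by
    obtain ⟨b, hbi, hbb⟩ := hb i.1.1 i.1.2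
    -- The target space of bounded continuous functions need not be separable; strong measurability
    -- comes from continuity on the second countable space `X`.
    refine hbi.mono' ((continuous_weightedDeriv _ _).comp hg).aestronglyMeasurable
      (Eventually.of_forall fun x => ?_)
    exact (norm_weightedDeriv _ _ _).le.trans (hbb x)
  have hJint : Integrable J μ := Integrable.of_eval hJi
  have hm : ∀ v, AEStronglyMeasurable (fun x => g x v) μ := fun v => by
    have : Continuous fun φ : 𝓢(V, ℂ) => φ v :=
      (BoundedContinuousFunction.evalCLM ℂ v).continuous.comp
        (SchwartzMap.toBoundedContinuousFunctionCLM ℂ V ℂ).continuous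
    exact (this.comp hg).aestronglyMeasurable
  -- The Bochner integral is identified pointwise, so the derivatives of `h` must be the integrals
  -- of those of `g`.
  have hD : ∀ n v, iteratedFDeriv ℝ n h v = ∫ x, iteratedFDeriv ℝ n (g x) v ∂μ := by
    have e : (h : V → ℂ) = fun v => ∫ x, g x v ∂μ := funext hh
    rw [e]
    refine (contDiff_integral_param (fun x => (g x).smooth ⊤) hm fun n => ?_).2
    obtain ⟨b, hbi, hbb⟩ := hb 0 n
    refine ⟨b, hbi, fun x v => ?_⟩
    refine le_trans ?_ (hbb x)
    simpa using (g x).le_seminorm ℂ 0 n v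
  simp only [hF]
  rw [F.integral_comp_comm hJint]
  congr 1
  funext i
  ext1 v
  have e1 : (∫ x, J x ∂μ) i v = ∫ x, J x i v ∂μ := by
    have h1 := (BoundedContinuousFunction.evalCLM ℂ v).integral_comp_comm (hJi i)
    have h2 := (ContinuousLinearMap.proj (R := ℂ)
      (φ := fun i : s => BoundedContinuousFunction V (MulForm V i.1.2)) i).integral_comp_comm hJint
    exact (congrArg (fun a => a v) h2.symm).trans h1.symm
  rw [e1, weightedDeriv_apply]
  change _ = ∫ x, ((‖v‖ ^ i.1.1 : ℝ) : ℂ) • iterForm i.1.2 (g x) v ∂μ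
  rw [integral_smul]
  exact congrArg (fun a : MulForm V i.1.2 => ((‖v‖ ^ i.1.1 : ℝ) : ℂ) • a) (hD i.1.2 v)

end SchwartzIntegral


/-! ### Functionals applied to one variable of a Schwartz kernel. -/

section SchwartzKernel

open MeasureTheory Filter Topology LineDeriv

variable {V W : Type*} [NormedAddCommGroup V] [NormedSpace ℝ V] [NormedAddCommGroup W]
  [NormedSpace ℝ W]

theorem iteratedFDeriv_slice {F : Type*} [NormedAddCommGroup F] [NormedSpace ℝ F] {K : V × W → F}
    (hK : ContDiff ℝ ∞ K) (x : V) (y : W) (n : ℕ) :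
    iteratedFDeriv ℝ n (fun y => K (x, y)) y =
      (iteratedFDeriv ℝ n K (x, y)).compContinuousLinearMap
        fun _ => ContinuousLinearMap.inr ℝ V W := by
  have e : (fun y => K (x, y)) = (fun w => K (w + (x, 0))) ∘ ContinuousLinearMap.inr ℝ V W := by
    funext y; simp
  have hs : ContDiff ℝ ∞ fun w => K (w + (x, 0)) := hK.comp (contDiff_id.add contDiff_const)
  rw [e, ContinuousLinearMap.iteratedFDeriv_comp_right _ hs _ (natCast_le_infty n),
    iteratedFDeriv_comp_add_right]
  simp

theorem norm_compContinuousLinearMap_inr_le {F : Type*} [NormedAddCommGroup F] [NormedSpace ℝ F]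
    {n : ℕ} (M : (V × W) [×n]→L[ℝ] F) :
    ‖M.compContinuousLinearMap fun _ => ContinuousLinearMap.inr ℝ V W‖ ≤ ‖M‖ := by
  refine (M.norm_compContinuousLinearMap_le _).trans (mul_le_of_le_one_right (norm_nonneg _) ?_)
  exact Finset.prod_le_one (fun _ _ => norm_nonneg _)
    fun _ _ => ContinuousLinearMap.norm_inr_le_one ℝ V W

theorem weighted_slice_le (K : 𝓢(V × W, ℂ)) (x : V) (y : W) (l k n : ℕ) :
    ‖x‖ ^ l * (‖y‖ ^ k * ‖iteratedFDeriv ℝ n (fun y => K (x, y)) y‖) ≤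
      SchwartzMap.seminorm ℂ (l + k) n K := by
  refine le_trans ?_ (K.le_seminorm ℂ (l + k) n (x, y))
  rw [iteratedFDeriv_slice (K.smooth ⊤), ← mul_assoc, pow_add]
  have h1 : ‖x‖ ≤ ‖(x, y)‖ := le_max_left _ _
  have h2 : ‖y‖ ≤ ‖(x, y)‖ := le_max_right _ _
  gcongr
  exact norm_compContinuousLinearMap_inr_le _

/-- The partial function `y ↦ K(x, y)` of a Schwartz function of two variables. -/
def slice (K : 𝓢(V × W, ℂ)) (x : V) : 𝓢(W, ℂ) where
  toFun y := K (x, y)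
  smooth' := (K.smooth ⊤).comp (contDiff_const.prodMk contDiff_id)
  decay' k n := ⟨SchwartzMap.seminorm ℂ (0 + k) n K, fun y => by
    simpa using weighted_slice_le K x y 0 k n⟩

@[simp]
theorem slice_apply (K : 𝓢(V × W, ℂ)) (x : V) (y : W) : slice K x y = K (x, y) := rfl

theorem pow_mul_seminorm_slice_le (K : 𝓢(V × W, ℂ)) (x : V) (l k n : ℕ) :
    ‖x‖ ^ l * SchwartzMap.seminorm ℂ k n (slice K x) ≤ SchwartzMap.seminorm ℂ (l + k) n K := by
  have h := SchwartzMap.seminorm_le_bound ℂ k n (((‖x‖ ^ l : ℝ) : ℂ) • slice K x)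
    (apply_nonneg (SchwartzMap.seminorm ℂ (l + k) n) K) fun y => by
      have e : iteratedFDeriv ℝ n (⇑(((‖x‖ ^ l : ℝ) : ℂ) • slice K x)) y =
          ((‖x‖ ^ l : ℝ) : ℂ) • iteratedFDeriv ℝ n (fun y => K (x, y)) y :=
        iteratedFDeriv_const_smul_apply ((slice K x).contDiffAt n)
      rw [e, norm_smul, Complex.norm_real, norm_pow, norm_norm, mul_left_comm]
      exact weighted_slice_le K x y l k n
  rwa [map_smul_eq_mul, Complex.norm_real, norm_pow, norm_norm] at h

/-- Mean value inequality on the affine subspace where the second variable equals `y`: there the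
weight `|y|^k` is constant and at most `|w|^k`. -/
theorem seminorm_slice_sub_le (K : 𝓢(V × W, ℂ)) (x x' : V) (k n : ℕ) :
    SchwartzMap.seminorm ℂ k n (slice K x' - slice K x) ≤
      SchwartzMap.seminorm ℂ k (n + 1) K * ‖x' - x‖ := by
  refine SchwartzMap.seminorm_le_bound ℂ k n _ (by positivity) fun y => ?_
  have e : iteratedFDeriv ℝ n (⇑(slice K x' - slice K x)) y =
      iteratedFDeriv ℝ n (fun y => K (x', y)) y - iteratedFDeriv ℝ n (fun y => K (x, y)) y :=
    iteratedFDeriv_sub_apply ((slice K x').contDiffAt n) ((slice K x).contDiffAt n)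
  rw [e, iteratedFDeriv_slice (K.smooth ⊤), iteratedFDeriv_slice (K.smooth ⊤)]
  have e2 : (iteratedFDeriv ℝ n K (x', y)).compContinuousLinearMap
        (fun _ => ContinuousLinearMap.inr ℝ V W) -
      (iteratedFDeriv ℝ n K (x, y)).compContinuousLinearMap
        (fun _ => ContinuousLinearMap.inr ℝ V W) =
      (iteratedFDeriv ℝ n K (x', y) - iteratedFDeriv ℝ n K (x, y)).compContinuousLinearMap
        fun _ => ContinuousLinearMap.inr ℝ V W := rfl
  rw [e2]
  have hd : Differentiable ℝ (iteratedFDeriv ℝ n K) :=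
    (K.smooth ⊤).differentiable_iteratedFDeriv (by exact_mod_cast ENat.natCast_lt_top n)
  have hconv : Convex ℝ {w : V × W | w.2 = y} := by
    intro a ha b hb s t _ _ hst
    simp only [Set.mem_ofPred_eq] at ha hb ⊢
    simp [ha, hb, ← add_smul, hst]
  have h := hconv.norm_image_sub_le_of_norm_hasFDerivWithin_le
    (f := fun w => (‖y‖ ^ k) • iteratedFDeriv ℝ n K w)
    (f' := fun w => (‖y‖ ^ k) • fderiv ℝ (iteratedFDeriv ℝ n K) w)
    (C := SchwartzMap.seminorm ℂ k (n + 1) K) (x := (x, y)) (y := (x', y))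
    (fun w _ => ((hd w).hasFDerivAt.fun_const_smul _).hasFDerivWithinAt)
    (fun w hw => by
      rw [norm_smul, norm_fderiv_iteratedFDeriv, norm_pow, norm_norm]
      refine le_trans ?_ (K.le_seminorm ℂ k (n + 1) w)
      have : ‖y‖ ≤ ‖w‖ := by rw [← show w.2 = y from hw]; exact le_max_right _ _
      gcongr) rfl rfl
  rw [← smul_sub, norm_smul, norm_pow, norm_norm] at h
  have hn : ‖(x', y) - (x, y)‖ = ‖x' - x‖ := by simp [Prod.norm_def]
  rw [hn] at h
  refine le_trans ?_ h
  gcongr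
  exact norm_compContinuousLinearMap_inr_le _

theorem continuous_slice (K : 𝓢(V × W, ℂ)) : Continuous (slice K) := by
  refine continuous_iff_continuousAt.2 fun x => ?_
  refine ((schwartz_withSeminorms ℂ W ℂ).tendsto_nhds _ _).2 fun i ε hε => ?_
  have h : Tendsto (fun x' => SchwartzMap.seminorm ℂ i.1 (i.2 + 1) K * ‖x' - x‖) (𝓝 x) (𝓝 0) := by
    have : Continuous fun x' : V => SchwartzMap.seminorm ℂ i.1 (i.2 + 1) K * ‖x' - x‖ := by
      fun_prop
    simpa using this.tendsto x
  filter_upwards [h.eventually (gt_mem_nhds hε)] with x' hx'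
  exact (seminorm_slice_sub_le K x x' i.1 i.2).trans_lt hx'

theorem exists_norm_le_on_bounded (f : 𝓢(W, ℂ) →L[ℂ] ℂ) {B : Set 𝓢(W, ℂ)}
    (hB : Bornology.IsVonNBounded ℂ B) : ∃ M, 0 ≤ M ∧ ∀ g ∈ B, ‖f g‖ ≤ M := by
  obtain ⟨M, hM⟩ := ((NormedSpace.isVonNBounded_iff ℂ).1 (hB.image f)).exists_norm_le
  exact ⟨max M 0, le_max_right _ _, fun g hg => (hM _ ⟨g, hg, rfl⟩).trans (le_max_left _ _)⟩

theorem exists_lipschitz_functional_slice (f : 𝓢(W, ℂ) →L[ℂ] ℂ) (K : 𝓢(V × W, ℂ)) :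
    ∃ C, 0 ≤ C ∧ ∀ x x', ‖f (slice K x') - f (slice K x)‖ ≤ C * ‖x' - x‖ := by
  obtain ⟨s, C, -, hC⟩ := Seminorm.bound_of_continuous (schwartz_withSeminorms ℂ W ℂ)
    ((normSeminorm ℂ ℂ).comp f.toLinearMap) (continuous_norm.comp f.continuous)
  refine ⟨C * ∑ i ∈ s, SchwartzMap.seminorm ℂ i.1 (i.2 + 1) K,
    mul_nonneg C.2 (Finset.sum_nonneg fun _ _ => apply_nonneg _ _), fun x x' => ?_⟩
  rw [← map_sub]
  have h1 : ‖f (slice K x' - slice K x)‖ ≤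
      C * (s.sup (schwartzSeminormFamily ℂ W ℂ)) (slice K x' - slice K x) := hC _
  refine h1.trans ?_
  rw [mul_assoc]
  refine mul_le_mul_of_nonneg_left ?_ C.2
  have h0 : 0 ≤ ∑ i ∈ s, SchwartzMap.seminorm ℂ i.1 (i.2 + 1) K :=
    Finset.sum_nonneg fun _ _ => apply_nonneg _ _
  refine Seminorm.finset_sup_apply_le (by positivity) fun i hi => ?_
  refine (seminorm_slice_sub_le K x x' i.1 i.2).trans ?_
  refine mul_le_mul_of_nonneg_right ?_ (norm_nonneg _)
  exact Finset.single_le_sum (f := fun i : ℕ × ℕ => SchwartzMap.seminorm ℂ i.1 (i.2 + 1) K)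
    (fun _ _ => apply_nonneg _ _) hi

variable [FiniteDimensional ℝ V]

/-- The partial derivative of `K` along the `i`-th basis vector of the first factor. -/
def leftDeriv (K : 𝓢(V × W, ℂ)) (i : Fin (Module.finrank ℝ V)) : 𝓢(V × W, ℂ) :=
  ∂_{(Module.finBasis ℝ V i, (0 : W))} K

theorem leftDeriv_apply (K : 𝓢(V × W, ℂ)) (i : Fin (Module.finrank ℝ V)) (w : V × W) :
    leftDeriv K i w = fderiv ℝ K w (Module.finBasis ℝ V i, 0) :=
  SchwartzMap.lineDerivOp_apply_eq_fderiv _ _ _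

theorem fderiv_left_eq_sum (K : 𝓢(V × W, ℂ)) (w : V × W) (h : V) :
    fderiv ℝ K w (h, 0) = ∑ i, ((Module.finBasis ℝ V).repr h i : ℂ) * leftDeriv K i w := by
  have e : ((h, 0) : V × W) = ∑ i, (Module.finBasis ℝ V).repr h i • (Module.finBasis ℝ V i, (0 : W)) := by
    have := (Module.finBasis ℝ V).sum_repr h
    refine Prod.ext ?_ ?_
    · simp [Prod.fst_sum, this]
    · simp [Prod.snd_sum]
  conv_lhs => rw [e]
  rw [map_sum]
  refine Finset.sum_congr rfl fun i _ => ?_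
  rw [map_smul, leftDeriv_apply, Complex.real_smul]

variable [FiniteDimensional ℝ W]

/-- The fundamental theorem of calculus for `t ↦ K(x + th, ·)`, with the functional passed under the
integral by `functional_integral`. -/
theorem functional_slice_sub (f : 𝓢(W, ℂ) →L[ℂ] ℂ) (K : 𝓢(V × W, ℂ)) (x h : V) :
    f (slice K (x + h)) - f (slice K x) = ∫ t in Set.Ioc (0 : ℝ) 1,
      ∑ i, ((Module.finBasis ℝ V).repr h i : ℂ) * f (slice (leftDeriv K i) (x + t • h)) := by
  rw [← map_sub]
  have hc : ∀ i, Continuous fun t : ℝ => slice (leftDeriv K i) (x + t • h) := fun i =>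
    (continuous_slice _).comp (by fun_prop)
  have hc' : ∀ i, Continuous fun t : ℝ =>
      ((Module.finBasis ℝ V).repr h i : ℂ) • slice (leftDeriv K i) (x + t • h) := fun i =>
    (continuous_const_smul ((Module.finBasis ℝ V).repr h i : ℂ)).comp (hc i)
  rw [functional_integral (μ := volume.restrict (Set.Ioc (0 : ℝ) 1)) (g := fun t : ℝ =>
    ∑ i, ((Module.finBasis ℝ V).repr h i : ℂ) • slice (leftDeriv K i) (x + t • h))
    (continuous_finsetSum _ fun i _ => hc' i) (fun k n => ?_) (fun v => ?_) f]
  · simp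
  · refine ⟨fun _ => ∑ i, ‖((Module.finBasis ℝ V).repr h i : ℂ)‖ *
      SchwartzMap.seminorm ℂ k n (leftDeriv K i), integrable_const _, fun t => ?_⟩
    refine (Finset.le_sum_of_subadditive (SchwartzMap.seminorm ℂ k n)
      (map_zero _).le (map_add_le_add _) _ _).trans ?_
    refine Finset.sum_le_sum fun i _ => ?_
    rw [map_smul_eq_mul]
    gcongr
    simpa using pow_mul_seminorm_slice_le (leftDeriv K i) (x + t • h) 0 k n
  · have hder : ∀ t : ℝ, HasDerivAt (fun t : ℝ => K (x + t • h, v))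
        (fderiv ℝ K (x + t • h, v) (h, 0)) t := fun t => by
      have h1 : HasDerivAt (fun t : ℝ => (x + t • h, v)) (h, (0 : W)) t := by
        have h2 : HasDerivAt (fun t : ℝ => x + t • h) h t := by
          simpa using ((hasDerivAt_id t).smul_const h).const_add x
        exact h2.prodMk (hasDerivAt_const t v)
      exact (K.differentiableAt.hasFDerivAt).comp_hasDerivAt t h1
    have hcont : Continuous fun t : ℝ => fderiv ℝ K (x + t • h, v) (h, 0) :=
      (((K.smooth 1).continuous_fderiv (by simp)).comp (by fun_prop)).clm_apply continuous_const
    have := intervalIntegral.integral_eq_sub_of_hasDerivAt (a := 0) (b := 1)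
      (fun t _ => hder t) (hcont.intervalIntegrable _ _)
    rw [intervalIntegral.integral_of_le zero_le_one] at this
    simp only [one_smul, zero_smul, add_zero] at this
    rw [sub_apply, slice_apply, slice_apply, ← this]
    refine integral_congr_ae (Eventually.of_forall fun t => ?_)
    simp only [fderiv_left_eq_sum]
    simp

/-- The remainder is the integral over `t` of differences of slices of the partial derivatives;
these are Lipschitz under the functional, so it is `O(|h|²)`. -/
theorem hasFDerivAt_functional_slice (f : 𝓢(W, ℂ) →L[ℂ] ℂ) (K : 𝓢(V × W, ℂ)) (x : V) :
    HasFDerivAt (fun x => f (slice K x)) (∑ i,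
      (LinearMap.toContinuousLinearMap ((Module.finBasis ℝ V).coord i)).smulRight
        (f (slice (leftDeriv K i) x))) x := by
  rw [hasFDerivAt_iff_isLittleO_nhds_zero]
  choose C hC hL using fun i => exists_lipschitz_functional_slice f (leftDeriv K i)
  let c := fun i => LinearMap.toContinuousLinearMap ((Module.finBasis ℝ V).coord i)
  refine Asymptotics.IsBigO.trans_isLittleO (g := fun h : V => ‖h‖ ^ 2) ?_
    (Asymptotics.isLittleO_norm_pow_id one_lt_two)
  refine Asymptotics.IsBigO.of_bound (∑ i, ‖c i‖ * C i) (Eventually.of_forall fun h => ?_)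
  have hconst : (∑ i, (c i).smulRight (f (slice (leftDeriv K i) x))) h =
      ∫ t in Set.Ioc (0 : ℝ) 1, ∑ i, ((Module.finBasis ℝ V).repr h i : ℂ) *
        f (slice (leftDeriv K i) x) := by
    simp [c]
  have hInt : ∀ i, Continuous fun t : ℝ => f (slice (leftDeriv K i) (x + t • h)) := fun i =>
    f.continuous.comp ((continuous_slice _).comp (by fun_prop))
  rw [functional_slice_sub, hconst, ← integral_sub]
  rotate_left
  · exact ((continuous_finsetSum _ fun i _ => (hInt i).const_mul _).integrableOn_Icc
      (a := 0) (b := 1)).mono_set Set.Ioc_subset_Icc_self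
  · exact integrable_const _
  have hbound : ∀ t ∈ Set.Ioc (0 : ℝ) 1,
      ‖∑ i, ((Module.finBasis ℝ V).repr h i : ℂ) * f (slice (leftDeriv K i) (x + t • h)) -
        ∑ i, ((Module.finBasis ℝ V).repr h i : ℂ) * f (slice (leftDeriv K i) x)‖ ≤
      (∑ i, ‖c i‖ * C i) * ‖h‖ ^ 2 := fun t ht => by
    rw [← Finset.sum_sub_distrib, Finset.sum_mul]
    refine norm_sum_le_of_le _ fun i _ => ?_
    rw [← mul_sub, norm_mul, Complex.norm_real]
    have h1 : ‖(Module.finBasis ℝ V).repr h i‖ ≤ ‖c i‖ * ‖h‖ := (c i).le_opNorm h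
    have h2 : ‖f (slice (leftDeriv K i) (x + t • h)) - f (slice (leftDeriv K i) x)‖ ≤
        C i * ‖h‖ := by
      refine (hL i x (x + t • h)).trans (mul_le_mul_of_nonneg_left ?_ (hC i))
      rw [add_sub_cancel_left, norm_smul, Real.norm_of_nonneg ht.1.le]
      exact mul_le_of_le_one_left (norm_nonneg _) ht.2
    calc _ ≤ (‖c i‖ * ‖h‖) * (C i * ‖h‖) := mul_le_mul h1 h2 (norm_nonneg _) (by positivity)
      _ = _ := by ring
  refine (norm_setIntegral_le_of_norm_le_const (by simp) hbound).trans ?_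
  simp

/-- The derivative is a finite combination of functions of the same form with kernels `leftDeriv K
i`, so induction on the order, for all kernels at once, applies. -/
theorem contDiff_functional_slice (f : 𝓢(W, ℂ) →L[ℂ] ℂ) (K : 𝓢(V × W, ℂ)) :
    ContDiff ℝ ∞ fun x => f (slice K x) := by
  refine contDiff_infty.2 fun n => ?_
  induction n generalizing K with
  | zero => exact contDiff_zero.2 (f.continuous.comp (continuous_slice K))
  | succ n ih =>
    refine contDiff_succ_iff_hasFDerivAt.2 ⟨_, ?_, hasFDerivAt_functional_slice f K⟩
    exact ContDiff.sum fun i _ => contDiff_const.smulRight (ih (leftDeriv K i))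

/-- The functionals bounded on a set, together with a bound. -/
abbrev BoundedOn (B : Set 𝓢(W, ℂ)) : Type _ :=
  {p : (𝓢(W, ℂ) →L[ℂ] ℂ) × ℝ // ∀ g ∈ B, ‖p.1 g‖ ≤ p.2}

theorem exists_derivBound_functional_slice_zero (K : 𝓢(V × W, ℂ)) (k : ℕ) :
    ∃ B : Set 𝓢(W, ℂ), Bornology.IsVonNBounded ℂ B ∧
      DerivBound 0 (fun (p : BoundedOn B) x => p.1.1 (slice K x)) (fun p x => p.1.2 * dec k x) := by
  -- The weighted slices form a bounded set, and the supremum of `|f|` on it is exactly the weighted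
  -- supremum of `f(K(x, ·))`. Thus weighted sup norms become seminorms of the strong dual.
  refine ⟨Set.range fun x => (((1 + ‖x‖) ^ k : ℝ) : ℂ) • slice K x, ?_, ?_⟩
  · refine (schwartz_withSeminorms ℂ W ℂ).isVonNBounded_iff_seminorm_bddAbove.2 fun i => ?_
    refine ⟨2 ^ (k - 1) * (SchwartzMap.seminorm ℂ (0 + i.1) i.2 K +
      SchwartzMap.seminorm ℂ (k + i.1) i.2 K), ?_⟩
    rintro _ ⟨_, ⟨x, rfl⟩, rfl⟩
    change SchwartzMap.seminorm ℂ i.1 i.2 _ ≤ _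
    rw [map_smul_eq_mul, Complex.norm_real, Real.norm_of_nonneg (by positivity)]
    have h1 := add_pow_le zero_le_one (norm_nonneg x) k
    have h2 := pow_mul_seminorm_slice_le K x 0 i.1 i.2
    have h3 := pow_mul_seminorm_slice_le K x k i.1 i.2
    rw [pow_zero, one_mul] at h2
    calc (1 + ‖x‖) ^ k * SchwartzMap.seminorm ℂ i.1 i.2 (slice K x)
        ≤ 2 ^ (k - 1) * (1 ^ k + ‖x‖ ^ k) * SchwartzMap.seminorm ℂ i.1 i.2 (slice K x) := by gcongr
      _ = 2 ^ (k - 1) * (SchwartzMap.seminorm ℂ i.1 i.2 (slice K x) +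
          ‖x‖ ^ k * SchwartzMap.seminorm ℂ i.1 i.2 (slice K x)) := by ring
      _ ≤ _ := by gcongr
  · refine DerivBound.zero_iff.2 ⟨fun p => contDiff_functional_slice _ K, 1, zero_le_one,
      fun p x => ?_⟩
    have h := p.2 _ ⟨x, rfl⟩
    simp only [map_smul, smul_eq_mul, norm_mul, Complex.norm_real] at h
    rw [Real.norm_of_nonneg (by positivity)] at h
    calc ‖p.1.1 (slice K x)‖ = ((1 + ‖x‖) ^ k * dec k x) * ‖p.1.1 (slice K x)‖ := by
          rw [pow_mul_dec, one_mul]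
      _ = ((1 + ‖x‖) ^ k * ‖p.1.1 (slice K x)‖) * dec k x := by ring
      _ ≤ p.1.2 * dec k x := mul_le_mul_of_nonneg_right h (dec_pos k x).le
      _ = _ := by ring

/-- Each partial derivative of the kernel brings its own bounded set; their finite union serves the
next order. -/
theorem exists_derivBound_functional_slice (N : ℕ) (K : 𝓢(V × W, ℂ)) (k : ℕ) :
    ∃ B : Set 𝓢(W, ℂ), Bornology.IsVonNBounded ℂ B ∧
      DerivBound N (fun (p : BoundedOn B) x => p.1.1 (slice K x)) (fun p x => p.1.2 * dec k x) := by
  induction N generalizing K with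
  | zero => exact exists_derivBound_functional_slice_zero K k
  | succ N ih =>
    obtain ⟨B₀, hB₀, h₀⟩ := exists_derivBound_functional_slice_zero K k
    choose B hB h using fun i => ih (leftDeriv K i)
    refine ⟨B₀ ∪ ⋃ i, B i, hB₀.union (Bornology.isVonNBounded_iUnion.2 hB), ?_⟩
    refine DerivBound.fderiv_iff.2 ⟨?_, ?_⟩
    · exact h₀.reindex fun p : BoundedOn (B₀ ∪ ⋃ i, B i) => ⟨p.1, fun g hg => p.2 g (Or.inl hg)⟩
    · have e : (fun (p : BoundedOn (B₀ ∪ ⋃ i, B i)) x => fderiv ℝ (fun x => p.1.1 (slice K x)) x) =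
          fun p x => ∑ i, ContinuousLinearMap.smulRightL ℝ V ℂ
            (LinearMap.toContinuousLinearMap ((Module.finBasis ℝ V).coord i))
              (p.1.1 (slice (leftDeriv K i) x)) := by
        funext p x
        exact (hasFDerivAt_functional_slice p.1.1 K x).fderiv
      rw [e]
      refine DerivBound.sum _ fun i _ => DerivBound.clm ?_ _
      exact (h i).reindex fun p : BoundedOn (B₀ ∪ ⋃ i, B i) =>
        ⟨p.1, fun g hg => p.2 g (Or.inr (Set.mem_iUnion.2 ⟨i, hg⟩))⟩

theorem exists_seminorm_bound_functional_slice (K : 𝓢(V × W, ℂ)) (k n : ℕ) :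
    ∃ B : Set 𝓢(W, ℂ), Bornology.IsVonNBounded ℂ B ∧ ∃ C, 0 ≤ C ∧
      ∀ (f : 𝓢(W, ℂ) →L[ℂ] ℂ) (M : ℝ), 0 ≤ M → (∀ g ∈ B, ‖f g‖ ≤ M) →
        ∀ x, ‖x‖ ^ k * ‖iteratedFDeriv ℝ n (fun x => f (slice K x)) x‖ ≤ C * M := by
  obtain ⟨B, hB, -, C, hC, hb⟩ := exists_derivBound_functional_slice n K k
  refine ⟨B, hB, C, hC, fun f M hM hf x => ?_⟩
  have h := hb ⟨(f, M), hf⟩ x n le_rfl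
  have h1 : ‖x‖ ^ k ≤ (1 + ‖x‖) ^ k := by gcongr; linarith
  calc ‖x‖ ^ k * ‖iteratedFDeriv ℝ n (fun x => f (slice K x)) x‖
      ≤ (1 + ‖x‖) ^ k * (C * (M * dec k x)) := mul_le_mul h1 h (norm_nonneg _) (by positivity)
    _ = C * M * ((1 + ‖x‖) ^ k * dec k x) := by ring
    _ = C * M := by rw [pow_mul_dec, mul_one]

/-- A functional applied to a Schwartz kernel in one variable is a Schwartz function of the other. -/
def functionalSlice (K : 𝓢(V × W, ℂ)) (f : 𝓢(W, ℂ) →L[ℂ] ℂ) : 𝓢(V, ℂ) where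
  toFun x := f (slice K x)
  smooth' := contDiff_functional_slice f K
  decay' k n := by
    obtain ⟨B, hB, C, hC, hb⟩ := exists_seminorm_bound_functional_slice K k n
    obtain ⟨M, hM, hf⟩ := exists_norm_le_on_bounded f hB
    exact ⟨C * M, hb f M hM hf⟩

/-- The map `f ↦ f(K(x, ·))` from the strong dual of the Schwartz space to the Schwartz space. -/
def kernelMap (K : 𝓢(V × W, ℂ)) : (𝓢(W, ℂ) →L[ℂ] ℂ) →L[ℂ] 𝓢(V, ℂ) where
  toFun := functionalSlice K
  map_add' _ _ := rfl
  map_smul' _ _ := rfl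
  cont := by
    let R : (𝓢(W, ℂ) →L[ℂ] ℂ) →ₗ[ℂ] 𝓢(V, ℂ) :=
      { toFun := functionalSlice K, map_add' := fun _ _ => rfl, map_smul' := fun _ _ => rfl }
    refine WithSeminorms.continuous_of_continuous_comp (schwartz_withSeminorms ℂ V ℂ) R fun i => ?_
    obtain ⟨B, hB, C, hC, hb⟩ := exists_seminorm_bound_functional_slice K i.1 i.2
    refine Seminorm.continuous' (r := C) ?_
    -- Functionals bounded by `1` on `B` form a neighbourhood of zero in the strong topology, and on
    -- it the seminorm is at most `C`.
    refine mem_of_superset (ContinuousLinearMap.hasBasis_nhds_zero.mem_of_mem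
      (i := (B, Metric.closedBall (0 : ℂ) 1)) ⟨hB, Metric.closedBall_mem_nhds _ one_pos⟩) ?_
    intro f hf
    rw [Seminorm.mem_closedBall_zero]
    refine SchwartzMap.seminorm_le_bound ℂ i.1 i.2 _ hC fun x => ?_
    have := hb f 1 zero_le_one (fun g hg => by simpa using hf g hg) x
    rwa [mul_one] at this

theorem kernelMap_apply (K : 𝓢(V × W, ℂ)) (f : 𝓢(W, ℂ) →L[ℂ] ℂ) (x : V) :
    kernelMap K f x = f (slice K x) := rfl

theorem functional_kernel_integral [MeasurableSpace V] [BorelSpace V] (μ : Measure V)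
    [μ.HasTemperateGrowth] (K : 𝓢(V × W, ℂ)) (f : 𝓢(W, ℂ) →L[ℂ] ℂ) (ψ : 𝓢(V, ℂ)) {h : 𝓢(W, ℂ)}
    (hh : ∀ y, h y = ∫ x, ψ x * K (x, y) ∂μ) :
    f h = ∫ x, ψ x * kernelMap K f x ∂μ := by
  rw [functional_integral (g := fun x => ψ x • slice K x) (μ := μ)
    (ψ.continuous.smul (continuous_slice K)) (fun k n => ?_) (fun v => ?_) f]
  · simp [kernelMap_apply]
  · refine ⟨fun x => ‖ψ x‖ * SchwartzMap.seminorm ℂ k n K, (ψ.integrable).norm.mul_const _,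
      fun x => ?_⟩
    rw [map_smul_eq_mul]
    refine mul_le_mul_of_nonneg_left ?_ (norm_nonneg _)
    simpa using pow_mul_seminorm_slice_le K x 0 k n
  · simp [hh]

end SchwartzKernel


/-! ### Rapidly decaying symbols give Schwartz kernels. -/

section SmoothingKernel

open MeasureTheory Filter

variable {d : ℕ}

/-- Smooth functions of `(x, y, z)` whose derivatives have polynomial growth in `(x, y)` and rapid
decay in `z`. -/
def RapidDecay (m : ℕ) (u : E4 d → ℂ) : Prop :=
  ∀ N r : ℕ, DerivBound N (fun _ : Unit => u)
    (fun _ w => (1 + ‖w.1‖) ^ m * (1 + ‖w.2.1‖) ^ m * dec r w.2.2)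

theorem RapidDecay.contDiff {m : ℕ} {u : E4 d → ℂ} (hu : RapidDecay m u) :
    ContDiff ℝ ∞ u := (hu 0 0).1 ()

theorem dec_fst_mul_dec_snd_le_dec (k : ℕ) (v : E d × E d) : dec k v.1 * dec k v.2 ≤ dec k v := by
  unfold dec
  rw [← mul_inv, ← mul_pow]
  refine inv_anti₀ (by positivity) (pow_le_pow_left₀ (by positivity) ?_ k)
  have h1 := norm_nonneg v.1
  have h2 := norm_nonneg v.2
  have h : ‖v‖ ≤ ‖v.1‖ + ‖v.2‖ := by
    rw [Prod.norm_def]; exact max_le (by linarith) (by linarith)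
  nlinarith [mul_nonneg h1 h2]

namespace WaveData

variable (D : WaveData d)

/-- Each of the two packets loses `N + m + k` powers of `z`, and `u` is taken with decay of order
twice that plus `s`. No integration by parts is needed; the bound for the `y`-packet is that of the
swapped data. -/
theorem derivBound_kern {m : ℕ} {u : E4 d → ℂ} (hu : RapidDecay m u) (N k s : ℕ) :
    DerivBound N (fun (p : Unit × (E d × E d)) (v : E d × E d) => D.kern u v.1 v.2 p.2)
      (fun p v => dec k v * dec s p.2) := by
  have hc : DerivBound N (fun (p : Unit × (E d × E d)) (_ : E d × E d) => D.c p.2)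
      (fun _ _ => 1) := DerivBound.const _ _ fun p => D.c_le p.2
  have h1 := (D.derivBound_packet_a (fun p : Unit × (E d × E d) => p.2) N (m + k)).comp_affine
    (ContinuousLinearMap.fst ℝ (E d) (E d)) (fun _ => 0)
  have h2 := (D.swap.derivBound_packet_a (fun p : Unit × (E d × E d) => p.2) N
    (m + k)).comp_affine (ContinuousLinearMap.snd ℝ (E d) (E d)) (fun _ => 0)
  have h3 := ((hu N (2 * (N + (m + k)) + s)).reindex
    (fun _ : Unit × (E d × E d) => ())).comp_affine
    ((ContinuousLinearMap.fst ℝ (E d) (E d)).prod ((ContinuousLinearMap.snd ℝ (E d) (E d)).prod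
        (0 : E d × E d →L[ℝ] E d × E d))) (fun p => (0, 0, p.2))
  have h := ((hc.mul h1).mul h2).mul h3
  simp only [ContinuousLinearMap.prod_apply, Prod.mk_add_mk, zero_apply,
    zero_add, add_zero, ContinuousLinearMap.coe_fst', ContinuousLinearMap.coe_snd'] at h
  refine h.mono 1 zero_le_one fun p v => ?_
  have e : ∀ y : E d, (1 + ‖y‖) ^ m * dec (m + k) y = dec k y := fun y => by
    rw [dec_add, ← mul_assoc, pow_mul_dec, one_mul]
  have ez : (1 + ‖p.2‖) ^ (N + (m + k)) * (1 + ‖p.2‖) ^ (N + (m + k)) *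
      dec (2 * (N + (m + k)) + s) p.2 = dec s p.2 := by
    rw [dec_add, ← pow_add, ← two_mul, ← mul_assoc, pow_mul_dec, one_mul]
  calc _ = ((1 + ‖p.2‖) ^ (N + (m + k)) * (1 + ‖p.2‖) ^ (N + (m + k)) *
      dec (2 * (N + (m + k)) + s) p.2) * ((1 + ‖v.1‖) ^ m * dec (m + k) v.1) *
        ((1 + ‖v.2‖) ^ m * dec (m + k) v.2) := by ring
    _ = (dec k v.1 * dec k v.2) * dec s p.2 := by rw [e, e, ez]; ring
    _ ≤ dec k v * dec s p.2 :=
      mul_le_mul_of_nonneg_right (dec_fst_mul_dec_snd_le_dec k v) (dec_pos _ _).le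
    _ = _ := (one_mul _).symm

theorem derivBound_integral_kern {m : ℕ} {u : E4 d → ℂ} (hu : RapidDecay m u) (N k : ℕ) :
    DerivBound N (fun (_ : Unit) (v : E d × E d) => ∫ z, D.kern u v.1 v.2 z)
      (fun _ v => dec k v) := by
  have hall : ∀ n, DerivBound n
      (fun (p : Unit × (E d × E d)) (v : E d × E d) => D.kern u v.1 v.2 p.2)
      (fun p _ => 1 * dec (2 * d + 1) p.2) := fun n => by
    simpa [dec] using D.derivBound_kern hu n 0 (2 * d + 1)
  have hm : ∀ (_ : Unit) (v : E d × E d),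
      AEStronglyMeasurable (fun z => D.kern u v.1 v.2 z) volume := fun _ v =>
    ((D.continuous_kern hu.contDiff.continuous).comp
      (by fun_prop : Continuous fun z : E d × E d => (v.1, v.2, z))).aestronglyMeasurable
  exact DerivBound.integral (ι := Unit) (Y := E d × E d) (V := E d × E d) (F := ℂ) (μ := volume)
    (f := fun _ z v => D.kern u v.1 v.2 z) (w := fun _ v => dec k v) (w' := fun _ _ => 1)
    (g := dec (2 * d + 1)) (fun _ v => (dec_pos k v).le) (D.derivBound_kern hu N k (2 * d + 1))
    hall hm integrable_dec_prod

/-- The integral kernel of the operator with rapidly decaying amplitude `u`. -/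
def kernel {m : ℕ} {u : E4 d → ℂ} (hu : RapidDecay m u) : 𝓢(E d × E d, ℂ) where
  toFun v := ∫ z, D.kern u v.1 v.2 z
  smooth' := (D.derivBound_integral_kern hu 0 0).1 ()
  decay' k n := by
    obtain ⟨-, C, hC, hb⟩ := D.derivBound_integral_kern hu n k
    refine ⟨C, fun v => ?_⟩
    have h := hb () v n le_rfl
    have h1 : ‖v‖ ^ k ≤ (1 + ‖v‖) ^ k := by gcongr; linarith
    calc _ ≤ (1 + ‖v‖) ^ k * (C * dec k v) := mul_le_mul h1 h (norm_nonneg _) (by positivity)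
      _ = C * ((1 + ‖v‖) ^ k * dec k v) := by ring
      _ = C := by rw [pow_mul_dec, mul_one]

theorem kernel_apply {m : ℕ} {u : E4 d → ℂ} (hu : RapidDecay m u) (x y : E d) :
    D.kernel hu (x, y) = ∫ z, D.kern u x y z := rfl

/-- With rapid decay in `z` the integral over `(z, x)` converges absolutely, so the `z`-integration
can be done first. -/
theorem swap_op_eq_integral_kernel {m : ℕ} {u : E4 d → ℂ} (hu : RapidDecay m u) (ψ : 𝓢(E d, ℂ))
    (y : E d) : D.swap.op (swapVar u) ψ y = ∫ x, ψ x * D.kernel hu (x, y) := by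
  unfold op inner
  simp only [kern_swap, kernel_apply, ← integral_const_mul]
  obtain ⟨-, C, hC, hb⟩ := D.derivBound_kern hu 0 0 (2 * d + 1)
  have hInt : Integrable (fun p : (E d × E d) × E d => D.kern u p.2 y p.1 * ψ p.2)
      (volume.prod volume) := by
    refine (((integrable_dec_prod (d := d)).const_mul C).mul_prod
      (ψ.integrable (μ := volume)).norm).mono' ?_ (Eventually.of_forall fun p => ?_)
    · exact (((D.continuous_kern hu.contDiff.continuous).comp
        (by fun_prop : Continuous fun p : (E d × E d) × E d => (p.2, y, p.1))).mul
          (ψ.continuous.comp continuous_snd)).aestronglyMeasurable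
    · rw [norm_mul]
      have h := hb ((), p.1) (p.2, y) 0 le_rfl
      rw [norm_iteratedFDeriv_zero] at h
      gcongr
      simpa [dec] using h
  rw [integral_integral_swap hInt]
  simp only [mul_comm]

/-- The transposed operator, paired with a functional. -/
theorem functional_swap_opCLM {m : ℕ} {u : E4 d → ℂ} (hu : RapidDecay m u)
    (hu' : ∃ m, PolyGrowth m (swapVar u)) (f : 𝓢(E d, ℂ) →L[ℂ] ℂ) (ψ : 𝓢(E d, ℂ)) :
    f (D.swap.opCLM (swapVar u) hu' ψ) = ∫ x, ψ x * kernelMap (D.kernel hu) f x :=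
  functional_kernel_integral volume (D.kernel hu) f ψ fun y => by
    rw [opCLM_apply, swap_op_eq_integral_kernel]

end WaveData

end SmoothingKernel


/-! ### Symbol classes compared with polynomial weights. -/

section Bounds

open MeasureTheory Filter

variable {d : ℕ}

theorem sqrt_one_add_sq_le {t : ℝ} (ht : 0 ≤ t) : Real.sqrt (1 + t ^ 2) ≤ 1 + t :=
  Real.sqrt_le_iff.2 ⟨by positivity, by nlinarith⟩

theorem one_le_sqrt_one_add {t : ℝ} (ht : 0 ≤ t) : 1 ≤ Real.sqrt (1 + t) :=
  Real.one_le_sqrt.2 (by linarith)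

theorem rpow_le_pow_of_le {s B m : ℝ} {M : ℕ} (hs : 1 ≤ s) (hB : s ≤ B) (hm : m ≤ M) :
    s ^ m ≤ B ^ M := by
  calc s ^ m ≤ s ^ (M : ℝ) := Real.rpow_le_rpow_of_exponent_le hs hm
    _ = s ^ M := Real.rpow_natCast s M
    _ ≤ B ^ M := pow_le_pow_left₀ (by linarith) hB M

theorem symbolWeight_mul_prod {V ι : Type*} [Fintype ι] {n : ι → V → ℝ} {m : ι → ℝ}
    (hn : ∀ j z, 0 ≤ n j z) (z : V) :
    symbolWeight n m z * ∏ j, Real.sqrt (1 + n j z) ^ m j = 1 := by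
  unfold symbolWeight
  rw [← Finset.prod_mul_distrib]
  refine Finset.prod_eq_one fun j _ => ?_
  have := one_le_sqrt_one_add (hn j z)
  rw [← Real.rpow_add (by linarith), neg_add_cancel, Real.rpow_zero]

section General

variable {V F ι : Type*} [NormedAddCommGroup V] [NormedSpace ℝ V]
  [NormedAddCommGroup F] [NormedSpace ℝ F] [Fintype ι] {n : ι → V → ℝ} {m : ι → ℝ}

theorem IsSymbol.derivBound {u : V → F} (hu : IsSymbol n m u) (hn : ∀ j z, 0 ≤ n j z) {W : V → ℝ}
    {C : ℝ} (hC : 0 ≤ C) (hW : ∀ z, ∏ j, Real.sqrt (1 + n j z) ^ m j ≤ C * W z) (N : ℕ) :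
    DerivBound N (fun _ : Unit => u) (fun _ => W) := by
  have h0 : ∀ z, 0 ≤ ∏ j, Real.sqrt (1 + n j z) ^ m j := fun z =>
    Finset.prod_nonneg fun j _ => Real.rpow_nonneg (Real.sqrt_nonneg _) _
  refine DerivBound.mono (W := fun _ z => ∏ j, Real.sqrt (1 + n j z) ^ m j) ?_ C hC
    fun _ z => hW z
  refine DerivBound.of_forall (fun _ => hu.1) (fun _ z => h0 z) (fun k => ?_) N
  obtain ⟨A, hA⟩ := hu.2 k
  refine ⟨A, fun _ z => ?_⟩
  calc ‖iteratedFDeriv ℝ k u z‖ = (symbolWeight n m z * ∏ j, Real.sqrt (1 + n j z) ^ m j) *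
        ‖iteratedFDeriv ℝ k u z‖ := by rw [symbolWeight_mul_prod hn, one_mul]
    _ = (symbolWeight n m z * ‖iteratedFDeriv ℝ k u z‖) *
        ∏ j, Real.sqrt (1 + n j z) ^ m j := by ring
    _ ≤ _ := mul_le_mul_of_nonneg_right (hA ⟨z, rfl⟩) (h0 z)

theorem IsSymbol.mono {ι' : Type*} [Fintype ι'] {n' : ι' → V → ℝ} {m' : ι' → ℝ} {u : V → F}
    (hu : IsSymbol n m u) (hn : ∀ j z, 0 ≤ n j z) (hn' : ∀ j z, 0 ≤ n' j z)
    (hW : ∀ z, ∏ j, Real.sqrt (1 + n j z) ^ m j ≤ ∏ j, Real.sqrt (1 + n' j z) ^ m' j) :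
    IsSymbol n' m' u := by
  refine ⟨hu.1, fun k => ?_⟩
  obtain ⟨-, C, hC, hb⟩ := hu.derivBound (W := fun z => ∏ j, Real.sqrt (1 + n' j z) ^ m' j) hn
    zero_le_one (fun z => (hW z).trans (one_mul _).ge) k
  refine ⟨C, ?_⟩
  rintro _ ⟨z, rfl⟩
  calc _ ≤ symbolWeight n' m' z * (C * ∏ j, Real.sqrt (1 + n' j z) ^ m' j) :=
        mul_le_mul_of_nonneg_left (hb () z k le_rfl) (symbolWeight_nonneg _ _ _)
    _ = C * (symbolWeight n' m' z * ∏ j, Real.sqrt (1 + n' j z) ^ m' j) := by ring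
    _ = C := by rw [symbolWeight_mul_prod hn', mul_one]

theorem polyGrowth_of_derivBound {M : ℕ} {u : V → F}
    (h : ∀ N, DerivBound N (fun _ : Unit => u) (fun _ w => (1 + ‖w‖) ^ M)) : PolyGrowth M u := by
  refine ⟨(h 0).1 (), fun n => ?_⟩
  obtain ⟨-, C, -, hb⟩ := h n
  exact ⟨C, fun w => hb () w n le_rfl⟩

end General

theorem blocks4d_nonneg (j : Fin 1) (z : E4 d) : 0 ≤ blocks4d d j z := by
  fin_cases j; simp [blocks4d]; positivity

theorem blocks3d1d_nonneg (j : Fin 2) (z : E4 d) : 0 ≤ blocks3d1d d j z := by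
  fin_cases j <;> simp [blocks3d1d]; positivity

theorem blocks2d2d_nonneg (j : Fin 2) (z : E4 d) : 0 ≤ blocks2d2d d j z := by
  fin_cases j <;> simp [blocks2d2d] <;> positivity

theorem blocksDDDD_nonneg (j : Fin 4) (z : E4 d) : 0 ≤ blocksDDDD d j z := by
  fin_cases j <;> simp [blocksDDDD]

theorem norm_le_of_mem (w : E4 d) : ‖w.1‖ ≤ ‖w‖ ∧ ‖w.2.1‖ ≤ ‖w‖ ∧ ‖w.2.2.1‖ ≤ ‖w‖ ∧
    ‖w.2.2.2‖ ≤ ‖w‖ := by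
  simp only [Prod.norm_def]
  refine ⟨le_max_left _ _, ?_, ?_, ?_⟩ <;> simp

theorem IsSymbolTop.polyGrowth {u : E4 d → ℂ} (hu : IsSymbolTop u) : ∃ M, PolyGrowth M u := by
  obtain ⟨m, hu⟩ := hu
  obtain ⟨M, hM⟩ := exists_nat_ge m
  refine ⟨M, polyGrowth_of_derivBound fun N => hu.derivBound blocks4d_nonneg
    (C := 2 ^ M) (by positivity) (fun w => ?_) N⟩
  rw [← mul_pow]
  simp only [Fin.prod_univ_one]
  have h0 := blocks4d_nonneg 0 w
  refine rpow_le_pow_of_le (one_le_sqrt_one_add h0) (Real.sqrt_le_iff.2 ⟨by positivity, ?_⟩) hM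
  obtain ⟨h1, h2, h3, h4⟩ := norm_le_of_mem w
  simp only [blocks4d, Matrix.cons_val_zero]
  have e1 := pow_le_pow_left₀ (norm_nonneg _) h1 2
  have e2 := pow_le_pow_left₀ (norm_nonneg _) h2 2
  have e3 := pow_le_pow_left₀ (norm_nonneg _) h3 2
  have e4 := pow_le_pow_left₀ (norm_nonneg _) h4 2
  nlinarith [norm_nonneg w]

theorem rpow_le_rpow_of_le {s B m M : ℝ} (hs : 1 ≤ s) (hB : s ≤ B) (hm : m ≤ M) (hM : 0 ≤ M) :
    s ^ m ≤ B ^ M :=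
  (Real.rpow_le_rpow_of_exponent_le hs hm).trans (Real.rpow_le_rpow (by linarith) hB hM)

/-- The square bracket of a sum of blocks is at most the product of the square brackets; replacing
`m` by `|m|` makes the powers monotone. -/
theorem IsSymbolTop.topFin {u : E4 d → ℂ} (hu : IsSymbolTop u) : ∃ mp, IsSymbolTopFin mp u := by
  obtain ⟨m, hu⟩ := hu
  refine ⟨|m|, |m|, hu.mono blocks4d_nonneg blocks3d1d_nonneg fun z => ?_⟩
  have h0 := blocks3d1d_nonneg 0 z
  have h1 := blocks3d1d_nonneg 1 z
  simp only [Fin.prod_univ_one, Fin.prod_univ_two, Matrix.cons_val_zero, Matrix.cons_val_one]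
  rw [← Real.mul_rpow (Real.sqrt_nonneg _) (Real.sqrt_nonneg _),
    ← Real.sqrt_mul (by linarith)]
  refine rpow_le_rpow_of_le (one_le_sqrt_one_add (blocks4d_nonneg 0 z)) (Real.sqrt_le_sqrt ?_)
    (le_abs_self m) (abs_nonneg m)
  simp only [blocks4d, blocks3d1d, Matrix.cons_val_zero, Matrix.cons_val_one] at *
  nlinarith [mul_nonneg h0 h1]

theorem IsSymbolTopBot.top {u : E4 d → ℂ} (hu : IsSymbolTopBot u) : IsSymbolTop u := by
  obtain ⟨m, hu⟩ := hu
  refine ⟨|m|, (hu 0).mono blocks2d2d_nonneg blocks4d_nonneg fun z => ?_⟩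
  simp only [Fin.prod_univ_one, Fin.prod_univ_two, Matrix.cons_val_zero, Matrix.cons_val_one,
    Real.rpow_zero, mul_one]
  refine rpow_le_rpow_of_le (one_le_sqrt_one_add (blocks2d2d_nonneg 0 z)) (Real.sqrt_le_sqrt ?_)
    (le_abs_self m) (abs_nonneg m)
  simp only [blocks4d, blocks2d2d, Matrix.cons_val_zero]
  nlinarith [sq_nonneg ‖z.2.2.1‖, sq_nonneg ‖z.2.2.2‖]

theorem sqrt_sum_two_le {a b : ℝ} (ha : 0 ≤ a) (hb : 0 ≤ b) :
    Real.sqrt (1 + (a ^ 2 + b ^ 2)) ≤ (1 + a) * (1 + b) :=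
  Real.sqrt_le_iff.2 ⟨by positivity, by
    have : 0 ≤ a * b := mul_nonneg ha hb
    nlinarith [mul_nonneg ha this, mul_nonneg hb this, sq_nonneg (a * b)]⟩

theorem one_add_norm_le_two_mul_sqrt (z : E d × E d) :
    1 + ‖z‖ ≤ 2 * Real.sqrt (1 + (‖z.1‖ ^ 2 + ‖z.2‖ ^ 2)) := by
  have h1 : ‖z.1‖ ≤ Real.sqrt (1 + (‖z.1‖ ^ 2 + ‖z.2‖ ^ 2)) :=
    Real.le_sqrt_of_sq_le (by nlinarith [sq_nonneg ‖z.2‖])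
  have h2 : ‖z.2‖ ≤ Real.sqrt (1 + (‖z.1‖ ^ 2 + ‖z.2‖ ^ 2)) :=
    Real.le_sqrt_of_sq_le (by nlinarith [sq_nonneg ‖z.1‖])
  have h3 : 1 ≤ Real.sqrt (1 + (‖z.1‖ ^ 2 + ‖z.2‖ ^ 2)) := one_le_sqrt_one_add (by positivity)
  have h4 : ‖z‖ ≤ Real.sqrt (1 + (‖z.1‖ ^ 2 + ‖z.2‖ ^ 2)) := max_le h1 h2
  linarith

/-- Decay of order `r` in `z` comes from the symbol estimate at order `-r`; the factor `2^r`
compares `1 + |z|` in the sup norm with the Euclidean bracket. -/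
theorem IsSymbolTopBot.rapidDecay {u : E4 d → ℂ} (hu : IsSymbolTopBot u) :
    ∃ M, RapidDecay M u := by
  obtain ⟨m, hu⟩ := hu
  obtain ⟨M, hM⟩ := exists_nat_ge m
  refine ⟨M, fun N r => (hu (-r)).derivBound blocks2d2d_nonneg (C := 2 ^ r) (by positivity)
    (fun w => ?_) N⟩
  simp only [Fin.prod_univ_two, Matrix.cons_val_zero, Matrix.cons_val_one]
  have h1 : Real.sqrt (1 + blocks2d2d d 0 w) ^ m ≤ ((1 + ‖w.1‖) * (1 + ‖w.2.1‖)) ^ M :=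
    rpow_le_pow_of_le (one_le_sqrt_one_add (blocks2d2d_nonneg 0 w))
      (sqrt_sum_two_le (norm_nonneg _) (norm_nonneg _)) hM
  have h2 : Real.sqrt (1 + blocks2d2d d 1 w) ^ (-(r : ℝ)) ≤ 2 ^ r * dec r w.2.2 := by
    have h3 : 1 ≤ Real.sqrt (1 + blocks2d2d d 1 w) := one_le_sqrt_one_add (blocks2d2d_nonneg 1 w)
    have h4 : 1 + ‖w.2.2‖ ≤ 2 * Real.sqrt (1 + blocks2d2d d 1 w) :=
      one_add_norm_le_two_mul_sqrt w.2.2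
    rw [Real.rpow_neg (by linarith), Real.rpow_natCast]
    unfold dec
    rw [← div_eq_mul_inv, inv_eq_one_div, div_le_div_iff₀ (by positivity) (by positivity), one_mul,
      ← mul_pow]
    exact pow_le_pow_left₀ (by positivity) h4 r
  calc _ ≤ ((1 + ‖w.1‖) * (1 + ‖w.2.1‖)) ^ M * (2 ^ r * dec r w.2.2) :=
        mul_le_mul h1 h2 (Real.rpow_nonneg (Real.sqrt_nonneg _) _) (by positivity)
    _ = _ := by rw [mul_pow]; ring

theorem IsSymbolTopFin.derivBound {mp : ℝ} {u : E4 d → ℂ} (hu : IsSymbolTopFin mp u) :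
    ∃ M : ℕ, ∀ N, DerivBound N (fun _ : Unit => u) (fun _ w =>
      (1 + ‖w.1‖) ^ M * (1 + ‖w.2.1‖) ^ M * (1 + ‖w.2.2.1‖) ^ M *
        Real.sqrt (1 + ‖w.2.2.2‖ ^ 2) ^ mp) := by
  obtain ⟨m, hu⟩ := hu
  obtain ⟨M, hM⟩ := exists_nat_ge m
  refine ⟨M, fun N => hu.derivBound blocks3d1d_nonneg zero_le_one (fun w => ?_) N⟩
  simp only [Fin.prod_univ_two, Matrix.cons_val_zero, Matrix.cons_val_one, one_mul]
  have h1 : Real.sqrt (1 + blocks3d1d d 0 w) ^ m ≤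
      ((1 + ‖w.1‖) * (1 + ‖w.2.1‖) * (1 + ‖w.2.2.1‖)) ^ M := by
    refine rpow_le_pow_of_le (one_le_sqrt_one_add (blocks3d1d_nonneg 0 w)) ?_ hM
    have ha := norm_nonneg w.1
    have hb := norm_nonneg w.2.1
    have hc := norm_nonneg w.2.2.1
    -- The auxiliary number `|x| + |y| + |x||y|` is `(1 + |x|)(1 + |y|) - 1`, so the two-term
    -- inequality `sqrt_sum_two_le` gives the three-fold product.
    have h2 : Real.sqrt (1 + blocks3d1d d 0 w) ≤ Real.sqrt
        (1 + ((‖w.1‖ + ‖w.2.1‖ + ‖w.1‖ * ‖w.2.1‖) ^ 2 + ‖w.2.2.1‖ ^ 2)) := by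
      refine Real.sqrt_le_sqrt ?_
      simp only [blocks3d1d, Matrix.cons_val_zero]
      have hab := mul_nonneg ha hb
      nlinarith [mul_nonneg ha hab, mul_nonneg hb hab, sq_nonneg (‖w.1‖ * ‖w.2.1‖)]
    refine (h2.trans (sqrt_sum_two_le (by positivity) hc)).trans (le_of_eq ?_)
    ring
  rw [mul_pow, mul_pow] at h1
  exact mul_le_mul_of_nonneg_right h1 (Real.rpow_nonneg (Real.sqrt_nonneg _) _)

/-- As `(1 + |p|)^{-k} ≤ ⟨p⟩^{-k}`, the integrand is at most `⟨p⟩^{mp - k}`, integrable since `k -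
mp > d`. This is where the condition on `k` enters. -/
theorem integrable_sqrt_rpow_mul_dec {mp : ℝ} {k : ℕ} (hk : mp + d < k) :
    Integrable fun p : E d => Real.sqrt (1 + ‖p‖ ^ 2) ^ mp * dec k p := by
  have h := integrable_rpow_neg_one_add_norm_sq (E := E d) (μ := volume) (r := k - mp)
    (by simp; linarith)
  refine h.mono' ?_ (Eventually.of_forall fun p => ?_)
  · have h1 : Continuous fun p : E d => Real.sqrt (1 + ‖p‖ ^ 2) ^ mp :=
      Continuous.rpow_const (by fun_prop) fun p =>
        Or.inl (by have := one_le_sqrt_one_add (sq_nonneg ‖p‖); positivity)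
    exact (h1.mul (continuous_dec k)).aestronglyMeasurable
  · have h1 := one_le_sqrt_one_add (sq_nonneg ‖p‖)
    have h2 : 0 < Real.sqrt (1 + ‖p‖ ^ 2) := by linarith
    rw [Real.norm_of_nonneg (mul_nonneg (Real.rpow_nonneg h2.le _) (dec_pos k p).le)]
    have h3 : dec k p ≤ Real.sqrt (1 + ‖p‖ ^ 2) ^ (-(k : ℝ)) := by
      rw [Real.rpow_neg h2.le, Real.rpow_natCast]
      exact inv_anti₀ (by positivity)
        (pow_le_pow_left₀ h2.le (sqrt_one_add_sq_le (norm_nonneg p)) k)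
    have h4 : (1 + ‖p‖ ^ 2) ^ (-((k : ℝ) - mp) / 2) =
        Real.sqrt (1 + ‖p‖ ^ 2) ^ mp * Real.sqrt (1 + ‖p‖ ^ 2) ^ (-(k : ℝ)) := by
      rw [← Real.rpow_add h2, Real.sqrt_eq_rpow, ← Real.rpow_mul (by positivity)]
      congr 1
      ring
    rw [h4]
    exact mul_le_mul_of_nonneg_left h3 (Real.rpow_nonneg h2.le _)

/-- A common natural bound for four orders. -/
theorem exists_order_bound (m : Fin 4 → ℝ) : ∃ M : ℕ, ∀ j, |m j| ≤ M := by
  obtain ⟨M, hM⟩ := exists_nat_ge (∑ j, |m j|)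
  exact ⟨M, fun j => (Finset.single_le_sum (f := fun j => |m j|) (fun _ _ => abs_nonneg _)
    (Finset.mem_univ j)).trans hM⟩

theorem sqrt_blocksDDDD_le (j : Fin 4) (w : E4 d) :
    Real.sqrt (1 + blocksDDDD d j w) ≤ 1 + ‖w‖ := by
  obtain ⟨h1, h2, h3, h4⟩ := norm_le_of_mem w
  have key : ∀ v : E d, ‖v‖ ≤ ‖w‖ → Real.sqrt (1 + ‖v‖ ^ 2) ≤ 1 + ‖w‖ := fun v hv =>
    (sqrt_one_add_sq_le (norm_nonneg v)).trans (by linarith)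
  fin_cases j
  exacts [key _ h1, key _ h2, key _ h3, key _ h4]

/-- Each of the four brackets is at most `1 + |w|` and has order at most `M` in absolute value,
hence the exponent `4M`. -/
theorem dec_le_symbolWeight {m : Fin 4 → ℝ} {M : ℕ} (hM : ∀ j, |m j| ≤ M) (w : E4 d) :
    dec (M * 4) w ≤ symbolWeight (blocksDDDD d) m w := by
  have h : ∏ j, Real.sqrt (1 + blocksDDDD d j w) ^ m j ≤ (1 + ‖w‖) ^ (M * 4) := by
    calc _ ≤ ∏ _j : Fin 4, (1 + ‖w‖) ^ M :=
          Finset.prod_le_prod (fun _ _ => Real.rpow_nonneg (Real.sqrt_nonneg _) _) fun j _ =>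
            rpow_le_pow_of_le (one_le_sqrt_one_add (blocksDDDD_nonneg j w))
              (sqrt_blocksDDDD_le j w) ((le_abs_self _).trans (hM j))
      _ = _ := by rw [Finset.prod_const, pow_mul]; simp
  have h1 := symbolWeight_mul_prod (m := m) blocksDDDD_nonneg w
  calc dec (M * 4) w = (symbolWeight (blocksDDDD d) m w *
        ∏ j, Real.sqrt (1 + blocksDDDD d j w) ^ m j) * dec (M * 4) w := by rw [h1, one_mul]
    _ ≤ (symbolWeight (blocksDDDD d) m w * (1 + ‖w‖) ^ (M * 4)) * dec (M * 4) w := by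
      gcongr
      · exact (dec_pos _ _).le
      · exact symbolWeight_nonneg _ _ _
    _ = _ := by rw [mul_assoc, pow_mul_dec, mul_one]

theorem polyGrowth_of_isSymbolDDDD {m : Fin 4 → ℝ} {M : ℕ} (hM : ∀ j, |m j| ≤ M) {u : E4 d → ℂ}
    (hu : IsSymbol (blocksDDDD d) m u) : PolyGrowth (M * 4) u := by
  refine ⟨hu.1, fun n => ?_⟩
  obtain ⟨A, hA⟩ := hu.2 n
  refine ⟨A, fun w => ?_⟩
  have h : dec (M * 4) w * ‖iteratedFDeriv ℝ n u w‖ ≤ A :=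
    (mul_le_mul_of_nonneg_right (dec_le_symbolWeight hM w) (norm_nonneg _)).trans (hA ⟨w, rfl⟩)
  calc ‖iteratedFDeriv ℝ n u w‖
      = ((1 + ‖w‖) ^ (M * 4) * dec (M * 4) w) * ‖iteratedFDeriv ℝ n u w‖ := by
        rw [pow_mul_dec, one_mul]
    _ = (dec (M * 4) w * ‖iteratedFDeriv ℝ n u w‖) * (1 + ‖w‖) ^ (M * 4) := by ring
    _ ≤ _ := by gcongr

theorem growthNorm_le_symbolSeminorm {m : Fin 4 → ℝ} {M : ℕ} (hM : ∀ j, |m j| ≤ M) (N : ℕ)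
    (u : SymbolSpace (blocksDDDD d) m) :
    growthNorm N (M * 4) u.val ≤
      ∑ n ∈ Finset.range (N + 1), symbolSeminorm (blocksDDDD d) m n u :=
  Finset.sum_le_sum fun n _ => ciSup_mono (u.isSymbol.2 n) fun w =>
    mul_le_mul_of_nonneg_right (dec_le_symbolWeight hM w) (norm_nonneg _)

theorem isSymbolTop_of_isSymbolDDDD {m : Fin 4 → ℝ} {u : E4 d → ℂ}
    (hu : IsSymbol (blocksDDDD d) m u) : IsSymbolTop u := by
  obtain ⟨M, hM⟩ := exists_order_bound m
  refine ⟨(M * 4 : ℕ), hu.mono blocksDDDD_nonneg blocks4d_nonneg fun w => ?_⟩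
  simp only [Fin.prod_univ_one, Matrix.cons_val_zero]
  have hle : ∀ j, blocksDDDD d j w ≤ blocks4d d 0 w := fun j => by
    fin_cases j <;> simp only [blocksDDDD, blocks4d] <;> simp <;>
      nlinarith [sq_nonneg ‖w.1‖, sq_nonneg ‖w.2.1‖, sq_nonneg ‖w.2.2.1‖, sq_nonneg ‖w.2.2.2‖]
  rw [Real.rpow_natCast, pow_mul]
  calc _ ≤ ∏ _j : Fin 4, Real.sqrt (1 + blocks4d d 0 w) ^ M :=
        Finset.prod_le_prod (fun _ _ => Real.rpow_nonneg (Real.sqrt_nonneg _) _) fun j _ =>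
          rpow_le_pow_of_le (one_le_sqrt_one_add (blocksDDDD_nonneg j w))
            (Real.sqrt_le_sqrt (by linarith [hle j])) ((le_abs_self _).trans (hM j))
    _ = _ := by simp

/-! ### Linear growth of canonical transformations of class `𝓑`. -/

section Canonical

variable {κ : E d × E d ≃ E d × E d}

theorem norm_symm_growth {f : E d × E d → E d × E d} (hf : Differentiable ℝ f) {C : ℝ}
    (hC : 0 ≤ C) (hb : ∀ z, ‖fderiv ℝ f z‖ ≤ C) (z : E d × E d) :
    1 + ‖f z‖ ≤ (1 + C + ‖f 0‖) * (1 + ‖z‖) := by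
  have h := convex_univ.norm_image_sub_le_of_norm_fderiv_le (𝕜 := ℝ) (f := f) (C := C)
    (x := 0) (y := z) (fun z _ => hf z) (fun z _ => hb z) trivial trivial
  rw [sub_zero] at h
  have h1 : ‖f z‖ ≤ ‖f z - f 0‖ + ‖f 0‖ := by simpa using norm_add_le (f z - f 0) (f 0)
  nlinarith [norm_nonneg z, norm_nonneg (f 0), mul_nonneg (norm_nonneg z) (norm_nonneg (f 0))]

theorem IsCanonicalClassB.exists_fderiv_le (hκ : IsCanonicalClassB κ) :
    ∃ C, 0 ≤ C ∧ ∀ z, ‖fderiv ℝ κ z‖ ≤ C := by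
  obtain ⟨A, hA⟩ := hκ.symbol.2 0
  have h : ∀ z, ‖fderiv ℝ κ z‖ ≤ A := fun z => by
    have := hA ⟨z, rfl⟩
    simpa [symbolWeight] using this
  exact ⟨A, (norm_nonneg _).trans (h 0), h⟩

/-- Testing the symplectic identity on `w = (-v₂, v₁)` gives `|v₁|² + |v₂|²` on one side. The other
side is two inner products, each at most `‖Fv‖ · C‖v‖`; hence the factor `2C`. -/
theorem IsCanonical.norm_le_norm_fderiv (hκ : IsCanonical κ) {C : ℝ}
    (hb : ∀ z, ‖fderiv ℝ κ z‖ ≤ C) (z v : E d × E d) : ‖v‖ ≤ 2 * C * ‖fderiv ℝ κ z v‖ := by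
  have hs := hκ.symplectic z v (-v.2, v.1)
  set F := fderiv ℝ κ z with hF
  have hw : ‖((-v.2, v.1) : E d × E d)‖ = ‖v‖ := by
    simp [Prod.norm_def, max_comm]
  have hFw : ‖F (-v.2, v.1)‖ ≤ C * ‖v‖ := by
    rw [← hw]; exact F.le_of_opNorm_le (hb z) _
  simp only [inner_neg_right, real_inner_self_eq_norm_sq, sub_neg_eq_add] at hs
  have h1 : inner ℝ (F v).1 (F (-v.2, v.1)).2 ≤ ‖F v‖ * (C * ‖v‖) :=
    (real_inner_le_norm _ _).trans (mul_le_mul (norm_fst_le _)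
      ((norm_snd_le _).trans hFw) (norm_nonneg _) (norm_nonneg _))
  have h2 : -inner ℝ (F v).2 (F (-v.2, v.1)).1 ≤ ‖F v‖ * (C * ‖v‖) := by
    rw [← inner_neg_left]
    refine (real_inner_le_norm _ _).trans (mul_le_mul ?_
      ((norm_fst_le _).trans hFw) (norm_nonneg _) (norm_nonneg _))
    rw [norm_neg]; exact norm_snd_le _
  have h3 : ‖v‖ ^ 2 ≤ ‖v.1‖ ^ 2 + ‖v.2‖ ^ 2 := by
    rcases max_choice ‖v.1‖ ‖v.2‖ with h | h <;> rw [Prod.norm_def, h] <;>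
      nlinarith [sq_nonneg ‖v.1‖, sq_nonneg ‖v.2‖]
  have h4 : ‖v‖ * ‖v‖ ≤ (2 * C * ‖F v‖) * ‖v‖ := by nlinarith
  rcases (norm_nonneg v).eq_or_lt with h0 | h0
  · rw [← h0]
    have : 0 ≤ C := (norm_nonneg _).trans (hb z)
    positivity
  · exact le_of_mul_le_mul_right h4 h0

/-- By the previous lemma the differential of the inverse is bounded by `2C`, so `κ` and its inverse
are both Lipschitz; the constant terms account for their values at the origin. -/
theorem IsCanonicalClassB.exists_growth (hκ : IsCanonicalClassB κ) : ∃ K, 1 ≤ K ∧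
    (∀ z, 1 + ‖κ z‖ ≤ K * (1 + ‖z‖)) ∧ ∀ z, 1 + ‖z‖ ≤ K * (1 + ‖κ z‖) := by
  obtain ⟨C, hC, hb⟩ := hκ.exists_fderiv_le
  have hd : Differentiable ℝ κ := hκ.contDiff.differentiable (by simp)
  have hd' : Differentiable ℝ κ.symm := hκ.contDiff_symm.differentiable (by simp)
  have hb' : ∀ z, ‖fderiv ℝ κ.symm z‖ ≤ 2 * C := fun z => by
    refine ContinuousLinearMap.opNorm_le_bound _ (by positivity) fun w => ?_
    have h1 := hκ.norm_le_norm_fderiv hb (κ.symm z) (fderiv ℝ κ.symm z w)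
    have h2 : fderiv ℝ κ (κ.symm z) (fderiv ℝ κ.symm z w) = w := by
      have h3 := fderiv_comp z (hd (κ.symm z)) (hd' z)
      rw [κ.self_comp_symm, fderiv_id] at h3
      exact (DFunLike.congr_fun h3 w).symm
    rwa [h2] at h1
  have g1 := norm_symm_growth hd hC hb
  have g2 := norm_symm_growth hd' (by positivity) hb'
  refine ⟨1 + 2 * C + ‖κ 0‖ + ‖κ.symm 0‖, ?_, fun z => ?_, fun z => ?_⟩
  · nlinarith [norm_nonneg (κ 0), norm_nonneg (κ.symm 0)]
  · refine (g1 z).trans (mul_le_mul_of_nonneg_right ?_ (by positivity))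
    linarith [norm_nonneg (κ.symm 0)]
  · have := g2 (κ z)
    rw [κ.symm_apply_apply] at this
    refine this.trans (mul_le_mul_of_nonneg_right ?_ (by positivity))
    linarith [norm_nonneg (κ 0)]

end Canonical

end Bounds


/-! ### Duality, smoothing, continuity in the symbol, and conclusion. -/

section Main

open MeasureTheory Filter Topology

variable {d : ℕ}

theorem withSeminorms_symbolSpace {V ι : Type*} [NormedAddCommGroup V] [NormedSpace ℝ V]
    [Fintype ι] (n : ι → V → ℝ) (m : ι → ℝ) : WithSeminorms (symbolSeminorm n m) := ⟨rfl⟩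

namespace WaveData

variable (D : WaveData d)

theorem exists_polyGrowth_swapVar {u : E4 d → ℂ} (hu : ∃ m, PolyGrowth m u) :
    ∃ m, PolyGrowth m (swapVar u) := hu.imp fun _ h => polyGrowth_swapVar h

/-- The dual of the transposed operator, acting on tempered distributions. -/
def dualOp (c : ℂ) (u : E4 d → ℂ) (hu : ∃ m, PolyGrowth m u) : 𝓢'(E d, ℂ) →L[ℂ] 𝓢'(E d, ℂ) :=
  PointwiseConvergenceCLM.precomp ℂ (c • D.swap.opCLM (swapVar u) (exists_polyGrowth_swapVar hu))

theorem dualOp_apply (c : ℂ) {u : E4 d → ℂ} (hu : ∃ m, PolyGrowth m u) (f : 𝓢'(E d, ℂ))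
    (ψ : 𝓢(E d, ℂ)) : D.dualOp c u hu f ψ =
      f (c • D.swap.opCLM (swapVar u) (exists_polyGrowth_swapVar hu) ψ) := rfl

theorem isDualExtension_dualOp (c : ℂ) {u : E4 d → ℂ} (hu : ∃ m, PolyGrowth m u) :
    IsDualExtension (c • D.opCLM u hu) (D.dualOp c u hu) := by
  refine ⟨fun φ => ?_, c • D.swap.opCLM (swapVar u) (exists_polyGrowth_swapVar hu),
    fun f ψ => D.dualOp_apply c hu f ψ⟩
  obtain ⟨m, hm⟩ := id hu
  ext ψ
  rw [dualOp_apply, map_smul, SchwartzMap.coe_apply, SchwartzMap.coe_apply]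
  have h1 : ∀ x, ψ x • (c • D.opCLM u hu) φ x = c * (ψ x * D.op u φ x) := fun x => by
    simp only [smul_apply, opCLM_apply, smul_eq_mul]
    ring
  have h2 : ∀ y, D.swap.opCLM (swapVar u) (exists_polyGrowth_swapVar hu) ψ y • φ y =
      φ y * D.swap.op (swapVar u) ψ y := fun y => by
    rw [opCLM_apply, smul_eq_mul, mul_comm]
  simp only [h1, h2, integral_const_mul, smul_eq_mul]
  rw [D.integral_op_swap hm]

/-- The transposed operator sends `ψ` to `∫ ψ(x) K(x, ·) dx`; applying `f` under the integral shows
that the distribution is integration against the function `f(K(x, ·))`. -/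
theorem isSmoothing_dualOp (c : ℂ) {u : E4 d → ℂ} (hu : ∃ m, PolyGrowth m u) {m : ℕ}
    (hr : RapidDecay m u) : IsSmoothing (D.dualOp c u hu) := by
  refine ⟨c • kernelMap (D.kernel hr), fun f => ?_⟩
  ext ψ
  rw [dualOp_apply, map_smul, SchwartzMap.coe_apply]
  have h := D.functional_swap_opCLM hr (exists_polyGrowth_swapVar hu) f ψ
  have h1 : ∀ x, ψ x • (c • kernelMap (D.kernel hr)) f x =
      c * (ψ x * kernelMap (D.kernel hr) f x) := fun x => by
    simp only [smul_apply, smul_eq_mul]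
    ring
  simp only [h1, integral_const_mul, smul_eq_mul]
  rw [← h]
  rfl

theorem seminorm_opCLM_le {u : E4 d → ℂ} (hu : ∃ m, PolyGrowth m u) {k n : ℕ} {φ : 𝓢(E d, ℂ)}
    {A : ℝ} (hA : 0 ≤ A) (h : ∀ x, ‖x‖ ^ k * ‖iteratedFDeriv ℝ n (D.op u φ) x‖ ≤ A) :
    SchwartzMap.seminorm ℂ k n (D.opCLM u hu φ) ≤ A :=
  SchwartzMap.seminorm_le_bound ℂ k n _ hA h

theorem exists_polyGrowth_val {m : Fin 4 → ℝ} (u : SymbolSpace (blocksDDDD d) m) :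
    ∃ M, PolyGrowth M u.val :=
  (isSymbolTop_of_isSymbolDDDD u.isSymbol).polyGrowth

/-- The operator as a linear function of its symbol. -/
def opLinear (m : Fin 4 → ℝ) (c : ℂ) :
    SymbolSpace (blocksDDDD d) m →ₗ[ℂ] (𝓢(E d, ℂ) →L[ℂ] 𝓢(E d, ℂ)) where
  toFun u := c • D.opCLM u.val (exists_polyGrowth_val u)
  map_add' u v := by
    obtain ⟨m₁, h₁⟩ := exists_polyGrowth_val u
    obtain ⟨m₂, h₂⟩ := exists_polyGrowth_val v
    ext φ x
    have := D.op_add_left h₁ h₂ φ x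
    change c * D.op (u.val + v.val) φ x = c * D.op u.val φ x + c * D.op v.val φ x
    rw [this, mul_add]
  map_smul' a u := by
    ext φ x
    have := D.op_smul_left u.val a φ x
    change c * D.op (a • u.val) φ x = a * (c * D.op u.val φ x)
    rw [this]
    ring

theorem opLinear_apply (m : Fin 4 → ℝ) (c : ℂ) (u : SymbolSpace (blocksDDDD d) m) :
    D.opLinear m c u = c • D.opCLM u.val (exists_polyGrowth_val u) := rfl

/-- The bound of `exists_op_bound` is a product of norms of `u` and `φ`, and a bounded set of `φ`
makes the second factor a constant `r`. -/
theorem exists_opLinear_bound (m : Fin 4 → ℝ) (c : ℂ) {B : Set 𝓢(E d, ℂ)}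
    (hB : Bornology.IsVonNBounded ℂ B) (k n : ℕ) : ∃ (A : ℝ) (N : ℕ),
      ∀ u : SymbolSpace (blocksDDDD d) m, ∀ φ ∈ B,
        SchwartzMap.seminorm ℂ k n (D.opLinear m c u φ) ≤
          A * ∑ j ∈ Finset.range (N + 1), symbolSeminorm (blocksDDDD d) m j u := by
  obtain ⟨M, hM⟩ := exists_order_bound m
  obtain ⟨N, l, C, hC, hb⟩ := D.exists_op_bound (M * 4) k n
  obtain ⟨r, hr, hBr⟩ := (schwartz_withSeminorms ℂ (E d) ℂ).isVonNBounded_iff_finset_seminorm_bounded.1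
    hB (Finset.Iic (l, N))
  refine ⟨‖c‖ * (C * r), N, fun u φ hφ => ?_⟩
  have hsn : schwartzNorm l N φ ≤ r := (hBr φ hφ).le
  have hg := growthNorm_le_symbolSeminorm hM N u
  have hg0 := growthNorm_nonneg N (M * 4) u.val
  have h1 : SchwartzMap.seminorm ℂ k n (D.opCLM u.val (exists_polyGrowth_val u) φ) ≤
      C * growthNorm N (M * 4) u.val * r := by
    refine D.seminorm_opCLM_le _ (by positivity) fun x => ?_
    refine (hb u.val (polyGrowth_of_isSymbolDDDD hM u.isSymbol) φ x).trans ?_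
    gcongr
  rw [opLinear_apply, smul_apply, map_smul_eq_mul]
  calc _ ≤ ‖c‖ * (C * (∑ j ∈ Finset.range (N + 1), symbolSeminorm (blocksDDDD d) m j u) * r) := by
        refine mul_le_mul_of_nonneg_left (h1.trans ?_) (norm_nonneg c)
        gcongr
    _ = _ := by ring

theorem continuous_opLinear (m : Fin 4 → ℝ) (c : ℂ) : Continuous (D.opLinear m c) := by
  have hw := withSeminorms_symbolSpace (blocksDDDD d) m
  have := hw.topologicalAddGroup
  refine continuous_of_continuousAt_zero _ ?_
  rw [ContinuousAt, map_zero, ContinuousLinearMap.hasBasis_nhds_zero.tendsto_right_iff]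
  rintro ⟨B, U⟩ ⟨hB, hU⟩
  -- A basic neighbourhood of zero for uniform convergence on bounded sets is a pair `(B, U)`; `U`
  -- contains a ball of finitely many seminorms, so finitely many symbol estimates suffice.
  obtain ⟨s, r, hr, hs⟩ := ((schwartz_withSeminorms ℂ (E d) ℂ).mem_nhds_iff _ _).1 hU
  choose A N hA using D.exists_opLinear_bound m c hB
  have hev : ∀ᶠ u in 𝓝 (0 : SymbolSpace (blocksDDDD d) m), ∀ i ∈ s,
      A i.1 i.2 * ∑ j ∈ Finset.range (N i.1 i.2 + 1), symbolSeminorm (blocksDDDD d) m j u < r := by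
    refine s.eventually_all.2 fun i _ => ?_
    have hcont : Continuous fun u : SymbolSpace (blocksDDDD d) m =>
        A i.1 i.2 * ∑ j ∈ Finset.range (N i.1 i.2 + 1), symbolSeminorm (blocksDDDD d) m j u :=
      continuous_const.mul (continuous_finsetSum _ fun j _ => hw.continuous_seminorm j)
    refine hcont.continuousAt.eventually (gt_mem_nhds ?_)
    simpa using hr
  filter_upwards [hev] with u hu φ hφ
  refine hs ?_
  rw [Seminorm.mem_ball, sub_zero]
  exact Seminorm.finset_sup_apply_lt hr fun i hi => (hA i.1 i.2 u φ hφ).trans_lt (hu i hi)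

end WaveData

/-- One operator serves every admissible pair `(mp, k)`, because each defining integral equals the
same iterated integral. -/
theorem isFourierOp_opCLM {κ : E d × E d ≃ E d × E d} {S : E d × E d → ℝ}
    {Θx Θy : Matrix (Fin d) (Fin d) ℂ} (hx : (Θx.map Complex.re).PosDef)
    (hy : (Θy.map Complex.re).PosDef) {ε : ℝ} (hε : 0 < ε) (hκ : Continuous κ) (hS : Continuous S)
    {K : ℝ} (hK : 1 ≤ K) (h1 : ∀ z, 1 + ‖κ z‖ ≤ K * (1 + ‖z‖))
    (h2 : ∀ z, 1 + ‖z‖ ≤ K * (1 + ‖κ z‖)) (hΘ : Θy.IsSymm) {u : E4 d → ℂ} (hu : IsSymbolTop u)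
    (hu' : ∃ m, PolyGrowth m u) :
    IsFourierOp κ S Θx Θy ε u (((((2 * Real.pi * ε) ^ (3 * (d : ℝ) / 2))⁻¹ : ℝ) : ℂ) •
      (canonicalData κ S Θx Θy hx hy hε hκ hS K hK h1 h2).opCLM u hu') := by
  refine ⟨hu.topFin, fun mp k hmp _ hk φ x => ?_⟩
  obtain ⟨M, hM⟩ := hmp.derivBound
  have h := integral_oscIntegrand hx hy hε hκ hS hK h1 h2 hΘ k
    (P := fun p => Real.sqrt (1 + ‖p‖ ^ 2) ^ mp)
    (fun p => Real.rpow_nonneg (Real.sqrt_nonneg _) _) (integrable_sqrt_rpow_mul_dec hk) hM φ x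
  refine ⟨h.1, ?_⟩
  rw [h.2]
  rfl

end Main

end CplxFourier

end

theorem mainTheorem2 {d : ℕ} (κ : CplxFourier.E d × CplxFourier.E d ≃ CplxFourier.E d × CplxFourier.E d)
    (hκ : CplxFourier.IsCanonicalClassB κ)
    (S : CplxFourier.E d × CplxFourier.E d → ℝ) (hS : CplxFourier.IsAction κ S)
    (Θx Θy : Matrix (Fin d) (Fin d) ℂ)
    (hΘx : CplxFourier.IsAdmissible Θx) (hΘy : CplxFourier.IsAdmissible Θy)
    (ε : ℝ) (hε : 0 < ε) (hε1 : ε ≤ 1) :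
    (∀ u : CplxFourier.E4 d → ℂ, CplxFourier.IsSymbolTop u →
      ∃ (T : 𝓢(CplxFourier.E d, ℂ) →L[ℂ] 𝓢(CplxFourier.E d, ℂ))
        (T' : 𝓢'(CplxFourier.E d, ℂ) →L[ℂ] 𝓢'(CplxFourier.E d, ℂ)),
        CplxFourier.IsFourierOp κ S Θx Θy ε u T ∧ CplxFourier.IsDualExtension T T') ∧
    (∀ mx my mq mp : ℝ,
      ∃ Op : CplxFourier.SymbolSpace (CplxFourier.blocksDDDD d) ![mx, my, mq, mp] →L[ℂ]
          (𝓢(CplxFourier.E d, ℂ) →L[ℂ] 𝓢(CplxFourier.E d, ℂ)),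
        ∀ u, CplxFourier.IsFourierOp κ S Θx Θy ε u.val (Op u)) ∧
    (∀ u : CplxFourier.E4 d → ℂ, CplxFourier.IsSymbolTopBot u →
      ∃ (T : 𝓢(CplxFourier.E d, ℂ) →L[ℂ] 𝓢(CplxFourier.E d, ℂ))
        (T' : 𝓢'(CplxFourier.E d, ℂ) →L[ℂ] 𝓢'(CplxFourier.E d, ℂ)),
        CplxFourier.IsFourierOp κ S Θx Θy ε u T ∧ CplxFourier.IsDualExtension T T' ∧
          CplxFourier.IsSmoothing T') := by
  open CplxFourier in
  obtain ⟨K, hK, h1, h2⟩ := hκ.exists_growth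
  let D := canonicalData κ S Θx Θy hΘx.2 hΘy.2 hε hκ.contDiff.continuous hS.1.continuous K hK h1 h2
  let c : ℂ := (((2 * Real.pi * ε) ^ (3 * (d : ℝ) / 2))⁻¹ : ℝ)
  have hF : ∀ {u : E4 d → ℂ} (_ : IsSymbolTop u) (hu' : ∃ m, PolyGrowth m u),
      IsFourierOp κ S Θx Θy ε u (c • D.opCLM u hu') := fun hu hu' =>
    isFourierOp_opCLM hΘx.2 hΘy.2 hε hκ.contDiff.continuous hS.1.continuous hK h1 h2 hΘy.1 hu hu'
  refine ⟨fun u hu => ?_, fun mx my mq mp => ?_, fun u hu => ?_⟩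
  · exact ⟨c • D.opCLM u hu.polyGrowth, D.dualOp c u hu.polyGrowth, hF hu _,
      D.isDualExtension_dualOp c _⟩
  · exact ⟨⟨D.opLinear _ c, D.continuous_opLinear _ c⟩, fun u =>
      hF (isSymbolTop_of_isSymbolDDDD u.isSymbol) _⟩
  · obtain ⟨M, hM⟩ := hu.rapidDecay
    exact ⟨c • D.opCLM u hu.top.polyGrowth, D.dualOp c u hu.top.polyGrowth, hF hu.top _,
      D.isDualExtension_dualOp c _, D.isSmoothing_dualOp c _ hM⟩
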